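/- **Setting.** A pattern is a closed subset of $\mathbb R^d$; the set $\mathcal C(\mathbb R^d)$ of patterns carries the Fell topology, and $\mathbb R^d$ acts on it by $S\mapsto S-t$. A set of patterns is uniformly separated if there is one non-empty open $U$ such that each of its patterns meets each translate of $U$ in at most one point. The transversal of a pattern $\mathcal L$ is $$\Xi_{\mathcal L}=\overline{\{S\in\Omega^\times_{\mathcal L}: 0\in S\}},\qquad \Omega_{\mathcal L}^\times=\overline{\{\mathcal L-t:t\in\mathbb R^d\}}\setminus\{\emptyset\},$$ and the transversal of a finite family $\mathfrak L$ of patterns is $\Xi=\bigcup_{\mathcal L\in\mathfrak L}\Xi_{\mathcal L}$. For a set $Y$ of patterns let $\mathcal G_Y=\{(x,S):S\in Y,\ x\in S\}$, with the topology of $\mathbb R^d\times\mathcal C(\mathbb R^d)$, source $S$, range $S-x$, inverse $(-x,S-x)$ and product $(x',S-x)(x,S)=(x'+x,S)$. A subset $Y\subseteq \Xi$ is invariant under the groupoid if $S-x\in Y$ for all $(x,S)\in\mathcal G_Y$. For $Y$ a closed invariant subset of $\Xi$, or a difference of two such sets, $C^*\mathcal G_Y$ is the full groupoid C*-algebra,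 i.e. the completion of the convolution algebra $C_c(\mathcal G_Y)$ (counting measures on the fibres) in the supremum of the norms of all its I-norm bounded *-representations on Hilbert spaces. A group $\Sigma$ of linear isometries of $\mathbb R^d$ acts on patterns by $S\mapsto\sigma(S)$ and on arrows by $(x,S)\mapsto(\sigma x,\sigma S)$. **A. Cofiltrations.** Let $\mathfrak L$ be a finite family of uniformly separated patterns in $\mathbb R^d$ with transversal $\Xi$, let $\Sigma\subset O(d)$ be a finite group leaving $\Xi$ invariant, and let $\Xi_0\subseteq\Xi_1\subseteq\dots\subseteq\Xi_n=\Xi$ be closed subsets, each of them invariant under the groupoid and under $\Sigma$. Then $\Sigma$ acts on each $C^*\mathcal G_{\Xi_r}$ by *-automorphisms induced by $f\mapsto f\circ\sigma^{-1}$, and restriction of functions induces surjective $\Sigma$-equivariant *-homomorphisms $$C^*\mathcal G_{\Xi_n}\twoheadrightarrow C^*\mathcal G_{\Xi_{n-1}}\twoheadrightarrow\cdots\twoheadrightarrow C^*\mathcal G_{\Xi_0}.$$ Extension of functions by zero induces an injective *-homomorphism $C^*\mathcal G_{\Xi_r\setminus\Xi_{r-1}}\to C^*\mathcal G_{\Xi_r}$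 whose image is $\operatorname{Ker}(C^*\mathcal G_{\Xi_r}\to C^*\mathcal G_{\Xi_{r-1}})$, for $1\le r\le n$. ("Equivariant cofiltration" below means all of this.) **B. Crystals.** Let $0\le k\le d$ and let $(\mathfrak L,\Sigma)$ be one of the following. The point group of $\mathfrak L$ is the group of all $\sigma\in O(d)$ that permute $\mathfrak L$ and fix the unit vectors $e_i$, $i>k$. * *Corner geometry* (the quarter geometry for $k=2$): $\mathfrak L=\{\mathbb N^k\times\mathbb Z^{d-k}\}$ with $0\in\mathbb N$, and $\Sigma$ is its point group. * *Box geometry* (the square geometry for $k=2$, the cube geometry for $k=d=3$): $\mathfrak L=\{\epsilon_1\mathbb N\times\dots\times\epsilon_k\mathbb N\times\mathbb Z^{d-k}:\epsilon\in\{\pm1\}^k\}$, and $\Sigma$ is any subgroup of its point group that contains all elements of the point group of determinant $1$. Let $\Xi$ be the transversal of $\mathfrak L$ and $\mathcal L_\infty=\mathbb Z^d$. The codimension of a pattern $S$ is $d$ minus the maximal number of linearly independent $v\in\mathbb R^d$ with $S-v=S$. Put $\Xi_r=\{S\in\Xi:\operatorname{codim}S\le r\}$ for $0\le r\le k$. Then: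 1. $\mathfrak L$ is a finite family of uniformly separated patterns, $\Sigma$ is finite, and $\Xi$ is invariant under $\Sigma$. 2. $\{\mathcal L_\infty\}=\Xi_0\subsetneq\Xi_1\subsetneq\dots\subsetneq\Xi_k=\Xi$, and all $\Xi_r$ are closed and invariant under the groupoid and under $\Sigma$. (For $k=d$ this is a filtration of length $d$.) 3. It is the only strictly increasing filtration $\{\mathcal L_\infty\}=F_0\subsetneq\dots\subsetneq F_k=\Xi$ of length $k$ by closed sets that are invariant under the groupoid and under $\Sigma$. 4. It yields a $\Sigma$-equivariant cofiltration of $C^*\mathcal G_\Xi$, with kernels $C^*\mathcal G_{\Xi_r\setminus\Xi_{r-1}}$, where $\Xi_r\setminus\Xi_{r-1}$ consists of the patterns in $\Xi$ of codimension $r$. 5. These kernels are the algebras of observables localized to the boundaries of codimension $r$, and this property determines the filtration. Precisely: call $y\in S$ a site on the boundaries of codimension $r$ of $S$ if for at least $r$ indices $i$ one of $y\pm e_i$ is not in $S$, and call $f\in C_c(\mathcal G_Y)$ localized to them if there is an $R$ such that $f(x,S)\neq0$ implies that $S$ has such a site $y$ with $|y|\le R$. Let $\{\mathcal L_\infty\}=F_0\subseteq\dots\subseteq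 F_k=\Xi$ be closed groupoid-invariant sets. Then $F_r=\Xi_r$ for all $r$ if and only if, for each $1\le r\le k$, $\operatorname{Ker}(C^*\mathcal G_{F_r}\to C^*\mathcal G_{F_{r-1}})$ is the closure of the set of all $f\in C_c(\mathcal G_{F_r})$ that are localized to the boundaries of codimension $r$. -/

import Mathlib

open Set Topology
open scoped ENNReal CompactlySupported

noncomputable section

namespace Crystal

/-! ### The space of patterns -/

/-- The space `ℝ^d`. -/
abbrev Space (d : ℕ) : Type := EuclideanSpace ℝ (Fin d)

/-- A pattern in `ℝ^d` is a closed subset of `ℝ^d`. -/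
structure Pattern (d : ℕ) : Type where
  carrier : Set (Space d)
  isClosed' : IsClosed carrier

namespace Pattern

variable {d : ℕ}

instance : SetLike (Pattern d) (Space d) where
  coe := Pattern.carrier
  coe_injective := by
    rintro ⟨S, hS⟩ ⟨T, hT⟩ h
    cases h
    rfl

/-- The Fell topology on the set of closed subsets of `ℝ^d`. -/
instance fellTopology : TopologicalSpace (Pattern d) :=
  TopologicalSpace.generateFrom
    ({A | ∃ K : Set (Space d), IsCompact K ∧ A = {S : Pattern d | Disjoint (S : Set (Space d)) K}} ∪
      {A | ∃ U : Set (Space d), IsOpen U ∧ A = {S : Pattern d | ((S : Set (Space d)) ∩ U).Nonempty}})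

/-- The translate `S - t = {y | y + t ∈ S}` of a pattern, i.e. the action of `t ∈ ℝ^d`. -/
def shift (S : Pattern d) (t : Space d) : Pattern d where
  carrier := {y | y + t ∈ S}
  isClosed' := S.isClosed'.preimage (by fun_prop : Continuous fun y : Space d => y + t)

/-- The image `σ(S)` of a pattern under a linear isometry `σ ∈ O(d)`. -/
def map (σ : Space d ≃ₗᵢ[ℝ] Space d) (S : Pattern d) : Pattern d where
  carrier := {y | σ.symm y ∈ S}
  isClosed' := S.isClosed'.preimage σ.symm.continuous

theorem map_one (S : Pattern d) : map (1 : Space d ≃ₗᵢ[ℝ] Space d) S = S := rfl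

theorem map_mul (σ τ : Space d ≃ₗᵢ[ℝ] Space d) (S : Pattern d) :
    map (σ * τ) S = map σ (map τ S) := rfl

end Pattern

/-- All patterns in `Y` are separated by translates of one and the same non-empty open set `U`:
each of them meets each translate `U - x` in at most one point. -/
def UniformlySeparated {d : ℕ} (Y : Set (Pattern d)) : Prop :=
  ∃ U : Set (Space d), IsOpen U ∧ U.Nonempty ∧
    ∀ S ∈ Y, ∀ x : Space d, ((S : Set (Space d)) ∩ ((fun u => u - x) '' U)).Subsingleton

/-- The punctured hull of a pattern: the closure of its translation orbit, without the
empty pattern. -/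
def hull {d : ℕ} (L : Pattern d) : Set (Pattern d) :=
  closure (range L.shift) \ {S | (S : Set (Space d)) = ∅}

/-- The canonical transversal of a pattern. -/
def transversal {d : ℕ} (L : Pattern d) : Set (Pattern d) :=
  closure {S | S ∈ hull L ∧ (0 : Space d) ∈ S}

/-- The global transversal of a family of patterns. -/
def globalTransversal {d : ℕ} (𝓛 : Set (Pattern d)) : Set (Pattern d) :=
  ⋃ L ∈ 𝓛, transversal L

/-! ### The groupoid of a transversal and its C*-algebra -/

/-- The (arrows of the) groupoid `𝒢_Y` over a set `Y` of patterns: pairs `(x, S)` with `S ∈ Y` and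
`x ∈ S`, with source `S`, range `S - x`, inverse `(x, S)⁻¹ = (-x, S - x)` and product
`(x', S - x) (x, S) = (x' + x, S)`. It carries the subspace topology of `ℝ^d × Pattern d`. -/
def arrows {d : ℕ} (Y : Set (Pattern d)) : Set (Space d × Pattern d) :=
  {γ | γ.2 ∈ Y ∧ γ.1 ∈ γ.2}

/-- Invariance of a set of units under the groupoid action: it contains the range `S - x` of every
arrow `(x, S)` whose source `S` it contains. -/
def GroupoidInvariant {d : ℕ} (Y : Set (Pattern d)) : Prop :=
  ∀ S ∈ Y, ∀ x ∈ S, S.shift x ∈ Y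

/-- Invariance of a set of patterns under a group of linear isometries. -/
def PointInvariant {d : ℕ} (G : Subgroup (Space d ≃ₗᵢ[ℝ] Space d)) (Y : Set (Pattern d)) : Prop :=
  ∀ σ ∈ G, ∀ S ∈ Y, S.map σ ∈ Y

/-- The convolution algebra `C_c(𝒢_Y)`, as a vector space. -/
abbrev Cc {d : ℕ} (Y : Set (Pattern d)) : Type := C_c(arrows Y, ℂ)

/-- Extension by zero of a function on `𝒢_Y` to all pairs `(x, S)`. -/
def ext {d : ℕ} {Y : Set (Pattern d)} (f : Cc Y) : Space d × Pattern d → ℂ :=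
  Function.extend Subtype.val f 0

/-- `h = f * g` is the convolution `h(γ) = ∑_{γ = γ₁γ₂} f(γ₁) g(γ₂)` for the counting measures on
the fibres. (If `Y` is invariant and uniformly separated then `𝒢_Y` is étale, all these sums are
finite, and every pair `f, g` in `C_c(𝒢_Y)` has a convolution in `C_c(𝒢_Y)`.) -/
def IsConvolution {d : ℕ} {Y : Set (Pattern d)} (f g h : Cc Y) : Prop :=
  ∀ γ : arrows Y, h γ =
    ∑ᶠ y : (γ.1.2 : Set (Space d)), ext f (γ.1.1 - y, γ.1.2.shift y) * ext g (y, γ.1.2)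

/-- `g = f*` is the adjoint `g(γ) = conj (f(γ⁻¹))`. -/
def IsAdjoint {d : ℕ} {Y : Set (Pattern d)} (f g : Cc Y) : Prop :=
  ∀ γ : arrows Y, g γ = star (ext f (-γ.1.1, γ.1.2.shift γ.1.1))

/-- The I-norm on `C_c(𝒢_Y)`: the larger one of the suprema of the `ℓ¹`-norms of `f` along the
fibres of the source and of the range map. -/
def iNorm {d : ℕ} {Y : Set (Pattern d)} (f : Cc Y) : ℝ≥0∞ :=
  max (⨆ S ∈ Y, ∑' x : (S : Set (Space d)), ‖ext f ((x : Space d), S)‖ₑ)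
    (⨆ S ∈ Y, ∑' x : (S : Set (Space d)), ‖ext f (-(x : Space d), S.shift x)‖ₑ)

/-- An I-norm bounded *-representation of the convolution algebra `C_c(𝒢_Y)` on a Hilbert space
(possibly degenerate, which does not affect the norm below). Every such representation is a direct
sum of cyclic ones and a zero one, and the cyclic ones are small enough to live in `Type`. -/
structure Rep {d : ℕ} (Y : Set (Pattern d)) : Type 1 where
  H : Type
  [normedAddCommGroup : NormedAddCommGroup H]
  [innerProductSpace : InnerProductSpace ℂ H]
  [completeSpace : CompleteSpace H]
  toFun : Cc Y →ₗ[ℂ] (H →L[ℂ] H)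
  map_convolution : ∀ f g h : Cc Y, IsConvolution f g h → toFun h = toFun f * toFun g
  map_adjoint : ∀ f g : Cc Y, IsAdjoint f g → toFun g = star (toFun f)
  bounded : ∀ f : Cc Y, ‖toFun f‖ₑ ≤ iNorm f

attribute [instance] Rep.normedAddCommGroup Rep.innerProductSpace Rep.completeSpace

/-- The C*-algebra of bounded families `(a_π)` of operators, indexed by the representations. -/
abbrev RepProduct {d : ℕ} (Y : Set (Pattern d)) : Type 1 :=
  lp (fun π : Rep Y => π.H →L[ℂ] π.H) ∞

theorem exists_card_bound {d : ℕ} {Y : Set (Pattern d)} (hY : UniformlySeparated Y)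
    {K : Set (Space d)} (hK : IsCompact K) :
    ∃ N : ℕ, ∀ S ∈ Y, ((S : Set (Space d)) ∩ K).encard ≤ N := by
  obtain ⟨U, hU, ⟨u, hu⟩, hsep⟩ := hY
  have hopen : ∀ x : Space d, IsOpen ((fun u => u - x) '' U) := fun x =>
    (Homeomorph.subRight x).isOpenMap U hU
  obtain ⟨t, ht⟩ := hK.elim_finite_subcover (fun x : Space d => (fun u => u - x) '' U) hopen
    (fun y _ => mem_iUnion.2 ⟨u - y, u, hu, by simp⟩)
  refine ⟨t.card, fun S hS => ?_⟩
  have hsub : (S : Set (Space d)) ∩ K ⊆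
      ⋃ x ∈ t, (S : Set (Space d)) ∩ ((fun u => u - x) '' U) := by
    rintro y ⟨hyS, hyK⟩
    obtain ⟨x, hx, hyx⟩ := mem_iUnion₂.1 (ht hyK)
    exact mem_iUnion₂.2 ⟨x, hx, hyS, hyx⟩
  have hfin : ∀ s : Finset (Space d),
      (⋃ x ∈ s, (S : Set (Space d)) ∩ ((fun u => u - x) '' U)).encard ≤ s.card := by
    classical
    intro s
    induction s using Finset.induction_on with
    | empty => simp
    | insert a s ha ih =>
      rw [Finset.set_biUnion_insert, Finset.card_insert_of_notMem ha, Nat.cast_add, add_comm]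
      refine (encard_union_le _ _).trans (add_le_add ?_ ih)
      exact_mod_cast encard_le_one_iff_subsingleton.2 (hsep S hS a)
  exact (encard_le_encard hsub).trans (hfin t)

/-- For uniformly separated `Y` the I-norm is finite, so that the representations are uniformly
bounded on each element of `C_c(𝒢_Y)`. -/
theorem iNorm_lt_top {d : ℕ} {Y : Set (Pattern d)} (hY : UniformlySeparated Y) (f : Cc Y) :
    iNorm f < ∞ := by
  obtain ⟨C, hC⟩ := f.hasCompactSupport.isCompact_range f.continuous |>.isBounded.exists_norm_le
  set K : Set (Space d) := (fun γ : arrows Y => γ.1.1) '' tsupport f with hKdef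
  have hK : IsCompact K := f.hasCompactSupport.isCompact.image (by fun_prop)
  have hsupp : ∀ γ : Space d × Pattern d, γ.1 ∉ K → ext f γ = 0 := by
    intro γ hγ
    by_cases h : ∃ γ' : arrows Y, γ'.1 = γ
    · obtain ⟨γ', rfl⟩ := h
      rw [ext, Subtype.val_injective.extend_apply]
      by_contra h0
      exact hγ ⟨γ', subset_tsupport _ h0, rfl⟩
    · rw [ext, Function.extend_apply' _ _ _ h]
      rfl
  have hbound : ∀ γ : Space d × Pattern d, ‖ext f γ‖ₑ ≤ ENNReal.ofReal C := by
    intro γ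
    by_cases h : ∃ γ' : arrows Y, γ'.1 = γ
    · obtain ⟨γ', rfl⟩ := h
      rw [ext, Subtype.val_injective.extend_apply, ← ofReal_norm]
      exact ENNReal.ofReal_le_ofReal (hC _ ⟨γ', rfl⟩)
    · rw [ext, Function.extend_apply' _ _ _ h]
      simp
  have key : ∀ K' : Set (Space d), IsCompact K' → ∃ M : ℝ≥0∞, M < ∞ ∧ ∀ S ∈ Y,
      ∀ φ : Space d → ℝ≥0∞, (∀ x, φ x ≤ ENNReal.ofReal C) → (∀ x ∉ K', φ x = 0) →
        ∑' x : (S : Set (Space d)), φ x ≤ M := by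
    intro K' hK'
    obtain ⟨N, hN⟩ := exists_card_bound hY hK'
    refine ⟨N * ENNReal.ofReal C, ENNReal.mul_lt_top (by simp) (by simp), ?_⟩
    intro S hS φ h1 h2
    have hle : ∀ x : Space d, (S : Set (Space d)).indicator φ x ≤
        ((S : Set (Space d)) ∩ K').indicator (fun _ => ENNReal.ofReal C) x := by
      intro x
      by_cases hx : x ∈ (S : Set (Space d))
      · by_cases hxK : x ∈ K'
        · rw [indicator_of_mem hx, indicator_of_mem (mem_inter hx hxK)]
          exact h1 x
        · rw [indicator_of_mem hx, h2 x hxK]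
          exact zero_le
      · rw [indicator_of_notMem hx]
        exact zero_le
    rw [tsum_subtype (S : Set (Space d)) φ]
    refine (ENNReal.tsum_le_tsum hle).trans ?_
    rw [← tsum_subtype, ENNReal.tsum_const]
    gcongr
    have h := hN S hS
    rw [← ENat.card_coe_set_eq] at h
    exact_mod_cast h
  obtain ⟨M₁, hM₁, h₁⟩ := key K hK
  obtain ⟨M₂, hM₂, h₂⟩ := key (Neg.neg '' K) (hK.image continuous_neg)
  refine max_lt (lt_of_le_of_lt (iSup₂_le fun S hS => ?_) hM₁)
    (lt_of_le_of_lt (iSup₂_le fun S hS => ?_) hM₂)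
  · exact h₁ S hS (fun x => ‖ext f (x, S)‖ₑ) (fun x => hbound _)
      fun x hx => by simp [hsupp (x, S) hx]
  · refine h₂ S hS (fun x => ‖ext f (-x, S.shift x)‖ₑ) (fun x => hbound _) fun x hx => ?_
    have : -x ∉ K := fun h => hx ⟨-x, h, neg_neg x⟩
    simp [hsupp (-x, S.shift x) this]

open Classical in
/-- The canonical map `C_c(𝒢_Y) → C*(𝒢_Y)` into the family of all representations,
`f ↦ (π(f))_π`. (The alternative `0` does not occur for uniformly separated `Y`, by
`memℓp_of_uniformlySeparated`.) -/
def toProduct {d : ℕ} {Y : Set (Pattern d)} (f : Cc Y) : RepProduct Y :=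
  if h : Memℓp (fun π : Rep Y => π.toFun f) ∞ then ⟨fun π => π.toFun f, h⟩ else 0

theorem memℓp_of_uniformlySeparated {d : ℕ} {Y : Set (Pattern d)} (hY : UniformlySeparated Y)
    (f : Cc Y) : Memℓp (fun π : Rep Y => π.toFun f) ∞ := by
  refine memℓp_infty ⟨(iNorm f).toReal, ?_⟩
  rintro _ ⟨π, rfl⟩
  have h := π.bounded f
  rw [← ofReal_norm] at h
  exact (ENNReal.ofReal_le_iff_le_toReal (iNorm_lt_top hY f).ne).1 h

/-- The closed *-subalgebra generated by the families `(π(f))_π`, `f ∈ C_c(𝒢_Y)`. -/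
def cstarSubalgebra {d : ℕ} (Y : Set (Pattern d)) : NonUnitalStarSubalgebra ℂ (RepProduct Y) :=
  (NonUnitalStarAlgebra.adjoin ℂ (range (toProduct (Y := Y)))).topologicalClosure

/-- The full groupoid C*-algebra `C*(𝒢_Y)`: the completion of `C_c(𝒢_Y)` in the norm
`‖f‖ = sup_π ‖π(f)‖` over all representations, realized as the closed *-subalgebra
generated by the families `(π(f))_π`. -/
def CStar {d : ℕ} (Y : Set (Pattern d)) : Type 1 := cstarSubalgebra Y

instance {d : ℕ} (Y : Set (Pattern d)) : NonUnitalCStarAlgebra (CStar Y) :=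
  haveI : IsClosed (cstarSubalgebra Y : Set (RepProduct Y)) :=
    NonUnitalStarSubalgebra.isClosed_topologicalClosure _
  inferInstanceAs (NonUnitalCStarAlgebra (cstarSubalgebra Y))

/-- The canonical map `C_c(𝒢_Y) → C*(𝒢_Y)`. -/
def ι {d : ℕ} {Y : Set (Pattern d)} (f : Cc Y) : CStar Y :=
  (⟨toProduct f, NonUnitalStarSubalgebra.le_topologicalClosure _
    (NonUnitalStarAlgebra.subset_adjoin ℂ _ ⟨f, rfl⟩)⟩ : cstarSubalgebra Y)

/-! ### The maps between groupoid C*-algebras -/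

/-- For closed invariant `Z ⊆ Y`: the homomorphism `p` is induced by restricting functions from
`𝒢_Y` to `𝒢_Z`. -/
def IsRestriction {d : ℕ} {Y Z : Set (Pattern d)} (p : CStar Y →⋆ₙₐ[ℂ] CStar Z) : Prop :=
  ∀ (f : Cc Y) (g : Cc Z), (∀ γ ∈ arrows Z, ext g γ = ext f γ) → p (ι f) = ι g

/-- For relatively open invariant `Z ⊆ Y`: the homomorphism `j` is induced by extending functions
on `𝒢_Z` by zero to `𝒢_Y`. -/
def IsExtensionByZero {d : ℕ} {Z Y : Set (Pattern d)} (j : CStar Z →⋆ₙₐ[ℂ] CStar Y) : Prop :=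
  ∀ (f : Cc Z) (g : Cc Y), ext g = ext f → j (ι f) = ι g

/-- The automorphism `a` is induced by `f ↦ f ∘ σ⁻¹`, where `σ(x, S) = (σ x, σ S)`. -/
def IsInducedBy {d : ℕ} {Y : Set (Pattern d)} (σ : Space d ≃ₗᵢ[ℝ] Space d)
    (a : CStar Y ≃⋆ₐ[ℂ] CStar Y) : Prop :=
  ∀ f g : Cc Y, (∀ γ ∈ arrows Y, ext g (σ γ.1, γ.2.map σ) = ext f γ) → a (ι f) = ι g

/-- The sets `F 0 ⊆ … ⊆ F n` induce a `G`-equivariant cofiltration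
`C*(𝒢_{F n}) → … → C*(𝒢_{F 0})` by surjective restriction homomorphisms `p`, where the kernel of
`C*(𝒢_{F (r+1)}) → C*(𝒢_{F r})` is the (isomorphic) image of `C*(𝒢_{F (r+1) ∖ F r})` under
extension by zero. -/
def HasEquivariantCofiltration {d n : ℕ} (G : Subgroup (Space d ≃ₗᵢ[ℝ] Space d))
    (F : Fin (n + 1) → Set (Pattern d)) : Prop :=
  ∃ (p : ∀ r : Fin n, CStar (F r.succ) →⋆ₙₐ[ℂ] CStar (F r.castSucc))
    (j : ∀ r : Fin n, CStar (F r.succ \ F r.castSucc) →⋆ₙₐ[ℂ] CStar (F r.succ))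
    (α : ∀ r : Fin (n + 1), G →* (CStar (F r) ≃⋆ₐ[ℂ] CStar (F r))),
    (∀ r, IsRestriction (p r)) ∧
    (∀ r, IsExtensionByZero (j r)) ∧
    (∀ r (σ : G), IsInducedBy (σ : Space d ≃ₗᵢ[ℝ] Space d) (α r σ)) ∧
    (∀ r, Function.Surjective (p r)) ∧
    (∀ r, Function.Injective (j r)) ∧
    (∀ r, range (j r) = {a | p r a = 0}) ∧
    (∀ r (σ : G) a, p r (α r.succ σ a) = α r.castSucc σ (p r a))

/-! ### Crystals with rectangular corners -/

/-- The pattern `{x ∈ ℤ^d | ε i * x i ≥ 0 for all i}`: a factor `ℕ`, `-ℕ` or `ℤ` for each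
coordinate, according to `ε i = 1, -1, 0`. -/
def orthant {d : ℕ} (ε : Fin d → SignType) : Pattern d where
  carrier := {x | ∀ i, x i ∈ range ((↑) : ℤ → ℝ) ∧ 0 ≤ (ε i : ℝ) * x i}
  isClosed' := by
    simp only [ofPred_forall, ofPred_and]
    refine isClosed_iInter fun i => IsClosed.inter ?_ ?_
    · exact Int.isClosedEmbedding_coe_real.isClosed_range.preimage
        (by fun_prop : Continuous fun x : Space d => x i)
    · exact isClosed_le continuous_const (by fun_prop)

/-- The bulk lattice `ℤ^d`. -/
def bulk (d : ℕ) : Pattern d := orthant 0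

/-- The corner geometry with the single pattern `ℕ^k × ℤ^(d-k)`; `k = 2` is the quarter
geometry. -/
def cornerFamily (d k : ℕ) : Set (Pattern d) :=
  {orthant fun i => if (i : ℕ) < k then 1 else 0}

/-- The box geometry with the `2^k` patterns `(±ℕ)^k × ℤ^(d-k)` that the observers at the
`2^k` corners of a growing `k`-dimensional cube (times `ℤ^(d-k)`) see in the limit; `k = 2` is the
square geometry, and `k = d = 3` is the cube geometry. -/
def boxFamily (d k : ℕ) : Set (Pattern d) :=
  {L | ∃ ε : Fin d → SignType, (∀ i : Fin d, ε i ≠ 0 ↔ (i : ℕ) < k) ∧ L = orthant ε}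

/-- The unit vector in the direction of the `i`-th coordinate. -/
def unitVec {d : ℕ} (i : Fin d) : Space d := EuclideanSpace.single i 1

/-- The point group of a family of patterns which are cut in the first `k` directions: the linear
isometries that permute the family and act trivially on the remaining directions. -/
def pointGroup {d : ℕ} (𝓛 : Set (Pattern d)) (k : ℕ) : Subgroup (Space d ≃ₗᵢ[ℝ] Space d) where
  carrier := {σ | (∀ i : Fin d, k ≤ i → σ (unitVec i) = unitVec i) ∧ Pattern.map σ '' 𝓛 = 𝓛}
  one_mem' := ⟨fun _ _ => rfl, image_id 𝓛⟩
  mul_mem' := by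
    rintro σ τ ⟨h1, h2⟩ ⟨h3, h4⟩
    refine ⟨fun i hi => ?_, ?_⟩
    · change σ (τ (unitVec i)) = unitVec i
      rw [h3 i hi, h1 i hi]
    · have : Pattern.map (σ * τ) = Pattern.map σ ∘ Pattern.map τ := funext fun S => rfl
      rw [this, image_comp, h4, h2]
  inv_mem' := by
    rintro σ ⟨h1, h2⟩
    refine ⟨fun i hi => ?_, ?_⟩
    · have h : σ⁻¹ (σ (unitVec i)) = unitVec i := σ.symm_apply_apply _
      rwa [h1 i hi] at h
    · have h : Pattern.map σ⁻¹ ∘ Pattern.map σ = (id : Pattern d → Pattern d) :=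
        funext fun S => by
          rw [Function.comp_apply, ← Pattern.map_mul, inv_mul_cancel, Pattern.map_one, id]
      conv_lhs => rw [← h2, ← image_comp, h, image_id]

/-- The codimension of a pattern: `d` minus the number of linearly independent directions of
translations that leave the pattern invariant. -/
def codim {d : ℕ} (S : Pattern d) : ℕ :=
  d - Module.finrank ℝ (Submodule.span ℝ {v : Space d | S.shift v = S})

/-- The filtration by codimension. -/
def codimFiltration {d : ℕ} (𝓛 : Set (Pattern d)) (k : ℕ) : Fin (k + 1) → Set (Pattern d) :=
  fun r => {S | S ∈ globalTransversal 𝓛 ∧ codim S ≤ r}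

/-- A filtration `{ℤ^d} = F 0 ⊆ … ⊆ F k = Ξ` by closed sets that are invariant under
the groupoid. -/
structure IsFiltration {d k : ℕ} (Ξ : Set (Pattern d)) (F : Fin (k + 1) → Set (Pattern d)) :
    Prop where
  monotone : Monotone F
  zero : F 0 = {bulk d}
  last : F (Fin.last k) = Ξ
  isClosed : ∀ r, IsClosed (F r)
  invariant : ∀ r, GroupoidInvariant (F r)

/-- The sites `y` of `S` on the boundaries of codimension `r` (or more) of `S`: in at least `r`
coordinate directions, one of the two neighbours `y ± e_i` is missing in `S`. -/
def boundarySites {d : ℕ} (r : ℕ) (S : Pattern d) : Set (Space d) :=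
  {y | y ∈ S ∧ r ≤ {i : Fin d | y + unitVec i ∉ S ∨ y - unitVec i ∉ S}.ncard}

/-- The observable `f ∈ C_c(𝒢_Y)` is localized to the boundaries of codimension `r`: its matrix
elements, seen from a site as origin, vanish if that site is at a distance
larger than a constant `R` from these boundaries. -/
def LocalizedAt {d : ℕ} {Y : Set (Pattern d)} (r : ℕ) (f : Cc Y) : Prop :=
  ∃ R : ℝ, ∀ γ : arrows Y, f γ ≠ 0 → ∃ y ∈ boundarySites r γ.1.2, ‖y‖ ≤ R

/-- The kernel of `C*(𝒢_Y) → C*(𝒢_Z)` consists of the observables in `C*(𝒢_Y)` that are localized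
to the boundaries of codimension `r`. -/
def KernelLocalizedAt {d : ℕ} (Y Z : Set (Pattern d)) (r : ℕ) : Prop :=
  ∃ p : CStar Y →⋆ₙₐ[ℂ] CStar Z, IsRestriction p ∧
    {a | p a = 0} = closure (ι '' {f : Cc Y | LocalizedAt r f})

end Crystal

end

/-! ### The Fell topology, uniform separation and transversals -/

noncomputable section

namespace Crystal

variable {d : ℕ}

/-! ### The Fell topology -/

namespace Pattern

/-! The pattern space is compact Hausdorff, so a closed invariant set `Y` of separated patterns
containing the origin is the compact unit space of a groupoid. Separation makes the units clopen
among the arrows and makes sums over fibres locally finite, hence continuous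
(`continuousOn_finsum`). Thus `C_c(𝒢_Y)` is a unital *-algebra, and a *-homomorphism between two
such algebras that does not increase the I-norm induces one between the C*-algebras (`CcHom.map`).
Restriction, extension by zero and point group elements are of this kind.

The analytic content of part A is exactness of the full completion for a closed invariant `Z ⊆ Y`.
Extension by zero is isometric (`norm_ι_le_of_ext_eq`): a vector functional of a representation over
`Y \ Z`, compressed by a cutoff function that vanishes near `Z`, is a positive functional on
`C_c(𝒢_Y)`, and its GNS representation recovers the norm. Conversely the norm over `Z` is the
quotient norm (`exists_norm_cut_le`). If changes off `Z` could not lower the norm of `f` that far,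
vectors witnessing this for larger and larger removed compact sets would give, along an ultrafilter,
a positive functional annihilating everything supported off `Z`. Its GNS representation factors
through `C_c(𝒢_Z)` and is bounded by the I-norm there, because fibre sums are continuous near `Z`
(`exists_cutoff_iNorm_le`); so it is one of the representations defining the norm over `Z`, which
contradicts the choice of the vectors. Surjectivity, the kernel and the range follow by
approximation.

For part B, limits of translated orthants are again lattices cut by coordinate half-spaces, with
some walls pushed to infinity (`mem_transversal_orthant`). Such a pattern is a sign vector `τ`
together with distances `n` to the walls, and its codimension is the size of the support of `τ`. A
closed invariant set forgets `n` and may set entries of `τ` to zero (`cut_mem_of_cut_mem`). Signed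
permutations in the point group move supports and change signs, so for `k ≥ 2` an invariant closed
set contains with a pattern everything of no larger codimension (`CodimClosed`). Then the maximal
codimension has to grow at each strict inclusion, and `k` steps inside the range from `0` to `k`
leave only the filtration by codimension. For `k ≤ 1` the prescribed end terms already determine it.

For the localization, a pattern has sites on boundaries of codimension `r` exactly if its own
codimension is at least `r`, and such sites persist under small perturbations. So compact support
over patterns of codimension at least `r` implies localization, and localized functions vanish over
smaller codimensions. Conversely, values on units are bounded by the C*-norm (`norm_ext_zero_le`,
from the regular representation), so peak functions at a single pattern detect any discrepancy
between the given filtration and the one by codimension. -/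

@[simp] theorem mem_shift {S : Pattern d} {t y : Space d} : y ∈ S.shift t ↔ y + t ∈ S := Iff.rfl

@[simp] theorem mem_map {S : Pattern d} {σ : Space d ≃ₗᵢ[ℝ] Space d} {y : Space d} :
    y ∈ S.map σ ↔ σ.symm y ∈ S := Iff.rfl

theorem isClosed (S : Pattern d) : IsClosed (S : Set (Space d)) := S.isClosed'

@[simp] theorem shift_zero (S : Pattern d) : S.shift 0 = S := SetLike.ext fun y => by simp

@[simp] theorem shift_shift (S : Pattern d) (x y : Space d) :
    (S.shift x).shift y = S.shift (y + x) := SetLike.ext fun z => by simp [add_assoc]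

theorem map_shift (σ : Space d ≃ₗᵢ[ℝ] Space d) (S : Pattern d) (x : Space d) :
    (S.shift x).map σ = (S.map σ).shift (σ x) := SetLike.ext fun z => by simp

theorem isOpen_disjoint {K : Set (Space d)} (hK : IsCompact K) :
    IsOpen {S : Pattern d | Disjoint (S : Set (Space d)) K} :=
  TopologicalSpace.isOpen_generateFrom_of_mem (Or.inl ⟨K, hK, rfl⟩)

theorem isOpen_inter_nonempty {U : Set (Space d)} (hU : IsOpen U) :
    IsOpen {S : Pattern d | ((S : Set (Space d)) ∩ U).Nonempty} :=
  TopologicalSpace.isOpen_generateFrom_of_mem (Or.inr ⟨U, hU, rfl⟩)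

theorem isOpen_notMem (x : Space d) : IsOpen {S : Pattern d | x ∉ S} := by
  simpa using isOpen_disjoint (isCompact_singleton (x := x))

theorem isClosed_mem (x : Space d) : IsClosed {S : Pattern d | x ∈ S} :=
  ⟨isOpen_notMem x⟩

/-- If `x` lies in one pattern and not in another, some closed ball about `x` misses the second.
Meeting the open ball and missing the closed one are disjoint open conditions; local compactness of
`ℝ^d` makes the second one open. -/
instance : T2Space (Pattern d) := by
  have key : ∀ S T : Pattern d, ∀ x ∈ S, x ∉ T → ∃ u v : Set (Pattern d),
      IsOpen u ∧ IsOpen v ∧ S ∈ u ∧ T ∈ v ∧ Disjoint u v := by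
    intro S T x hx hT
    obtain ⟨δ, hδ, h⟩ := Metric.nhds_basis_closedBall.mem_iff.1 (T.isClosed.isOpen_compl.mem_nhds hT)
    refine ⟨_, _, isOpen_inter_nonempty (Metric.isOpen_ball (x := x) (ε := δ)),
      isOpen_disjoint (isCompact_closedBall x δ), ⟨x, hx, Metric.mem_ball_self hδ⟩,
      (subset_compl_iff_disjoint_left.1 h), ?_⟩
    rw [Set.disjoint_left]
    rintro P ⟨y, hy, hyb⟩ hP
    exact Set.disjoint_left.1 hP hy (Metric.ball_subset_closedBall hyb)
  refine ⟨fun S T hne => ?_⟩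
  by_cases h : ∃ x ∈ S, x ∉ T
  · obtain ⟨x, hx, hT⟩ := h
    exact key S T x hx hT
  · push Not at h
    obtain ⟨x, hx, hS⟩ : ∃ x ∈ T, x ∉ S := by
      by_contra! h'
      exact hne (SetLike.ext fun x => ⟨h x, h' x⟩)
    obtain ⟨u, v, hu, hv, h1, h2, h3⟩ := key T S x hx hS
    exact ⟨v, u, hv, hu, h2, h1, h3.symm⟩

/-- By Alexander's subbase theorem only covers by the generating hit and miss sets need finite
subcovers. -/
instance : CompactSpace (Pattern d) := by
  refine ⟨isCompact_generateFrom rfl fun P hP hcov => ?_⟩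
  set 𝒰 : Set (Set (Space d)) :=
    {U | IsOpen U ∧ {S : Pattern d | ((S : Set (Space d)) ∩ U).Nonempty} ∈ P} with h𝒰
  have hW : IsOpen (⋃₀ 𝒰) := isOpen_sUnion fun U hU => hU.1
  -- The complement of the union of all open sets occurring in hit sets is itself a pattern and
  -- belongs to none of these hit sets, so a miss set covers it. The compact set of that miss set
  -- lies in the union, and finitely many of the open sets suffice for it.
  obtain ⟨A, hAP, hA⟩ := hcov (mem_univ (⟨(⋃₀ 𝒰)ᶜ, hW.isClosed_compl⟩ : Pattern d))
  obtain ⟨K, hK, rfl⟩ | ⟨U, hU, rfl⟩ := hP hAP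
  · have hKW : K ⊆ ⋃₀ 𝒰 := by
      intro x hx
      by_contra hx'
      exact Set.disjoint_left.1 hA (show x ∈ _ from hx') hx
    obtain ⟨t, ht, htf, hKt⟩ := hK.elim_finite_subcover_image (b := 𝒰) (c := id)
      (fun U hU => hU.1) (by simpa [sUnion_eq_biUnion] using hKW)
    refine ⟨insert {S : Pattern d | Disjoint (S : Set (Space d)) K}
      ((fun U => {S : Pattern d | ((S : Set (Space d)) ∩ U).Nonempty}) '' t), ?_,
      (htf.image _).insert _, ?_⟩
    · rintro B (rfl | ⟨U, hU, rfl⟩)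
      · exact hAP
      · exact (ht hU).2
    · intro S _
      by_cases hS : Disjoint (S : Set (Space d)) K
      · exact ⟨_, mem_insert _ _, hS⟩
      · obtain ⟨x, hxS, hxK⟩ := Set.not_disjoint_iff.1 hS
        obtain ⟨U, hU, hxU⟩ := mem_iUnion₂.1 (hKt hxK)
        exact mem_sUnion.2 ⟨_, mem_insert_of_mem _ ⟨U, hU, rfl⟩, x, hxS, hxU⟩
  · obtain ⟨x, hx, hxU⟩ := hA
    exact absurd (show x ∈ ⋃₀ 𝒰 from ⟨U, ⟨hU, hAP⟩, hxU⟩) hx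

theorem continuous_shift : Continuous fun p : Pattern d × Space d => p.1.shift p.2 := by
  refine continuous_generateFrom_iff.2 ?_
  rintro A (⟨K, hK, rfl⟩ | ⟨U, hU, rfl⟩)
  · rw [isOpen_iff_mem_nhds]
    rintro ⟨S, t⟩ h
    have hdisj : Disjoint ((fun y => y + t) '' K) (S : Set (Space d)) := by
      rw [Set.disjoint_left]
      rintro _ ⟨y, hy, rfl⟩ hS
      exact Set.disjoint_left.1 h (show y ∈ S.shift t from hS) hy
    have hKt : IsCompact ((fun y => y + t) '' K) := hK.image (by fun_prop)
    -- Missing a whole thickening of `K + t` is a condition on the pattern alone that leaves room to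
    -- vary `t` by `δ`.
    obtain ⟨δ, hδ, hd⟩ := hdisj.exists_cthickenings hKt S.isClosed
    have hKδ : IsCompact (Metric.cthickening δ ((fun y => y + t) '' K)) := hKt.cthickening
    have hmiss : Disjoint (S : Set (Space d)) (Metric.cthickening δ ((fun y => y + t) '' K)) :=
      (hd.mono_right (Metric.self_subset_cthickening _)).symm
    filter_upwards [prod_mem_nhds ((isOpen_disjoint hKδ).mem_nhds hmiss)
      (Metric.ball_mem_nhds t hδ)] with p hp
    refine Set.disjoint_left.2 fun y hy hyK => Set.disjoint_left.1 hp.1 (show y + p.2 ∈ p.1 from hy) ?_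
    refine Metric.mem_cthickening_of_dist_le _ (y + t) _ _ ⟨y, hyK, rfl⟩ ?_
    rw [dist_add_left]
    exact (Metric.mem_ball.1 hp.2).le
  · rw [isOpen_iff_mem_nhds]
    rintro ⟨S, t⟩ ⟨z, hz, hzU⟩
    obtain ⟨δ, hδ, hd⟩ := Metric.isOpen_iff.1 hU z hzU
    have hmem : ((S : Set (Space d)) ∩ Metric.ball (z + t) (δ / 2)).Nonempty :=
      ⟨z + t, hz, Metric.mem_ball_self (half_pos hδ)⟩
    filter_upwards [prod_mem_nhds ((isOpen_inter_nonempty Metric.isOpen_ball).mem_nhds hmem)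
      (Metric.ball_mem_nhds t (half_pos hδ))] with p hp
    obtain ⟨⟨w, hwS, hw⟩, ht⟩ := hp
    refine ⟨w - p.2, ?_, hd ?_⟩
    · change w - p.2 + p.2 ∈ p.1
      simpa using hwS
    · rw [Metric.mem_ball] at hw ht ⊢
      rw [dist_eq_norm] at hw ht ⊢
      have : w - p.2 - z = (w - (z + t)) - (p.2 - t) := by abel
      rw [this]
      linarith [norm_sub_le (w - (z + t)) (p.2 - t)]

theorem _root_.Continuous.shift {X : Type*} [TopologicalSpace X] {f : X → Pattern d}
    {g : X → Space d} (hf : Continuous f) (hg : Continuous g) :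
    Continuous fun x => (f x).shift (g x) :=
  continuous_shift.comp (hf.prodMk hg)

theorem continuous_map (σ : Space d ≃ₗᵢ[ℝ] Space d) :
    Continuous (map σ : Pattern d → Pattern d) := by
  refine continuous_generateFrom_iff.2 ?_
  rintro A (⟨K, hK, rfl⟩ | ⟨U, hU, rfl⟩)
  · convert isOpen_disjoint (hK.image σ.symm.continuous) using 1
    ext S
    simp only [mem_preimage, mem_ofPred_eq, Set.disjoint_left]
    refine ⟨fun h y hy => ?_, fun h y hy hK => h (show σ.symm y ∈ S from hy) ⟨y, hK, rfl⟩⟩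
    rintro ⟨z, hz, rfl⟩
    exact h (show z ∈ S.map σ from hy) hz
  · convert isOpen_inter_nonempty (hU.preimage σ.continuous) using 1
    ext S
    simp only [mem_preimage, mem_ofPred_eq]
    constructor
    · rintro ⟨y, hy, hyU⟩
      exact ⟨σ.symm y, hy, by simpa using hyU⟩
    · rintro ⟨y, hy, hyU⟩
      exact ⟨σ y, by simpa using hy, hyU⟩

end Pattern

/-- `x ∈ S` means `0 ∈ S - x`, and containing a fixed point is a closed condition; joint continuity
of the shift does the rest. -/
theorem isClosed_setOf_mem : IsClosed {γ : Space d × Pattern d | γ.1 ∈ γ.2} := by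
  have h : Continuous fun γ : Space d × Pattern d => γ.2.shift γ.1 :=
    continuous_snd.shift continuous_fst
  convert (Pattern.isClosed_mem (0 : Space d)).preimage h using 1
  ext γ
  simp

theorem IsClosed.arrows {Y : Set (Pattern d)} (hY : IsClosed Y) : IsClosed (arrows Y) :=
  (hY.preimage continuous_snd).inter isClosed_setOf_mem

/-! ### Uniform separation -/

/-- A ball inside `U` can be translated to any site, so only its radius matters. The distance form
is the convenient one for limits. -/
theorem uniformlySeparated_iff {Y : Set (Pattern d)} : UniformlySeparated Y ↔
    ∃ δ : ℝ, 0 < δ ∧ ∀ S ∈ Y, ∀ x ∈ S, ∀ y ∈ S, dist x y < δ → x = y := by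
  constructor
  · rintro ⟨U, hU, ⟨u, hu⟩, h⟩
    obtain ⟨δ, hδ, hd⟩ := Metric.isOpen_iff.1 hU u hu
    refine ⟨δ, hδ, fun S hS x hx y hy hxy => ?_⟩
    refine h S hS (u - x) ⟨hx, u, hu, by simp⟩ ⟨hy, u - x + y, hd ?_, by simp⟩
    rw [Metric.mem_ball, dist_eq_norm, show u - x + y - u = y - x by abel, ← dist_eq_norm, dist_comm]
    exact hxy
  · rintro ⟨δ, hδ, h⟩
    refine ⟨Metric.ball 0 (δ / 2), Metric.isOpen_ball, ⟨0, Metric.mem_ball_self (half_pos hδ)⟩,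
      fun S hS x => ?_⟩
    rintro _ ⟨hy, y, hyb, rfl⟩ _ ⟨hz, z, hzb, rfl⟩
    refine h S hS _ hy _ hz ?_
    rw [dist_sub_right]
    rw [Metric.mem_ball] at hyb hzb
    linarith [dist_triangle_right y z 0]

theorem UniformlySeparated.mono {Y Z : Set (Pattern d)} (hY : UniformlySeparated Y) (h : Z ⊆ Y) :
    UniformlySeparated Z := by
  obtain ⟨U, h1, h2, h3⟩ := hY
  exact ⟨U, h1, h2, fun S hS => h3 S (h hS)⟩

theorem UniformlySeparated.union {Y Z : Set (Pattern d)} (hY : UniformlySeparated Y)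
    (hZ : UniformlySeparated Z) : UniformlySeparated (Y ∪ Z) := by
  rw [uniformlySeparated_iff] at *
  obtain ⟨δ, hδ, h⟩ := hY
  obtain ⟨ε, hε, h'⟩ := hZ
  refine ⟨min δ ε, lt_min hδ hε, ?_⟩
  rintro S (hS | hS) x hx y hy hxy
  · exact h S hS x hx y hy (hxy.trans_le (min_le_left _ _))
  · exact h' S hS x hx y hy (hxy.trans_le (min_le_right _ _))

theorem uniformlySeparated_empty : UniformlySeparated (∅ : Set (Pattern d)) :=
  uniformlySeparated_iff.2 ⟨1, one_pos, fun _ h => h.elim⟩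

theorem UniformlySeparated.closure_orbit {L : Pattern d} (hL : UniformlySeparated {L}) :
    UniformlySeparated (closure (range L.shift)) := by
  rw [uniformlySeparated_iff] at *
  obtain ⟨δ, hδ, h⟩ := hL
  refine ⟨δ, hδ, fun S hS x hx y hy hxy => ?_⟩
  by_contra hne
  -- The first bound keeps the approximations `a`, `b` closer than `δ`, so they coincide in a
  -- translate of `L`; the second forbids a common approximation of `x` and `y`.
  set ε := min ((δ - dist x y) / 2) (dist x y / 2) with hε
  have hpos : 0 < ε := lt_min (by linarith) (half_pos (dist_pos.2 hne))
  have h1 : ε ≤ (δ - dist x y) / 2 := min_le_left _ _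
  have h2 : ε ≤ dist x y / 2 := min_le_right _ _
  obtain ⟨_, ⟨⟨a, ha, hax⟩, ⟨b, hb, hby⟩⟩, t, rfl⟩ := mem_closure_iff.1 hS
    ({T : Pattern d | ((T : Set (Space d)) ∩ Metric.ball x ε).Nonempty} ∩
      {T : Pattern d | ((T : Set (Space d)) ∩ Metric.ball y ε).Nonempty})
    ((Pattern.isOpen_inter_nonempty Metric.isOpen_ball).inter
      (Pattern.isOpen_inter_nonempty Metric.isOpen_ball))
    ⟨⟨x, hx, Metric.mem_ball_self hpos⟩, ⟨y, hy, Metric.mem_ball_self hpos⟩⟩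
  rw [Metric.mem_ball] at hax hby
  have hab : a + t = b + t := by
    refine h L rfl _ ha _ hb ?_
    rw [dist_add_right]
    linarith [dist_triangle4 a x y b, dist_comm b y]
  have : a = b := add_right_cancel hab
  subst this
  linarith [dist_triangle_left x y a]

/-! ### Transversals -/

/-- Containing the origin is a closed condition that excludes the empty pattern, so neither the
puncture of the hull nor the outer closure has any effect. -/
theorem mem_transversal {L S : Pattern d} :
    S ∈ transversal L ↔ S ∈ closure (range L.shift) ∧ (0 : Space d) ∈ S := by
  have heq : {S | S ∈ hull L ∧ (0 : Space d) ∈ S} =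
      closure (range L.shift) ∩ {S : Pattern d | (0 : Space d) ∈ S} := by
    ext S
    simp only [hull, mem_ofPred_eq, mem_sdiff, mem_inter_iff]
    exact ⟨fun h => ⟨h.1.1, h.2⟩, fun h => ⟨⟨h.1, fun h0 => by
      have : (0 : Space d) ∈ (S : Set (Space d)) := h.2
      rw [h0] at this
      exact this⟩, h.2⟩⟩
  rw [transversal, heq, (isClosed_closure.inter (Pattern.isClosed_mem 0)).closure_eq]
  rfl

theorem isClosed_transversal (L : Pattern d) : IsClosed (transversal L) := isClosed_closure

theorem zero_mem_of_mem_transversal {L S : Pattern d} (h : S ∈ transversal L) : (0 : Space d) ∈ S :=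
  (mem_transversal.1 h).2

theorem shift_mem_closure_orbit {L S : Pattern d} (h : S ∈ closure (range L.shift)) (x : Space d) :
    S.shift x ∈ closure (range L.shift) := by
  have hc : Continuous fun S : Pattern d => S.shift x :=
    continuous_id.shift continuous_const
  refine map_mem_closure (f := fun S : Pattern d => S.shift x) hc h ?_
  rintro _ ⟨t, rfl⟩
  exact ⟨x + t, by simp⟩

theorem groupoidInvariant_transversal (L : Pattern d) : GroupoidInvariant (transversal L) := by
  intro S hS x hx
  rw [mem_transversal] at *
  exact ⟨shift_mem_closure_orbit hS.1 x, by simpa using hx⟩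

theorem map_mem_transversal (σ : Space d ≃ₗᵢ[ℝ] Space d) {L S : Pattern d}
    (hS : S ∈ transversal L) : S.map σ ∈ transversal (L.map σ) := by
  rw [mem_transversal] at *
  refine ⟨map_mem_closure (Pattern.continuous_map σ) hS.1 ?_, by simpa using hS.2⟩
  rintro _ ⟨t, rfl⟩
  exact ⟨σ t, (Pattern.map_shift _ _ _).symm⟩

/-- The sets of patterns which are unit spaces of étale groupoids of arrows: they are uniformly
separated, their patterns contain the origin, and they are invariant under the groupoid. -/
structure IsUnitSpace (Y : Set (Pattern d)) : Prop where
  separated : UniformlySeparated Y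
  zero_mem : ∀ S ∈ Y, (0 : Space d) ∈ S
  invariant : GroupoidInvariant Y

theorem IsUnitSpace.shift_mem_iff {Y : Set (Pattern d)} (hY : IsUnitSpace Y) {S : Pattern d}
    {x : Space d} (h0 : (0 : Space d) ∈ S) (hx : x ∈ S) : S.shift x ∈ Y ↔ S ∈ Y := by
  refine ⟨fun h => ?_, fun h => hY.invariant S h x hx⟩
  have := hY.invariant _ h (-x) (by simpa using h0)
  simpa using this

theorem IsUnitSpace.subset {Y Z : Set (Pattern d)} (hY : IsUnitSpace Y) (h : Z ⊆ Y)
    (hZ : GroupoidInvariant Z) : IsUnitSpace Z :=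
  ⟨hY.separated.mono h, fun S hS => hY.zero_mem S (h hS), hZ⟩

theorem IsUnitSpace.diff {Y Z : Set (Pattern d)} (hY : IsUnitSpace Y) (hZ : IsUnitSpace Z) :
    IsUnitSpace (Y \ Z) :=
  hY.subset sdiff_subset fun S hS x hx => ⟨hY.invariant S hS.1 x hx, fun h =>
    hS.2 ((hZ.shift_mem_iff (hY.zero_mem S hS.1) hx).1 h)⟩

theorem isClosed_globalTransversal {𝓛 : Set (Pattern d)} (h : 𝓛.Finite) :
    IsClosed (globalTransversal 𝓛) :=
  h.isClosed_biUnion fun L _ => isClosed_transversal L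

theorem isUnitSpace_globalTransversal {𝓛 : Set (Pattern d)} (h : 𝓛.Finite)
    (hs : ∀ L ∈ 𝓛, UniformlySeparated {L}) : IsUnitSpace (globalTransversal 𝓛) where
  separated := by
    induction 𝓛, h using Set.Finite.induction_on with
    | empty => simpa [globalTransversal] using uniformlySeparated_empty
    | @insert L 𝓛 _ _ ih =>
      rw [globalTransversal, biUnion_insert]
      refine ((hs L (mem_insert _ _)).closure_orbit.mono fun S hS => (mem_transversal.1 hS).1).union
        (ih fun L hL => hs L (mem_insert_of_mem _ hL))
  zero_mem S hS := by
    obtain ⟨L, _, hL⟩ := mem_iUnion₂.1 hS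
    exact zero_mem_of_mem_transversal hL
  invariant S hS x hx := by
    obtain ⟨L, h, hL⟩ := mem_iUnion₂.1 hS
    exact mem_iUnion₂.2 ⟨L, h, groupoidInvariant_transversal L S hL x hx⟩

end Crystal

end

/-! ### Compactly supported functions and continuity of fibre sums -/

noncomputable section

namespace Crystal

open Filter

variable {d : ℕ}

/-! ### Compactly supported functions on the arrows -/

/-- `F` is the extension by zero of an element of `C_c(𝒢_Y)`. -/
def IsCc (Y : Set (Pattern d)) (F : Space d × Pattern d → ℂ) : Prop :=
  ContinuousOn F (arrows Y) ∧ ∃ C ⊆ arrows Y, IsCompact C ∧ ∀ γ ∉ C, F γ = 0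

theorem IsCc.eq_zero {Y : Set (Pattern d)} {F : Space d × Pattern d → ℂ} (hF : IsCc Y F)
    {γ : Space d × Pattern d} (h : γ ∉ arrows Y) : F γ = 0 := by
  obtain ⟨_, C, hC, _, h0⟩ := hF
  exact h0 γ fun h' => h (hC h')

theorem IsCc.mem {Y : Set (Pattern d)} {F : Space d × Pattern d → ℂ} (hF : IsCc Y F)
    {γ : Space d × Pattern d} (h : F γ ≠ 0) : γ ∈ arrows Y := by
  by_contra h'
  exact h (hF.eq_zero h')

/-- The element of `C_c(𝒢_Y)` given by its extension by zero. -/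
def mkCc {Y : Set (Pattern d)} (F : Space d × Pattern d → ℂ) (hF : IsCc Y F) : Cc Y where
  toFun γ := F γ
  continuous_toFun := continuousOn_iff_continuous_domRestrict.1 hF.1
  hasCompactSupport' := by
    obtain ⟨_, C, hC, hCc, h0⟩ := hF
    refine HasCompactSupport.intro (K := Subtype.val ⁻¹' C) ?_ fun γ hγ => h0 _ hγ
    rw [Subtype.isCompact_iff, Subtype.image_preimage_coe, inter_eq_right.2 hC]
    exact hCc

theorem ext_apply {Y : Set (Pattern d)} (f : Cc Y) (γ : arrows Y) : ext f γ = f γ :=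
  Subtype.val_injective.extend_apply _ _ _

theorem ext_of_notMem {Y : Set (Pattern d)} (f : Cc Y) {γ : Space d × Pattern d}
    (h : γ ∉ arrows Y) : ext f γ = 0 :=
  Function.extend_apply' _ _ _ fun ⟨γ', h'⟩ => h (h' ▸ γ'.2)

@[simp] theorem ext_mkCc {Y : Set (Pattern d)} {F : Space d × Pattern d → ℂ} (hF : IsCc Y F) :
    ext (mkCc F hF) = F := by
  funext γ
  by_cases h : γ ∈ arrows Y
  · exact ext_apply _ ⟨γ, h⟩
  · rw [ext_of_notMem _ h, hF.eq_zero h]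

theorem isCc_ext {Y : Set (Pattern d)} (f : Cc Y) : IsCc Y (ext f) := by
  refine ⟨?_, Subtype.val '' tsupport f, by simp, f.hasCompactSupport.image continuous_subtype_val,
    fun γ hγ => ?_⟩
  · rw [continuousOn_iff_continuous_domRestrict]
    convert f.continuous using 1
    funext γ
    exact ext_apply f γ
  · by_cases h : γ ∈ arrows Y
    · rw [ext_apply f ⟨γ, h⟩]
      by_contra h0
      exact hγ ⟨⟨γ, h⟩, subset_tsupport _ h0, rfl⟩
    · exact ext_of_notMem f h

theorem ext_injective {Y : Set (Pattern d)} : Function.Injective (ext : Cc Y → _) := by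
  intro f g h
  refine CompactlySupportedContinuousMap.ext fun γ => ?_
  rw [← ext_apply, h, ext_apply]

@[simp] theorem ext_zero {Y : Set (Pattern d)} : ext (0 : Cc Y) = 0 := by
  funext γ
  by_cases h : γ ∈ arrows Y
  · exact ext_apply 0 ⟨γ, h⟩
  · exact ext_of_notMem _ h

@[simp] theorem ext_add {Y : Set (Pattern d)} (f g : Cc Y) : ext (f + g) = ext f + ext g := by
  funext γ
  by_cases h : γ ∈ arrows Y
  · lift γ to arrows Y using h
    simp [ext_apply]
  · simp [ext_of_notMem _ h]

@[simp] theorem ext_smul {Y : Set (Pattern d)} (c : ℂ) (f : Cc Y) : ext (c • f) = c • ext f := by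
  funext γ
  by_cases h : γ ∈ arrows Y
  · lift γ to arrows Y using h
    simp [ext_apply]
  · simp [ext_of_notMem _ h]

@[simp] theorem ext_sub {Y : Set (Pattern d)} (f g : Cc Y) : ext (f - g) = ext f - ext g := by
  rw [sub_eq_add_neg, ← neg_one_smul ℂ g, ext_add, ext_smul, neg_one_smul, sub_eq_add_neg]

theorem IsCc.add {Y : Set (Pattern d)} {F G : Space d × Pattern d → ℂ} (hF : IsCc Y F)
    (hG : IsCc Y G) : IsCc Y (F + G) := by
  simpa using isCc_ext (mkCc F hF + mkCc G hG)

theorem IsCc.sub {Y : Set (Pattern d)} {F G : Space d × Pattern d → ℂ} (hF : IsCc Y F)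
    (hG : IsCc Y G) : IsCc Y (F - G) := by
  simpa using isCc_ext (mkCc F hF - mkCc G hG)

/-- Over a compact set of patterns, compactness of the support only concerns the first variable. -/
theorem isCc_of_isClosed {Y : Set (Pattern d)} (hY : IsClosed Y) {F : Space d × Pattern d → ℂ}
    (hF : ContinuousOn F (arrows Y)) {K : Set (Space d)} (hK : IsCompact K)
    (h0 : ∀ γ, γ ∉ arrows Y → F γ = 0) (hFK : ∀ γ : Space d × Pattern d, γ.1 ∉ K → F γ = 0) :
    IsCc Y F := by
  refine ⟨hF, (K ×ˢ univ) ∩ arrows Y, inter_subset_right,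
    (hK.prod isCompact_univ).inter_right (IsClosed.arrows hY), fun γ hγ => ?_⟩
  by_contra h
  refine hγ ⟨⟨?_, mem_univ _⟩, ?_⟩
  · by_contra h'
    exact h (hFK γ h')
  · by_contra h'
    exact h (h0 γ h')

theorem IsCc.exists_compact {Y : Set (Pattern d)} {F : Space d × Pattern d → ℂ} (hF : IsCc Y F) :
    ∃ K : Set (Space d), IsCompact K ∧ ∀ γ : Space d × Pattern d, γ.1 ∉ K → F γ = 0 := by
  obtain ⟨_, C, _, hC, h0⟩ := hF
  exact ⟨_, hC.image continuous_fst, fun γ h => h0 _ fun h' => h ⟨γ, h', rfl⟩⟩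

/-- A function in `C_c(𝒢_W)` for a relatively open `W ⊆ Y` lies in `C_c(𝒢_Y)`. -/
theorem IsCc.extend {Y Z : Set (Pattern d)} (hZ : IsClosed Z) {F : Space d × Pattern d → ℂ}
    (hF : IsCc (Y \ Z) F) : IsCc Y F := by
  obtain ⟨hc, C, hCW, hC, h0⟩ := hF
  refine ⟨fun γ hγ => ?_, C, fun γ h => ⟨(hCW h).1.1, (hCW h).2⟩, hC, h0⟩
  -- Near a point of the support, arrows over `Y` avoid the closed set `Z`, so continuity over `Y \
  -- Z` suffices. Elsewhere the function vanishes nearby because `C` is closed.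
  by_cases h : γ ∈ C
  · refine (hc γ (hCW h)).mono_of_mem_nhdsWithin ?_
    have hopen : IsOpen {γ : Space d × Pattern d | γ.2 ∉ Z} :=
      hZ.isOpen_compl.preimage continuous_snd
    filter_upwards [self_mem_nhdsWithin, mem_nhdsWithin_of_mem_nhds (hopen.mem_nhds (hCW h).1.2)]
      with γ' h1 h2
    exact ⟨⟨h1.1, h2⟩, h1.2⟩
  · refine ContinuousAt.continuousWithinAt ?_
    refine (continuousAt_const (y := (0 : ℂ))).congr ?_
    filter_upwards [hC.isClosed.isOpen_compl.mem_nhds h] with γ' h'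
    exact (h0 γ' h').symm

open Classical in
/-- Restriction of a function to the arrows over a set of patterns. -/
def restrictTo (Z : Set (Pattern d)) (F : Space d × Pattern d → ℂ) : Space d × Pattern d → ℂ :=
  fun γ => if γ.2 ∈ Z then F γ else 0

theorem IsCc.restrictTo {Y Z : Set (Pattern d)} (hZ : IsClosed Z) (hZY : Z ⊆ Y)
    {F : Space d × Pattern d → ℂ} (hF : IsCc Y F) : IsCc Z (restrictTo Z F) := by
  obtain ⟨hc, C, hCY, hC, h0⟩ := hF
  refine ⟨(hc.mono fun γ h => ⟨hZY h.1, h.2⟩).congr fun γ h => if_pos h.1, C ∩ {γ | γ.2 ∈ Z},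
    fun γ h => ⟨h.2, (hCY h.1).2⟩, hC.inter_right (hZ.preimage continuous_snd), fun γ h => ?_⟩
  by_cases h' : γ.2 ∈ Z
  · rw [Crystal.restrictTo, if_pos h', h0 γ fun h'' => h ⟨h'', h'⟩]
  · exact if_neg h'

/-! ### Sums over fibres -/

theorem finite_inter {S : Pattern d} (hS : UniformlySeparated {S}) {K : Set (Space d)}
    (hK : IsCompact K) : ((S : Set (Space d)) ∩ K).Finite := by
  obtain ⟨N, hN⟩ := exists_card_bound hS hK
  exact Set.finite_of_encard_le_coe (hN S rfl)

/-- Only the finitely many points `a` of `q x₀` in `K` matter. For `x` near `x₀` the hit sets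
provide a point of `q x` near each `a`, unique by separation and moving continuously, while a miss
set excludes all other points of `q x` in `K`. Locally the sum is therefore a fixed finite sum of
continuous terms. The radius `δ / 3` ensures that two points near the same `a`, or two `a` near the
same point, are closer than `δ`. -/
theorem continuousOn_finsum {X E : Type*} [TopologicalSpace X] [NormedAddCommGroup E]
    {s : Set X} {q : X → Pattern d} (hq : ContinuousOn q s) (hsep : UniformlySeparated (q '' s))
    {K : Set (Space d)} (hK : IsCompact K) {F : Space d → X → E}
    (h0 : ∀ x ∈ s, ∀ y, F y x ≠ 0 → y ∈ q x ∧ y ∈ K)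
    (hF : ContinuousOn (fun p : Space d × X => F p.1 p.2) {p | p.2 ∈ s ∧ p.1 ∈ q p.2}) :
    ContinuousOn (fun x => ∑ᶠ y, F y x) s := by
  classical
  intro x₀ hx₀
  obtain ⟨δ, hδ, hd⟩ := uniformlySeparated_iff.1 hsep
  have hfin : ((q x₀ : Set (Space d)) ∩ K).Finite :=
    finite_inter (hsep.mono (by rintro _ rfl; exact ⟨x₀, hx₀, rfl⟩)) hK
  set A : Finset (Space d) := hfin.toFinset with hA
  have hAmem : ∀ a ∈ A, a ∈ q x₀ ∧ a ∈ K := fun a ha => hfin.mem_toFinset.1 ha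
  have hAball : ∀ a ∈ A, ∀ b ∈ A, dist a b < δ → a = b := fun a ha b hb h =>
    hd (q x₀) ⟨x₀, hx₀, rfl⟩ a (hAmem a ha).1 b (hAmem b hb).1 h
  have hev : ∀ a ∈ A, ∀ η > 0, ∀ᶠ x in 𝓝[s] x₀, ∃ y ∈ q x, dist y a < η := by
    intro a ha η hη
    have : {S : Pattern d | ((S : Set (Space d)) ∩ Metric.ball a η).Nonempty} ∈ 𝓝 (q x₀) :=
      (Pattern.isOpen_inter_nonempty Metric.isOpen_ball).mem_nhds
        ⟨a, (hAmem a ha).1, Metric.mem_ball_self hη⟩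
    filter_upwards [hq x₀ hx₀ this] with x hx
    obtain ⟨y, hy, hya⟩ := hx
    exact ⟨y, hy, hya⟩
  have hmiss : ∀ᶠ x in 𝓝[s] x₀, ∀ y ∈ q x, y ∈ K → ∃ a ∈ A, dist y a < δ / 3 := by
    have hK' : IsCompact (K \ ⋃ a ∈ A, Metric.ball a (δ / 3)) :=
      hK.diff (isOpen_biUnion fun a _ => Metric.isOpen_ball)
    have : {S : Pattern d | Disjoint (S : Set (Space d)) (K \ ⋃ a ∈ A, Metric.ball a (δ / 3))} ∈
        𝓝 (q x₀) := by
      refine (Pattern.isOpen_disjoint hK').mem_nhds (Set.disjoint_left.2 fun y hy hyK => hyK.2 ?_)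
      exact mem_iUnion₂.2 ⟨y, hfin.mem_toFinset.2 ⟨hy, hyK.1⟩, Metric.mem_ball_self (by positivity)⟩
    filter_upwards [hq x₀ hx₀ this] with x hx y hy hyK
    by_contra hcon
    refine Set.disjoint_left.1 hx hy ⟨hyK, fun hmem => hcon ?_⟩
    obtain ⟨a, ha, h⟩ := mem_iUnion₂.1 hmem
    exact ⟨a, ha, h⟩
  -- The point of `q x` that follows `a`; the default value is irrelevant, since the point exists
  -- for all `x` near `x₀`.
  let c : Space d → X → Space d := fun a x =>
    if h : ∃ y ∈ q x, dist y a < δ / 3 then h.choose else a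
  have hc : ∀ a x, (∃ y ∈ q x, dist y a < δ / 3) → c a x ∈ q x ∧ dist (c a x) a < δ / 3 := by
    intro a x h
    simp only [c, dif_pos h]
    exact h.choose_spec
  have hctend : ∀ a ∈ A, Tendsto (c a) (𝓝[s] x₀) (𝓝 a) := by
    intro a ha
    rw [Metric.tendsto_nhds]
    intro η hη
    filter_upwards [hev a ha (min η (δ / 3)) (lt_min hη (by positivity)), self_mem_nhdsWithin]
      with x ⟨y, hy, hya⟩ hxs
    have hy3 : dist y a < δ / 3 := hya.trans_le (min_le_right _ _)
    obtain ⟨h1, h2⟩ := hc a x ⟨y, hy, hy3⟩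
    have : c a x = y := hd (q x) ⟨x, hxs, rfl⟩ _ h1 _ hy (by
      linarith [dist_triangle_right (c a x) y a])
    rw [this]
    exact hya.trans_le (min_le_left _ _)
  have hall : ∀ᶠ x in 𝓝[s] x₀, ∀ a ∈ A, c a x ∈ q x ∧ dist (c a x) a < δ / 3 := by
    rw [Filter.eventually_all_finset]
    intro a ha
    filter_upwards [hev a ha (δ / 3) (by positivity)] with x hx
    exact hc a x hx
  have hsum : (fun x => ∑ a ∈ A, F (c a x) x) =ᶠ[𝓝[s] x₀] fun x => ∑ᶠ y, F y x := by
    filter_upwards [hall, hmiss, self_mem_nhdsWithin] with x hx hm hxs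
    have hinj : Set.InjOn (fun a => c a x) A := by
      intro a ha b hb hab
      refine hAball a ha b hb ?_
      have h1 := (hx a ha).2
      have h2 := (hx b hb).2
      simp only at hab
      rw [← hab] at h2
      linarith [dist_triangle_left a b (c a x)]
    rw [← Finset.sum_image (f := fun y => F y x) hinj]
    symm
    refine finsum_eq_sum_of_support_subset _ fun y hy => ?_
    obtain ⟨hyq, hyK⟩ := h0 x hxs y hy
    obtain ⟨a, ha, hya⟩ := hm y hyq hyK
    refine Finset.mem_coe.2 (Finset.mem_image.2 ⟨a, ha, ?_⟩)
    refine hd (q x) ⟨x, hxs, rfl⟩ _ (hx a ha).1 _ hyq ?_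
    linarith [dist_triangle_right (c a x) y a, (hx a ha).2]
  have hval : ∑ᶠ y, F y x₀ = ∑ a ∈ A, F a x₀ :=
    finsum_eq_sum_of_support_subset _ fun y hy => hfin.mem_toFinset.2 (h0 x₀ hx₀ y hy)
  rw [ContinuousWithinAt, hval]
  refine Tendsto.congr' hsum (tendsto_finsetSum A fun a ha => ?_)
  have h1 : Tendsto (fun x => (c a x, x)) (𝓝[s] x₀)
      (𝓝[{p : Space d × X | p.2 ∈ s ∧ p.1 ∈ q p.2}] (a, x₀)) := by
    refine tendsto_nhdsWithin_iff.2 ⟨?_, ?_⟩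
    · exact (hctend a ha).prodMk_nhds (tendsto_id.mono_left nhdsWithin_le_nhds)
    · filter_upwards [hall, self_mem_nhdsWithin] with x hx hxs
      exact ⟨hxs, (hx a ha).1⟩
  exact (hF (a, x₀) ⟨hx₀, (hAmem a ha).1⟩).tendsto.comp h1

theorem IsCc.finite_support {Y : Set (Pattern d)} (hY : IsUnitSpace Y)
    {F : Space d × Pattern d → ℂ} (hF : IsCc Y F) (S : Pattern d) :
    {y | F (y, S) ≠ 0}.Finite := by
  by_cases hS : S ∈ Y
  · obtain ⟨K, hK, h0⟩ := hF.exists_compact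
    refine (finite_inter (hY.separated.mono (singleton_subset_iff.2 hS)) hK).subset fun y hy => ?_
    refine ⟨(hF.mem hy).2, ?_⟩
    by_contra h
    exact hy (h0 _ h)
  · convert Set.finite_empty
    ext y
    simp only [mem_ofPred_eq, mem_empty_iff_false, iff_false, not_not]
    exact hF.eq_zero fun h => hS h.1

end Crystal

end

/-! ### The convolution *-algebra and cutoff functions -/

noncomputable section

namespace Crystal

open Filter

variable {d : ℕ}

/-! ### Convolution and adjoints -/

/-- The convolution of functions that vanish outside the arrows. -/
def conv (F G : Space d × Pattern d → ℂ) : Space d × Pattern d → ℂ :=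
  fun γ => ∑ᶠ y : Space d, F (γ.1 - y, γ.2.shift y) * G (y, γ.2)

/-- The inversion of arrows. -/
def inverse (γ : Space d × Pattern d) : Space d × Pattern d := (-γ.1, γ.2.shift γ.1)

/-- The adjoint of a function on the arrows. -/
def adj (F : Space d × Pattern d → ℂ) : Space d × Pattern d → ℂ :=
  fun γ => star (F (inverse γ))

@[simp] theorem inverse_inverse (γ : Space d × Pattern d) : inverse (inverse γ) = γ := by
  simp [inverse]

theorem continuous_inverse : Continuous (inverse : Space d × Pattern d → _) :=
  continuous_fst.neg.prodMk (continuous_snd.shift continuous_fst)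

theorem IsUnitSpace.inverse_mem {Y : Set (Pattern d)} (hY : IsUnitSpace Y)
    {γ : Space d × Pattern d} (h : γ ∈ arrows Y) : inverse γ ∈ arrows Y :=
  ⟨hY.invariant _ h.1 _ h.2, by simpa [inverse] using hY.zero_mem _ h.1⟩

@[simp] theorem adj_adj (F : Space d × Pattern d → ℂ) : adj (adj F) = F := by
  funext γ
  simp [adj]

theorem adj_add (F G : Space d × Pattern d → ℂ) : adj (F + G) = adj F + adj G := by
  funext γ
  simp [adj]

theorem IsCc.adj {Y : Set (Pattern d)} (hY : IsUnitSpace Y) {F : Space d × Pattern d → ℂ}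
    (hF : IsCc Y F) : IsCc Y (adj F) := by
  obtain ⟨hc, C, hCY, hC, h0⟩ := hF
  refine ⟨(hc.comp continuous_inverse.continuousOn fun γ h => hY.inverse_mem h).star,
    inverse '' C, ?_, hC.image continuous_inverse, fun γ hγ => ?_⟩
  · rintro _ ⟨γ, hγ, rfl⟩
    exact hY.inverse_mem (hCY hγ)
  · rw [Crystal.adj, h0, star_zero]
    exact fun h => hγ ⟨_, h, inverse_inverse γ⟩

/-- The right factor alone determines the source, so functions over an invariant `W ⊆ Y` form a left
ideal. Continuity is that of fibre sums, and the support lies in the image of the compact set of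
composable pairs. -/
theorem IsCc.conv {Y W : Set (Pattern d)} (hW : IsUnitSpace W) (hWY : W ⊆ Y)
    {F G : Space d × Pattern d → ℂ} (hF : IsCc Y F) (hG : IsCc W G) : IsCc W (conv F G) := by
  obtain ⟨hcF, C₁, hC₁Y, hC₁, h0F⟩ := hF
  obtain ⟨hcG, C₂, hC₂W, hC₂, h0G⟩ := hG
  refine ⟨?_, ?_⟩
  · refine continuousOn_finsum (X := Space d × Pattern d) (q := Prod.snd)
      (F := fun y γ => F (γ.1 - y, γ.2.shift y) * G (y, γ.2))
      continuousOn_snd (hW.separated.mono (by rintro _ ⟨γ, h, rfl⟩; exact h.1))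
      (hC₂.image continuous_fst) (fun γ hγ y h => ?_) ?_
    · have hG0 : (y, γ.2) ∈ C₂ := by
        by_contra h'
        exact h (by rw [h0G _ h', mul_zero])
      exact ⟨(hC₂W hG0).2, _, hG0, rfl⟩
    · refine ContinuousOn.mul ?_ ?_
      · refine hcF.comp (f := fun p : Space d × (Space d × Pattern d) =>
          (p.2.1 - p.1, p.2.2.shift p.1)) (Continuous.continuousOn ?_) ?_
        · exact (by fun_prop : Continuous fun p : Space d × (Space d × Pattern d) =>
            p.2.1 - p.1).prodMk (Continuous.shift (by fun_prop) (by fun_prop))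
        · rintro ⟨y, x, S⟩ ⟨hx, hy⟩
          exact ⟨hWY (hW.invariant S hx.1 y hy), by simpa using hx.2⟩
      · refine hcG.comp (f := fun p : Space d × (Space d × Pattern d) => (p.1, p.2.2))
          (by fun_prop) ?_
        rintro ⟨y, x, S⟩ ⟨hx, hy⟩
        exact ⟨hx.1, hy⟩
  · have hcl : IsClosed {p : (Space d × Pattern d) × (Space d × Pattern d) |
        p.1.2 = p.2.2.shift p.2.1} :=
      isClosed_eq (by fun_prop) (Continuous.shift (by fun_prop) (by fun_prop))
    refine ⟨(fun p : (Space d × Pattern d) × (Space d × Pattern d) => (p.1.1 + p.2.1, p.2.2)) ''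
      ((C₁ ×ˢ C₂) ∩ {p | p.1.2 = p.2.2.shift p.2.1}), ?_,
      ((hC₁.prod hC₂).inter_right hcl).image (by fun_prop), fun γ hγ => ?_⟩
    · rintro _ ⟨⟨⟨x, S⟩, ⟨y, T⟩⟩, ⟨⟨h1, h2⟩, h3⟩, rfl⟩
      refine ⟨(hC₂W h2).1, ?_⟩
      have := (hC₁Y h1).2
      simp only [mem_ofPred_eq] at h3
      subst h3
      exact this
    · refine finsum_eq_zero_of_forall_eq_zero fun y => ?_
      by_contra h
      refine hγ ⟨((γ.1 - y, γ.2.shift y), (y, γ.2)), ⟨⟨?_, ?_⟩, rfl⟩, by simp⟩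
      · by_contra h'
        exact h (by rw [h0F _ h', zero_mul])
      · by_contra h'
        exact h (by rw [h0G _ h', mul_zero])

theorem conv_apply_eq_sum {F G : Space d × Pattern d → ℂ} {γ : Space d × Pattern d}
    {A : Finset (Space d)} (hA : ∀ y, G (y, γ.2) ≠ 0 → y ∈ A) :
    conv F G γ = ∑ y ∈ A, F (γ.1 - y, γ.2.shift y) * G (y, γ.2) :=
  finsum_eq_sum_of_support_subset _ fun y hy => hA y (right_ne_zero_of_mul hy)

/-- The finite set `A` carries the inner arrow and `B` all composites that can contribute, so both
sides become the same double sum after the substitution `w = y - z`. -/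
theorem conv_assoc {Y : Set (Pattern d)} (hY : IsUnitSpace Y)
    {F G H : Space d × Pattern d → ℂ} (hG : IsCc Y G) (hH : IsCc Y H) :
    conv (conv F G) H = conv F (conv G H) := by
  classical
  funext ⟨x, S⟩
  have hHf := hH.finite_support hY S
  have hGf : ∀ z, {y | G (y, S.shift z) ≠ 0}.Finite := fun z => hG.finite_support hY _
  set A := hHf.toFinset
  set B : Finset (Space d) := A.biUnion fun z => (hGf z).toFinset.image fun w => w + z
  have hA : ∀ z, H (z, S) ≠ 0 → z ∈ A := fun z h => hHf.mem_toFinset.2 h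
  have hB : ∀ z ∈ A, ∀ y, G (y - z, S.shift z) ≠ 0 → y ∈ B := fun z hz y h =>
    Finset.mem_biUnion.2 ⟨z, hz, Finset.mem_image.2 ⟨y - z, (hGf z).mem_toFinset.2 h, by simp⟩⟩
  rw [conv_apply_eq_sum hA]
  have h1 : ∀ z ∈ A, conv F G (x - z, S.shift z) =
      ∑ y ∈ B, F (x - y, S.shift y) * G (y - z, S.shift z) := by
    intro z hz
    change ∑ᶠ w : Space d, F (x - z - w, (S.shift z).shift w) * G (w, S.shift z) = _
    rw [← finsum_comp_equiv (Equiv.subRight z)]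
    simp only [Equiv.subRight_apply, Pattern.shift_shift, sub_add_cancel, sub_sub_sub_cancel_right]
    exact finsum_eq_sum_of_support_subset _ fun y hy => hB z hz y (right_ne_zero_of_mul hy)
  have h2 : ∀ y, conv G H (y, S) = ∑ z ∈ A, G (y - z, S.shift z) * H (z, S) := fun y =>
    conv_apply_eq_sum hA
  have h3 : ∀ y, conv G H (y, S) ≠ 0 → y ∈ B := by
    intro y hy
    rw [h2] at hy
    obtain ⟨z, hz, h⟩ := Finset.exists_ne_zero_of_sum_ne_zero hy
    exact hB z hz y (left_ne_zero_of_mul h)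
  rw [conv_apply_eq_sum h3]
  simp_rw [h2, Finset.mul_sum]
  rw [Finset.sum_comm]
  refine Finset.sum_congr rfl fun z hz => ?_
  simp only [h1 z hz, Finset.sum_mul, mul_assoc]

theorem adj_conv {Y : Set (Pattern d)} (hY : IsUnitSpace Y)
    {F G : Space d × Pattern d → ℂ} (hG : IsCc Y G) :
    adj (conv F G) = conv (adj G) (adj F) := by
  funext ⟨x, S⟩
  have hfin : {y | G (y, S.shift x) ≠ 0}.Finite := hG.finite_support hY _
  have h1 : adj (conv F G) (x, S) =
      ∑ᶠ y : Space d, star (F (-x - y, S.shift (y + x)) * G (y, S.shift x)) := by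
    change star (∑ᶠ y : Space d, F (-x - y, (S.shift x).shift y) * G (y, S.shift x)) = _
    simp only [Pattern.shift_shift]
    exact (starAddEquiv (R := ℂ)).toAddMonoidHom.map_finsum
      (hfin.subset fun y hy => right_ne_zero_of_mul hy)
  rw [h1, ← finsum_comp_equiv (Equiv.subRight x)]
  refine finsum_congr fun z => ?_
  simp [adj, inverse, mul_comm, sub_eq_add_neg, add_comm]

theorem conv_add {Y : Set (Pattern d)} (hY : IsUnitSpace Y)
    {F G H : Space d × Pattern d → ℂ} (hG : IsCc Y G) (hH : IsCc Y H) :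
    conv F (G + H) = conv F G + conv F H := by
  funext ⟨x, S⟩
  simp only [conv, Pi.add_apply, mul_add]
  exact finsum_add_distrib ((hG.finite_support hY S).subset fun y hy => right_ne_zero_of_mul hy)
    ((hH.finite_support hY S).subset fun y hy => right_ne_zero_of_mul hy)

theorem add_conv {Y : Set (Pattern d)} (hY : IsUnitSpace Y)
    {F G H : Space d × Pattern d → ℂ} (hH : IsCc Y H) :
    conv (F + G) H = conv F H + conv G H := by
  funext ⟨x, S⟩
  simp only [conv, Pi.add_apply, add_mul]
  exact finsum_add_distrib ((hH.finite_support hY S).subset fun y hy => right_ne_zero_of_mul hy)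
    ((hH.finite_support hY S).subset fun y hy => right_ne_zero_of_mul hy)

theorem conv_smul (c : ℂ) (F G : Space d × Pattern d → ℂ) : conv F (c • G) = c • conv F G := by
  funext γ
  rw [Pi.smul_apply, conv, conv, smul_finsum]
  exact finsum_congr fun y => by simp only [Pi.smul_apply, smul_eq_mul]; ring

theorem smul_conv (c : ℂ) (F G : Space d × Pattern d → ℂ) : conv (c • F) G = c • conv F G := by
  funext γ
  rw [Pi.smul_apply, conv, conv, smul_finsum]
  exact finsum_congr fun y => by simp only [Pi.smul_apply, smul_eq_mul]; ring

/-! ### The unit -/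

open Classical in
/-- The unit of the convolution algebra over a closed set of patterns. -/
def unitFun (Y : Set (Pattern d)) : Space d × Pattern d → ℂ :=
  fun γ => if γ.1 = 0 ∧ γ.2 ∈ Y then 1 else 0

theorem isCc_unitFun {Y : Set (Pattern d)} (hY : IsUnitSpace Y) (hcl : IsClosed Y) :
    IsCc Y (unitFun Y) := by
  refine isCc_of_isClosed hcl ?_ (isCompact_singleton (x := (0 : Space d))) ?_ ?_
  · obtain ⟨δ, hδ, h⟩ := uniformlySeparated_iff.1 hY.separated
    intro γ hγ
    -- Both `0` and `γ'.1` are sites of the pattern, so separation isolates the units from the other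
    -- arrows.
    have hzero : ∀ γ' ∈ arrows Y, γ'.1 = 0 ∨ δ ≤ ‖γ'.1‖ := by
      intro γ' h'
      by_contra! hcon
      refine hcon.1 (h _ h'.1 _ h'.2 _ (hY.zero_mem _ h'.1) ?_)
      simpa using hcon.2
    refine (continuousWithinAt_const (b := unitFun Y γ)).congr_of_eventuallyEq ?_ rfl
    have hopen : IsOpen {γ' : Space d × Pattern d | ‖γ'.1‖ < δ} :=
      isOpen_lt (by fun_prop) continuous_const
    have hopen' : IsOpen {γ' : Space d × Pattern d | γ'.1 ≠ 0} :=
      isOpen_ne.preimage continuous_fst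
    by_cases h0 : γ.1 = 0
    · filter_upwards [self_mem_nhdsWithin, mem_nhdsWithin_of_mem_nhds
        (hopen.mem_nhds (by simpa [h0] using hδ : γ ∈ {γ' : Space d × Pattern d | ‖γ'.1‖ < δ}))]
        with γ' h1 h2
      have : γ'.1 = 0 := (hzero γ' h1).resolve_right (not_le.2 h2)
      simp [unitFun, h0, this, h1.1, hγ.1]
    · filter_upwards [mem_nhdsWithin_of_mem_nhds (hopen'.mem_nhds h0)] with γ' h1
      rw [unitFun, unitFun, if_neg fun h => h1 h.1, if_neg fun h => h0 h.1]
  · intro γ hγ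
    refine if_neg fun h => hγ ⟨h.2, ?_⟩
    rw [h.1]
    exact hY.zero_mem _ h.2
  · exact fun γ hγ => if_neg fun h => hγ h.1

theorem conv_unitFun {Y : Set (Pattern d)} {F : Space d × Pattern d → ℂ} (hF : IsCc Y F) :
    conv F (unitFun Y) = F := by
  funext ⟨x, S⟩
  rw [conv, finsum_eq_single _ 0]
  · by_cases hS : S ∈ Y
    · simp [unitFun, hS]
    · simp [hF.eq_zero (γ := (x, S)) fun h => hS h.1, unitFun, hS]
  · intro y hy
    simp [unitFun, hy]

theorem adj_unitFun {Y : Set (Pattern d)} : adj (unitFun Y) = unitFun Y := by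
  funext ⟨x, S⟩
  by_cases hx : x = 0
  · subst hx
    by_cases hS : S ∈ Y <;> simp [adj, unitFun, inverse, hS]
  · simp [adj, unitFun, inverse, hx]

/-! ### Multiplication by functions on the unit space -/

/-- Multiplication of a function on the arrows by a function of the source. -/
def rmul (F : Space d × Pattern d → ℂ) (χ : C(Pattern d, ℝ)) : Space d × Pattern d → ℂ :=
  fun γ => F γ * χ γ.2

/-- Multiplication of a function on the arrows by a function of the range. -/
def lmul (χ : C(Pattern d, ℝ)) (F : Space d × Pattern d → ℂ) : Space d × Pattern d → ℂ :=
  fun γ => χ (γ.2.shift γ.1) * F γ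

theorem adj_rmul (F : Space d × Pattern d → ℂ) (χ : C(Pattern d, ℝ)) :
    adj (rmul F χ) = lmul χ (adj F) := by
  funext γ
  simp [adj, rmul, lmul, inverse, mul_comm]

theorem adj_lmul (F : Space d × Pattern d → ℂ) (χ : C(Pattern d, ℝ)) :
    adj (lmul χ F) = rmul (adj F) χ := by
  rw [← adj_adj (rmul _ _), adj_rmul, adj_adj]

theorem conv_rmul (F G : Space d × Pattern d → ℂ) (χ : C(Pattern d, ℝ)) :
    conv F (rmul G χ) = rmul (conv F G) χ := by
  funext γ
  simp only [conv, rmul]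
  rw [mul_comm, ← smul_eq_mul, smul_finsum]
  exact finsum_congr fun y => by rw [smul_eq_mul]; ring

/-- The range of the right factor is the source of the left one, so a function of this middle unit
can be moved from one factor to the other. -/
theorem conv_lmul (F G : Space d × Pattern d → ℂ) (χ : C(Pattern d, ℝ)) :
    conv F (lmul χ G) = conv (rmul F χ) G := by
  funext γ
  exact finsum_congr fun y => by simp only [rmul, lmul]; ring

theorem lmul_conv (F G : Space d × Pattern d → ℂ) (χ : C(Pattern d, ℝ)) :
    conv (lmul χ F) G = lmul χ (conv F G) := by
  funext γ
  simp only [conv, lmul]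
  rw [← smul_eq_mul, smul_finsum]
  refine finsum_congr fun y => ?_
  rw [Pattern.shift_shift, sub_add_cancel, smul_eq_mul, mul_assoc]

theorem lmul_rmul (F : Space d × Pattern d → ℂ) (χ ψ : C(Pattern d, ℝ)) :
    lmul χ (rmul F ψ) = rmul (lmul χ F) ψ := by
  funext γ
  simp only [rmul, lmul, mul_assoc]

theorem IsCc.rmul {Y : Set (Pattern d)} {F : Space d × Pattern d → ℂ} (hF : IsCc Y F)
    (χ : C(Pattern d, ℝ)) : IsCc Y (rmul F χ) := by
  obtain ⟨hc, C, hCY, hC, h0⟩ := hF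
  refine ⟨hc.mul (Continuous.continuousOn ?_), C, hCY, hC, fun γ h => by simp [Crystal.rmul, h0 γ h]⟩
  exact Complex.continuous_ofReal.comp (χ.continuous.comp continuous_snd)

theorem IsCc.lmul {Y : Set (Pattern d)} {F : Space d × Pattern d → ℂ} (hF : IsCc Y F)
    (χ : C(Pattern d, ℝ)) : IsCc Y (lmul χ F) := by
  obtain ⟨hc, C, hCY, hC, h0⟩ := hF
  refine ⟨(Continuous.continuousOn ?_).mul hc, C, hCY, hC, fun γ h => by simp [Crystal.lmul, h0 γ h]⟩
  exact Complex.continuous_ofReal.comp (χ.continuous.comp (continuous_snd.shift continuous_fst))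

/-- Multiplication by a cutoff function that vanishes near `Z` on the sources. -/
theorem IsCc.rmul_diff {Y Z : Set (Pattern d)} {F : Space d × Pattern d → ℂ}
    (hF : IsCc Y F) {χ : C(Pattern d, ℝ)} (hχ : Disjoint (tsupport χ) Z) :
    IsCc (Y \ Z) (Crystal.rmul F χ) := by
  obtain ⟨hc, C, hCY, hC, h0⟩ := hF.rmul χ
  refine ⟨hc.mono fun γ h => ⟨h.1.1, h.2⟩, C ∩ {γ | γ.2 ∈ tsupport χ}, ?_,
    hC.inter_right ((isClosed_tsupport χ).preimage continuous_snd), fun γ hγ => ?_⟩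
  · exact fun γ h => ⟨⟨(hCY h.1).1, Set.disjoint_left.1 hχ h.2⟩, (hCY h.1).2⟩
  · by_cases h : γ ∈ C
    · have : χ γ.2 = 0 := by
        by_contra h'
        exact hγ ⟨h, subset_tsupport _ h'⟩
      simp [Crystal.rmul, this]
    · exact h0 γ h

theorem IsCc.lmul_diff {Y Z : Set (Pattern d)} (hY : IsUnitSpace Y) (hZ : IsUnitSpace Z)
    {F : Space d × Pattern d → ℂ} (hF : IsCc Y F) {χ : C(Pattern d, ℝ)}
    (hχ : Disjoint (tsupport χ) Z) : IsCc (Y \ Z) (Crystal.lmul χ F) := by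
  rw [← adj_adj (Crystal.lmul χ F), adj_lmul]
  exact ((hF.adj hY).rmul_diff hχ).adj (hY.diff hZ)

/-- The right ideal property, obtained from the left one in `IsCc.conv` by taking adjoints. -/
theorem IsCc.conv_left {Y W : Set (Pattern d)} (hY : IsUnitSpace Y) (hW : IsUnitSpace W)
    (hWY : W ⊆ Y) {F G : Space d × Pattern d → ℂ} (hF : IsCc W F) (hG : IsCc Y G)
    : IsCc W (Crystal.conv F G) := by
  rw [← adj_adj (Crystal.conv F G), adj_conv hY hG]
  exact ((hG.adj hY).conv hW hWY (hF.adj hW)).adj hW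

/-- Cutoff functions that do not change a given function with compact support. -/
theorem exists_cutoff {K Z : Set (Pattern d)} (hK : IsCompact K) (hZ : IsClosed Z)
    (hKZ : Disjoint K Z) : ∃ χ : C(Pattern d, ℝ), (∀ S ∈ K, χ S = 1) ∧
      (∀ S, 0 ≤ χ S ∧ χ S ≤ 1) ∧ Disjoint (tsupport χ) Z := by
  obtain ⟨V, hV, hKV, hVZ⟩ := normal_exists_closure_subset hK.isClosed hZ.isOpen_compl
    (subset_compl_iff_disjoint_right.2 hKZ)
  obtain ⟨χ, h0, h1, h⟩ := exists_continuous_zero_one_of_isClosed hV.isClosed_compl hK.isClosed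
    (Set.disjoint_left.2 fun S hS hSK => hS (hKV hSK))
  refine ⟨χ, h1, fun S => h S, ?_⟩
  have : tsupport χ ⊆ closure V := closure_mono fun S hS => by
    by_contra h'
    exact hS (h0 h')
  exact Set.disjoint_left.2 fun S hS hSZ => hVZ (this hS) hSZ

theorem IsCc.exists_compact_source {Y Z : Set (Pattern d)} {F : Space d × Pattern d → ℂ}
    (hF : IsCc (Y \ Z) F) : ∃ K : Set (Pattern d), IsCompact K ∧ K ⊆ Y \ Z ∧
      ∀ χ : C(Pattern d, ℝ), (∀ S ∈ K, χ S = 1) → Crystal.rmul F χ = F := by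
  obtain ⟨_, C, hCY, hC, h0⟩ := hF
  refine ⟨Prod.snd '' C, hC.image continuous_snd, ?_, fun χ hχ => ?_⟩
  · rintro _ ⟨γ, hγ, rfl⟩
    exact (hCY hγ).1
  · funext γ
    by_cases h : γ ∈ C
    · simp [Crystal.rmul, hχ γ.2 ⟨γ, h, rfl⟩]
    · simp [Crystal.rmul, h0 γ h]

end Crystal

end

/-! ### The I-norm and the full C*-algebra -/

noncomputable section

namespace Crystal

open Filter

variable {d : ℕ}

/-! ### The I-norm -/

/-- The `ℓ¹`-norm of `F` along a fibre of the source map. -/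
def sumAbs (F : Space d × Pattern d → ℂ) (S : Pattern d) : ℝ := ∑ᶠ y : Space d, ‖F (y, S)‖

theorem tsum_enorm_eq {Y : Set (Pattern d)} (hY : IsUnitSpace Y) {F : Space d × Pattern d → ℂ}
    (hF : IsCc Y F) (S : Pattern d) :
    ∑' x : (S : Set (Space d)), ‖F ((x : Space d), S)‖ₑ = ENNReal.ofReal (sumAbs F S) := by
  have hfin := hF.finite_support hY S
  rw [tsum_subtype (S : Set (Space d)) (fun x => ‖F (x, S)‖ₑ), sumAbs,
    finsum_eq_sum_of_support_subset (s := hfin.toFinset) _ (fun y hy => by simpa using hy),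
    ENNReal.ofReal_sum_of_nonneg fun _ _ => norm_nonneg _,
    tsum_eq_sum (s := hfin.toFinset) fun y hy => ?_]
  · refine Finset.sum_congr rfl fun y hy => ?_
    rw [indicator_of_mem, ofReal_norm]
    exact (hF.mem (by simpa using hy : F (y, S) ≠ 0)).2
  · rw [indicator_apply_eq_zero]
    intro _
    simpa using hy

theorem iNorm_eq {Y : Set (Pattern d)} (hY : IsUnitSpace Y) (f : Cc Y) :
    iNorm f = max (⨆ S ∈ Y, ENNReal.ofReal (sumAbs (ext f) S))
      (⨆ S ∈ Y, ENNReal.ofReal (sumAbs (adj (ext f)) S)) := by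
  have h1 := tsum_enorm_eq hY (isCc_ext f)
  have h2 := tsum_enorm_eq hY ((isCc_ext f).adj hY)
  simp only [← h1, ← h2, iNorm]
  congr 1
  refine iSup_congr fun S => iSup_congr fun hS => tsum_congr fun x => ?_
  rw [adj, ← ofReal_norm, ← ofReal_norm, norm_star]
  rfl

theorem iNorm_le {Y : Set (Pattern d)} (hY : IsUnitSpace Y) {f : Cc Y} {M : ℝ}
    (h1 : ∀ S ∈ Y, sumAbs (ext f) S ≤ M) (h2 : ∀ S ∈ Y, sumAbs (adj (ext f)) S ≤ M) :
    iNorm f ≤ ENNReal.ofReal M := by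
  rw [iNorm_eq hY]
  exact max_le (iSup₂_le fun S hS => ENNReal.ofReal_le_ofReal (h1 S hS))
    (iSup₂_le fun S hS => ENNReal.ofReal_le_ofReal (h2 S hS))

theorem sumAbs_le {Y : Set (Pattern d)} (hY : IsUnitSpace Y) (f : Cc Y) {S : Pattern d}
    (hS : S ∈ Y) : sumAbs (ext f) S ≤ (iNorm f).toReal := by
  rw [← ENNReal.ofReal_le_iff_le_toReal (iNorm_lt_top hY.separated f).ne, iNorm_eq hY]
  exact le_max_of_le_left (le_iSup₂_of_le S hS le_rfl)

theorem sumAbs_adj_le {Y : Set (Pattern d)} (hY : IsUnitSpace Y) (f : Cc Y) {S : Pattern d}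
    (hS : S ∈ Y) : sumAbs (adj (ext f)) S ≤ (iNorm f).toReal := by
  rw [← ENNReal.ofReal_le_iff_le_toReal (iNorm_lt_top hY.separated f).ne, iNorm_eq hY]
  exact le_max_of_le_right (le_iSup₂_of_le S hS le_rfl)

theorem iNorm_mono {Y W : Set (Pattern d)} (hW : IsUnitSpace W) (hWY : W ⊆ Y)
    {f : Cc W} {g : Cc Y} (h : ∀ γ, γ.2 ∈ W → ‖ext f γ‖ ≤ ‖ext g γ‖) : iNorm f ≤ iNorm g := by
  have h' : ∀ γ, γ.2 ∈ W → ‖ext f γ‖ₑ ≤ ‖ext g γ‖ₑ := fun γ hγ => by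
    rw [← ofReal_norm, ← ofReal_norm]
    exact ENNReal.ofReal_le_ofReal (h γ hγ)
  refine max_le_max (iSup₂_le fun S hS => le_iSup₂_of_le S (hWY hS) ?_)
    (iSup₂_le fun S hS => le_iSup₂_of_le S (hWY hS) ?_)
  · exact ENNReal.tsum_le_tsum fun x => h' _ hS
  · exact ENNReal.tsum_le_tsum fun x => h' _ (hW.invariant S hS x x.2)

theorem Rep.norm_le {Y : Set (Pattern d)} (hY : IsUnitSpace Y) (π : Rep Y) (f : Cc Y) :
    ‖π.toFun f‖ ≤ (iNorm f).toReal := by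
  have h := π.bounded f
  rw [← ofReal_norm] at h
  exact (ENNReal.ofReal_le_iff_le_toReal (iNorm_lt_top hY.separated f).ne).1 h

/-! ### The convolution algebra -/

/-- The sum over the sites of the pattern may be extended to all of `ℝ^d`, because the right factor
vanishes off the arrows; all algebra is then done with functions on pairs. -/
theorem isConvolution_iff {Y : Set (Pattern d)} (hY : IsUnitSpace Y) {f g h : Cc Y} :
    IsConvolution f g h ↔ ext h = conv (ext f) (ext g) := by
  have key : ∀ γ : Space d × Pattern d,
      ∑ᶠ y : (γ.2 : Set (Space d)), ext f (γ.1 - y, γ.2.shift y) * ext g (y, γ.2) =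
        conv (ext f) (ext g) γ := by
    intro γ
    rw [finsum_set_coe_eq_finsum_mem (γ.2 : Set (Space d))
      (f := fun y => ext f (γ.1 - y, γ.2.shift y) * ext g (y, γ.2)), conv]
    refine finsum_congr fun y => ?_
    by_cases hy : y ∈ (γ.2 : Set (Space d))
    · simp [hy]
    · simp [hy, ext_of_notMem g (γ := (y, γ.2)) fun h => hy h.2]
  simp only [IsConvolution, key]
  refine ⟨fun H => funext fun γ => ?_, fun H γ => by rw [← H, ext_apply]⟩
  by_cases hγ : γ ∈ arrows Y
  · rw [← H ⟨γ, hγ⟩]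
    exact ext_apply h ⟨γ, hγ⟩
  · rw [ext_of_notMem _ hγ, ((isCc_ext f).conv hY subset_rfl (isCc_ext g)).eq_zero hγ]

theorem isAdjoint_iff {Y : Set (Pattern d)} (hY : IsUnitSpace Y) {f g : Cc Y} :
    IsAdjoint f g ↔ ext g = adj (ext f) := by
  refine ⟨fun H => funext fun γ => ?_, fun H γ => by rw [← ext_apply, H]; rfl⟩
  by_cases hγ : γ ∈ arrows Y
  · rw [ext_apply g ⟨γ, hγ⟩, H ⟨γ, hγ⟩]
    rfl
  · rw [ext_of_notMem _ hγ, ((isCc_ext f).adj hY).eq_zero hγ]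

namespace IsUnitSpace

variable {Y : Set (Pattern d)} (hY : IsUnitSpace Y)

/-- The product of the convolution algebra. -/
def mul (f g : Cc Y) : Cc Y :=
  mkCc (conv (ext f) (ext g)) ((isCc_ext f).conv hY subset_rfl (isCc_ext g))

/-- The involution of the convolution algebra. -/
def inv (f : Cc Y) : Cc Y := mkCc (adj (ext f)) ((isCc_ext f).adj hY)

/-- The unit of the convolution algebra of a closed set of patterns. -/
def one (hcl : IsClosed Y) : Cc Y := mkCc (unitFun Y) (isCc_unitFun hY hcl)

@[simp] theorem ext_mul (f g : Cc Y) : ext (hY.mul f g) = conv (ext f) (ext g) := ext_mkCc _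

@[simp] theorem ext_inv (f : Cc Y) : ext (hY.inv f) = adj (ext f) := ext_mkCc _

@[simp] theorem ext_one (hcl : IsClosed Y) : ext (hY.one hcl) = unitFun Y := ext_mkCc _

theorem mul_assoc (f g h : Cc Y) : hY.mul (hY.mul f g) h = hY.mul f (hY.mul g h) :=
  ext_injective (by simpa using conv_assoc hY (isCc_ext g) (isCc_ext h))

theorem mul_add (f g h : Cc Y) : hY.mul f (g + h) = hY.mul f g + hY.mul f h :=
  ext_injective (by simpa using conv_add hY (isCc_ext g) (isCc_ext h))

theorem add_mul (f g h : Cc Y) : hY.mul (f + g) h = hY.mul f h + hY.mul g h :=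
  ext_injective (by simpa using add_conv hY (isCc_ext h))

theorem mul_smul (c : ℂ) (f g : Cc Y) : hY.mul f (c • g) = c • hY.mul f g :=
  ext_injective (by simp [conv_smul])

theorem smul_mul (c : ℂ) (f g : Cc Y) : hY.mul (c • f) g = c • hY.mul f g :=
  ext_injective (by simp [smul_conv])

theorem inv_mul (f g : Cc Y) : hY.inv (hY.mul f g) = hY.mul (hY.inv g) (hY.inv f) :=
  ext_injective (by simpa using adj_conv hY (isCc_ext g))

@[simp] theorem inv_inv (f : Cc Y) : hY.inv (hY.inv f) = f := ext_injective (by simp)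

theorem inv_add (f g : Cc Y) : hY.inv (f + g) = hY.inv f + hY.inv g :=
  ext_injective (by simp [adj_add])

theorem inv_smul (c : ℂ) (f : Cc Y) : hY.inv (c • f) = star c • hY.inv f :=
  ext_injective (by
    simp only [ext_inv, ext_smul]
    funext γ
    simp [adj])

theorem mul_one (hcl : IsClosed Y) (f : Cc Y) : hY.mul f (hY.one hcl) = f :=
  ext_injective (by simpa using conv_unitFun (isCc_ext f))

theorem inv_one (hcl : IsClosed Y) : hY.inv (hY.one hcl) = hY.one hcl :=
  ext_injective (by simpa using adj_unitFun)

theorem rep_mul (π : Rep Y) (f g : Cc Y) :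
    π.toFun (hY.mul f g) = π.toFun f * π.toFun g :=
  π.map_convolution f g _ ((isConvolution_iff hY).2 (hY.ext_mul f g))

theorem rep_inv (π : Rep Y) (f : Cc Y) : π.toFun (hY.inv f) = star (π.toFun f) :=
  π.map_adjoint f _ ((isAdjoint_iff hY).2 (hY.ext_inv f))

end IsUnitSpace

/-! ### The full C*-algebra -/

instance (Y : Set (Pattern d)) : SMul ℂ (RepProduct Y) :=
  (lp.instModuleSubtypePreLpMemAddSubgroup :
    Module ℂ (RepProduct Y)).toDistribMulAction.toDistribSMul.toSMul

theorem toProduct_apply {Y : Set (Pattern d)} (hY : IsUnitSpace Y) (f : Cc Y) (π : Rep Y) :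
    toProduct f π = π.toFun f := by
  rw [toProduct, dif_pos (memℓp_of_uniformlySeparated hY.separated f)]

theorem norm_toFun_le_norm_ι {Y : Set (Pattern d)} (hY : IsUnitSpace Y) (f : Cc Y) (π : Rep Y) :
    ‖π.toFun f‖ ≤ ‖ι f‖ := by
  rw [← toProduct_apply hY]
  exact lp.norm_apply_le_norm (by simp) (toProduct f) π

theorem norm_ι_le {Y : Set (Pattern d)} (hY : IsUnitSpace Y) (f : Cc Y) {C : ℝ} (hC : 0 ≤ C)
    (h : ∀ π : Rep Y, ‖π.toFun f‖ ≤ C) : ‖ι f‖ ≤ C := by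
  refine lp.norm_le_of_forall_le (f := toProduct f) hC fun π => ?_
  rw [toProduct_apply hY]
  exact h π

theorem toProduct_add {Y : Set (Pattern d)} (hY : IsUnitSpace Y) (f g : Cc Y) :
    toProduct (f + g) = toProduct f + toProduct g := by
  refine lp.ext (funext fun π => ?_)
  simp [toProduct_apply hY]

theorem toProduct_smul {Y : Set (Pattern d)} (hY : IsUnitSpace Y) (c : ℂ) (f : Cc Y) :
    toProduct (c • f) = c • toProduct f := by
  refine lp.ext (funext fun π => ?_)
  simp [toProduct_apply hY]

theorem toProduct_mul {Y : Set (Pattern d)} (hY : IsUnitSpace Y) (f g : Cc Y) :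
    toProduct (hY.mul f g) = toProduct f * toProduct g := by
  refine lp.ext (funext fun π => ?_)
  rw [lp.infty_coeFn_mul, Pi.mul_apply, toProduct_apply hY, toProduct_apply hY,
    toProduct_apply hY, hY.rep_mul]

theorem toProduct_inv {Y : Set (Pattern d)} (hY : IsUnitSpace Y) (f : Cc Y) :
    toProduct (hY.inv f) = star (toProduct f) := by
  refine lp.ext (funext fun π => ?_)
  rw [lp.coeFn_star, Pi.star_apply, toProduct_apply hY, toProduct_apply hY, hY.rep_inv]

theorem ι_sub {Y : Set (Pattern d)} (hY : IsUnitSpace Y) (f g : Cc Y) :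
    ι (f - g) = ι f - ι g := by
  rw [sub_eq_add_neg, ← neg_one_smul ℂ g]
  refine Subtype.ext ?_
  change toProduct _ = toProduct f - toProduct g
  rw [toProduct_add hY, toProduct_smul hY, neg_one_smul, sub_eq_add_neg]

theorem ι_zero {Y : Set (Pattern d)} (hY : IsUnitSpace Y) : ι (0 : Cc Y) = 0 := by
  simpa using ι_sub hY 0 0

theorem ι_add {Y : Set (Pattern d)} (hY : IsUnitSpace Y) (f g : Cc Y) :
    ι (f + g) = ι f + ι g := Subtype.ext (toProduct_add hY f g)

/-- The image of the convolution algebra. -/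
def rangeSubalgebra {Y : Set (Pattern d)} (hY : IsUnitSpace Y) :
    NonUnitalStarSubalgebra ℂ (RepProduct Y) where
  carrier := range toProduct
  add_mem' := by
    rintro _ _ ⟨f, rfl⟩ ⟨g, rfl⟩
    exact ⟨f + g, toProduct_add hY f g⟩
  zero_mem' := ⟨0, congrArg Subtype.val (ι_zero hY)⟩
  mul_mem' := by
    rintro _ _ ⟨f, rfl⟩ ⟨g, rfl⟩
    exact ⟨_, toProduct_mul hY f g⟩
  smul_mem' := by
    rintro c _ ⟨f, rfl⟩
    exact ⟨c • f, toProduct_smul hY c f⟩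
  star_mem' := by
    rintro _ ⟨f, rfl⟩
    exact ⟨_, toProduct_inv hY f⟩

/-- The image of `C_c(𝒢_Y)` is already a *-subalgebra, so nothing is adjoined before the closure is
taken. -/
theorem denseRange_ι {Y : Set (Pattern d)} (hY : IsUnitSpace Y) :
    DenseRange (ι : Cc Y → CStar Y) := by
  have h : NonUnitalStarAlgebra.adjoin ℂ (range (toProduct (Y := Y))) = rangeSubalgebra hY :=
    le_antisymm (NonUnitalStarAlgebra.adjoin_le subset_rfl)
      (NonUnitalStarAlgebra.subset_adjoin ℂ _)
  rintro ⟨a, ha⟩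
  have ha' : a ∈ closure (range (toProduct (Y := Y))) := by
    have h2 : a ∈ closure
        (NonUnitalStarAlgebra.adjoin ℂ (range (toProduct (Y := Y))) : Set (RepProduct Y)) := ha
    rw [h] at h2
    exact h2
  rw [Metric.mem_closure_iff] at ha'
  refine Metric.mem_closure_iff.2 ?_
  intro ε hε
  obtain ⟨_, ⟨f, rfl⟩, hf⟩ := ha' ε hε
  exact ⟨ι f, ⟨f, rfl⟩, hf⟩

open scoped CStarAlgebra in
/-- Homomorphisms out of `C*(𝒢_Y)` are determined by their values on `C_c(𝒢_Y)`. -/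
theorem CStar.hom_ext {Y : Set (Pattern d)} (hY : IsUnitSpace Y) {A : Type*}
    [NonUnitalCStarAlgebra A] {φ ψ : CStar Y →⋆ₙₐ[ℂ] A} (h : ∀ f : Cc Y, φ (ι f) = ψ (ι f)) :
    φ = ψ := by
  refine DFunLike.coe_injective ((denseRange_ι hY).equalizer ?_ ?_ (funext h))
  · exact map_continuous φ
  · exact map_continuous ψ

/-- A linear map between convolution algebras that induces a homomorphism between the full
C*-algebras. -/
structure CcHom (Y Y' : Set (Pattern d)) where
  toLin : Cc Y →ₗ[ℂ] Cc Y'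
  map_convolution : ∀ f g h, IsConvolution f g h → IsConvolution (toLin f) (toLin g) (toLin h)
  map_adjoint : ∀ f g, IsAdjoint f g → IsAdjoint (toLin f) (toLin g)
  iNorm_le : ∀ f, iNorm (toLin f) ≤ iNorm f

namespace CcHom

variable {Y Y' : Set (Pattern d)} (θ : CcHom Y Y')

/-- The pullback of representations. -/
abbrev pull (π : Rep Y') : Rep Y where
  H := π.H
  toFun := π.toFun ∘ₗ θ.toLin
  map_convolution f g h H := π.map_convolution _ _ _ (θ.map_convolution f g h H)
  map_adjoint f g H := π.map_adjoint _ _ (θ.map_adjoint f g H)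
  bounded f := (π.bounded _).trans (θ.iNorm_le f)

theorem norm_pull_le (a : RepProduct Y) (π : Rep Y') : ‖a (θ.pull π)‖ ≤ ‖a‖ :=
  lp.norm_apply_le_norm (by simp) a _

/-- The homomorphism between the products of all representations. -/
def product : RepProduct Y →⋆ₙₐ[ℂ] RepProduct Y' where
  toFun a := ⟨fun π => a (θ.pull π), memℓp_infty ⟨‖a‖, by
    rintro _ ⟨π, rfl⟩
    exact θ.norm_pull_le a π⟩⟩
  map_smul' _ _ := rfl
  map_zero' := rfl
  map_add' _ _ := rfl
  map_mul' _ _ := rfl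
  map_star' _ := rfl

theorem continuous_product : Continuous θ.product := by
  refine AddMonoidHomClass.continuous_of_bound θ.product 1 fun a => ?_
  rw [one_mul]
  exact lp.norm_le_of_forall_le (norm_nonneg a) fun π => θ.norm_pull_le a π

theorem product_toProduct (hY : IsUnitSpace Y) (hY' : IsUnitSpace Y') (f : Cc Y) :
    θ.product (toProduct f) = toProduct (θ.toLin f) := by
  refine lp.ext (funext fun π => ?_)
  rw [toProduct_apply hY']
  exact toProduct_apply hY f (θ.pull π)

theorem product_mem (hY : IsUnitSpace Y) (hY' : IsUnitSpace Y') :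
    cstarSubalgebra Y ≤ (cstarSubalgebra Y').comap θ.product := by
  refine NonUnitalStarSubalgebra.topologicalClosure_minimal _ (NonUnitalStarAlgebra.adjoin_le ?_)
    ((NonUnitalStarSubalgebra.isClosed_topologicalClosure _).preimage θ.continuous_product)
  rintro _ ⟨f, rfl⟩
  change θ.product (toProduct f) ∈ cstarSubalgebra Y'
  rw [θ.product_toProduct hY hY']
  exact (ι (θ.toLin f) : cstarSubalgebra Y').2

/-- The induced homomorphism between the full C*-algebras. -/
def map (hY : IsUnitSpace Y) (hY' : IsUnitSpace Y') : CStar Y →⋆ₙₐ[ℂ] CStar Y' where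
  toFun a := (⟨θ.product (a : cstarSubalgebra Y).1, θ.product_mem hY hY' (a : cstarSubalgebra Y).2⟩ :
    cstarSubalgebra Y')
  map_smul' _ _ := rfl
  map_zero' := rfl
  map_add' _ _ := rfl
  map_mul' _ _ := rfl
  map_star' _ := rfl

theorem map_ι (hY : IsUnitSpace Y) (hY' : IsUnitSpace Y') (f : Cc Y) :
    θ.map hY hY' (ι f) = ι (θ.toLin f) :=
  Subtype.ext (θ.product_toProduct hY hY' f)

end CcHom

end Crystal

end

/-! ### GNS representations and isometry of extension by zero -/

noncomputable section

namespace Crystal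

open Filter UniformSpace
open scoped InnerProductSpace

variable {d : ℕ}

/-! ### Positive functionals and the GNS construction -/

/-- A positive functional on the convolution algebra whose GNS representation is I-norm bounded. -/
structure PositiveFunctional {Y : Set (Pattern d)} (hY : IsUnitSpace Y) where
  toLin : Cc Y →ₗ[ℂ] ℂ
  map_inv : ∀ f, toLin (hY.inv f) = star (toLin f)
  nonneg : ∀ f, 0 ≤ (toLin (hY.mul (hY.inv f) f)).re
  bound : ∀ k f, (toLin (hY.mul (hY.inv (hY.mul k f)) (hY.mul k f))).re ≤
    (iNorm k).toReal ^ 2 * (toLin (hY.mul (hY.inv f) f)).re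

namespace PositiveFunctional

variable {Y : Set (Pattern d)} {hY : IsUnitSpace Y} (φ : PositiveFunctional hY)

set_option linter.unusedVariables false in
/-- The convolution algebra with the inner product of a positive functional. -/
def PreGNS (φ : PositiveFunctional hY) : Type := Cc Y

instance : AddCommGroup φ.PreGNS := inferInstanceAs (AddCommGroup (Cc Y))
instance : Module ℂ φ.PreGNS := inferInstanceAs (Module ℂ (Cc Y))

/-- The identity map to the pre-Hilbert space of a positive functional. -/
def toPreGNS : Cc Y ≃ₗ[ℂ] φ.PreGNS := LinearEquiv.refl ℂ _

/-- The pre-inner product of a positive functional. -/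
abbrev core : PreInnerProductSpace.Core ℂ φ.PreGNS where
  inner a b := φ.toLin (hY.mul (hY.inv (φ.toPreGNS.symm a)) (φ.toPreGNS.symm b))
  conj_inner_symm a b := by
    rw [starRingEnd_apply, ← φ.map_inv, hY.inv_mul, hY.inv_inv]
  re_inner_nonneg a := φ.nonneg _
  add_left a b c := by rw [map_add, hY.inv_add, hY.add_mul, map_add]
  smul_left a b c := by
    rw [map_smul, hY.inv_smul, hY.smul_mul, map_smul]
    rfl

instance : SeminormedAddCommGroup φ.PreGNS :=
  InnerProductSpace.Core.toSeminormedAddCommGroup (c := φ.core)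
instance : InnerProductSpace ℂ φ.PreGNS := InnerProductSpace.ofCore φ.core

theorem inner_toPreGNS (f g : Cc Y) :
    ⟪φ.toPreGNS f, φ.toPreGNS g⟫_ℂ = φ.toLin (hY.mul (hY.inv f) g) := rfl

theorem norm_toPreGNS_sq (f : Cc Y) :
    ‖φ.toPreGNS f‖ ^ 2 = (φ.toLin (hY.mul (hY.inv f) f)).re := by
  rw [← inner_toPreGNS, ← inner_self_eq_norm_sq (𝕜 := ℂ)]
  rfl

/-- Left multiplication in the convolution algebra. -/
def leftMul (k : Cc Y) : φ.PreGNS →L[ℂ] φ.PreGNS :=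
  LinearMap.mkContinuous
    { toFun := fun a => φ.toPreGNS (hY.mul k (φ.toPreGNS.symm a))
      map_add' := fun a b => by rw [map_add, hY.mul_add, map_add]
      map_smul' := fun c a => by rw [map_smul, hY.mul_smul, map_smul, RingHom.id_apply] }
    (iNorm k).toReal fun a => by
      refine le_of_sq_le_sq ?_ (by positivity)
      rw [mul_pow]
      have h := φ.norm_toPreGNS_sq (φ.toPreGNS.symm a)
      rw [LinearEquiv.apply_symm_apply] at h
      rw [h]
      exact (φ.norm_toPreGNS_sq _).trans_le (φ.bound k _)

theorem leftMul_apply (k f : Cc Y) : φ.leftMul k (φ.toPreGNS f) = φ.toPreGNS (hY.mul k f) := rfl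

theorem norm_leftMul_le (k : Cc Y) : ‖φ.leftMul k‖ ≤ (iNorm k).toReal :=
  LinearMap.mkContinuous_norm_le _ ENNReal.toReal_nonneg _

theorem completion_ext {T T' : Completion φ.PreGNS →L[ℂ] Completion φ.PreGNS}
    (h : ∀ f : Cc Y, T (φ.toPreGNS f) = T' (φ.toPreGNS f)) : T = T' := by
  ext c
  induction c using Completion.induction_on with
  | hp => exact isClosed_eq T.continuous T'.continuous
  | ih c => exact h (φ.toPreGNS.symm c)

/-- The GNS representation of a positive functional. -/
def gns : Rep Y where
  H := Completion φ.PreGNS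
  toFun :=
    { toFun := fun k => (φ.leftMul k).completion
      map_add' := fun k l => φ.completion_ext fun f => by
        simp only [ContinuousLinearMap.completion_apply_coe, add_apply,
          leftMul_apply, hY.add_mul, map_add, Completion.coe_add]
      map_smul' := fun c k => φ.completion_ext fun f => by
        simp only [ContinuousLinearMap.completion_apply_coe, smul_apply,
          leftMul_apply, hY.smul_mul, map_smul, Completion.coe_smul, RingHom.id_apply] }
  map_convolution f g h H := φ.completion_ext fun a => by
    have : h = hY.mul f g := ext_injective (by rw [(isConvolution_iff hY).1 H, hY.ext_mul])
    subst this
    simp only [LinearMap.coe_mk, AddHom.coe_mk, mul_apply_eq_comp,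
      ContinuousLinearMap.completion_apply_coe, leftMul_apply, hY.mul_assoc]
  map_adjoint f g H := by
    have : g = hY.inv f := ext_injective (by rw [(isAdjoint_iff hY).1 H, hY.ext_inv])
    subst this
    refine (ContinuousLinearMap.eq_adjoint_iff _ _).2 fun x y => ?_
    simp only [LinearMap.coe_mk, AddHom.coe_mk]
    induction x, y using Completion.induction_on₂ with
    | hp => apply isClosed_eq <;> fun_prop
    | ih x y =>
      simp only [ContinuousLinearMap.completion_apply_coe, Completion.inner_coe]
      obtain ⟨x, rfl⟩ := φ.toPreGNS.surjective x
      obtain ⟨y, rfl⟩ := φ.toPreGNS.surjective y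
      simp only [leftMul_apply, inner_toPreGNS, hY.inv_mul, hY.inv_inv, hY.mul_assoc]
  bounded f := by
    rw [← ofReal_norm, ENNReal.ofReal_le_iff_le_toReal (iNorm_lt_top hY.separated f).ne]
    refine ContinuousLinearMap.opNorm_le_bound _ ENNReal.toReal_nonneg fun x => ?_
    simp only [LinearMap.coe_mk, AddHom.coe_mk]
    induction x using Completion.induction_on with
    | hp => apply isClosed_le <;> fun_prop
    | ih x =>
      rw [ContinuousLinearMap.completion_apply_coe, Completion.norm_coe, Completion.norm_coe]
      exact ContinuousLinearMap.le_of_opNorm_le _ (φ.norm_leftMul_le f) x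

/-- The vectors of the GNS representation that come from the convolution algebra. -/
def vec (f : Cc Y) : φ.gns.H := ((φ.toPreGNS f : φ.PreGNS) : Completion φ.PreGNS)

theorem gns_vec (k f : Cc Y) : φ.gns.toFun k (φ.vec f) = φ.vec (hY.mul k f) :=
  ContinuousLinearMap.completion_apply_coe _ _

theorem norm_vec_sq (f : Cc Y) : ‖φ.vec f‖ ^ 2 = (φ.toLin (hY.mul (hY.inv f) f)).re := by
  rw [← φ.norm_toPreGNS_sq]
  exact congrArg (· ^ 2) (Completion.norm_coe _)

/-- The operator of `k` maps the dense vectors coming from `f` to those of `k * f`, whose norms are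
the values assumed to vanish. -/
theorem gns_eq_zero {k : Cc Y}
    (h : ∀ f, (φ.toLin (hY.mul (hY.inv (hY.mul k f)) (hY.mul k f))).re = 0) :
    φ.gns.toFun k = 0 := by
  refine φ.completion_ext fun f => ?_
  have h1 := φ.norm_vec_sq (hY.mul k f)
  rw [h f, sq_eq_zero_iff, norm_eq_zero, ← φ.gns_vec] at h1
  exact h1

/-- The norm of the GNS representation is bounded below by the values of the functional. -/
theorem le_norm_gns_mul (hcl : IsClosed Y) (f : Cc Y) :
    (φ.toLin (hY.mul (hY.inv f) f)).re ≤
      ‖φ.gns.toFun f‖ ^ 2 * (φ.toLin (hY.one hcl)).re := by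
  have h1 := φ.norm_vec_sq f
  have h2 := φ.norm_vec_sq (hY.one hcl)
  rw [hY.mul_one, hY.inv_one] at h2
  rw [← h1, ← h2, ← mul_pow]
  -- Applied to the vector of the unit, `f` gives the vector of `f` itself; closedness of `Y` is
  -- what provides this unit.
  have h3 := (φ.gns.toFun f).le_opNorm (φ.vec (hY.one hcl))
  rw [φ.gns_vec, hY.mul_one] at h3
  gcongr

/-- Pointwise limits of bounded nets of positive functionals along ultrafilters. -/
theorem exists_limit {I : Type*} (𝒰 : Ultrafilter I) (ψ : I → PositiveFunctional hY)
    (B : Cc Y → ℝ) (hB : ∀ i f, ‖(ψ i).toLin f‖ ≤ B f) :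
    ∃ φ : PositiveFunctional hY, ∀ f,
      Tendsto (fun i => (ψ i).toLin f) 𝒰 (𝓝 (φ.toLin f)) := by
  have h : ∀ f, ∃ z : ℂ, Tendsto (fun i => (ψ i).toLin f) 𝒰 (𝓝 z) := by
    intro f
    -- The values stay in a compact disc, so they converge along the ultrafilter; all axioms of a
    -- positive functional are closed conditions and pass to the limit.
    obtain ⟨z, _, hz⟩ := (isCompact_closedBall (0 : ℂ) (B f)).ultrafilter_le_nhds
      (𝒰.map fun i => (ψ i).toLin f)
      (le_principal_iff.2 (Filter.mem_map.2 (Filter.univ_mem' fun i => by simpa using hB i f)))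
    exact ⟨z, hz⟩
  choose L hL using h
  have hre : ∀ f, Tendsto (fun i => ((ψ i).toLin f).re) 𝒰 (𝓝 (L f).re) := fun f =>
    (Complex.continuous_re.tendsto _).comp (hL f)
  refine ⟨⟨⟨⟨L, fun f g => ?_⟩, fun c f => ?_⟩, fun f => ?_, fun f => ?_, fun k f => ?_⟩, hL⟩
  · refine tendsto_nhds_unique (hL (f + g)) ?_
    simpa using (hL f).add (hL g)
  · refine tendsto_nhds_unique (hL (c • f)) ?_
    simpa using (hL f).const_mul c
  · refine tendsto_nhds_unique (hL (hY.inv f)) ?_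
    simp only [map_inv]
    exact (hL f).star
  · exact ge_of_tendsto' (hre _) fun i => (ψ i).nonneg f
  · exact le_of_tendsto_of_tendsto' (hre _) ((hre _).const_mul _) fun i => (ψ i).bound k f

end PositiveFunctional

/-! ### Compressed vector functionals -/

section Compress

variable {Y Z W : Set (Pattern d)}

/-- Multiplication by a cutoff function on the source. -/
def cutRight (hW : W = Y \ Z) {χ : C(Pattern d, ℝ)} (hχ : Disjoint (tsupport χ) Z) :
    Cc Y →ₗ[ℂ] Cc W where
  toFun f := mkCc (rmul (ext f) χ) (hW ▸ (isCc_ext f).rmul_diff hχ)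
  map_add' f g := ext_injective (by
    simp only [ext_mkCc, ext_add]
    funext γ
    simp [rmul, add_mul])
  map_smul' c f := ext_injective (by
    simp only [ext_mkCc, ext_smul]
    funext γ
    simp [rmul, mul_assoc])

/-- Multiplication by a cutoff function on the source and on the range. -/
def compress (hW : W = Y \ Z) {χ : C(Pattern d, ℝ)} (hχ : Disjoint (tsupport χ) Z) :
    Cc Y →ₗ[ℂ] Cc W where
  toFun f := mkCc (lmul χ (rmul (ext f) χ)) ((hW ▸ (isCc_ext f).rmul_diff hχ : IsCc W _).lmul χ)
  map_add' f g := ext_injective (by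
    simp only [ext_mkCc, ext_add]
    funext γ
    simp [rmul, lmul]
    ring)
  map_smul' c f := ext_injective (by
    simp only [ext_mkCc, ext_smul]
    funext γ
    simp [rmul, lmul]
    ring)

variable {hW : W = Y \ Z} {χ : C(Pattern d, ℝ)} {hχ : Disjoint (tsupport χ) Z}

@[simp] theorem ext_cutRight (f : Cc Y) : ext (cutRight hW hχ f) = rmul (ext f) χ :=
  ext_mkCc (hW ▸ (isCc_ext f).rmul_diff hχ)

@[simp] theorem ext_compress (f : Cc Y) :
    ext (compress hW hχ f) = lmul χ (rmul (ext f) χ) :=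
  ext_mkCc ((hW ▸ (isCc_ext f).rmul_diff hχ : IsCc W _).lmul χ)

theorem compress_inv (hY : IsUnitSpace Y) (hWu : IsUnitSpace W) (f : Cc Y) :
    compress hW hχ (hY.inv f) = hWu.inv (compress hW hχ f) :=
  ext_injective (by simp [adj_rmul, adj_lmul, lmul_rmul])

/-- The identity `χ (f* g) χ = (f χ)* (g χ)`. It turns the compressed vector functional at `f* f`
into a squared norm, which gives positivity. -/
theorem compress_inv_mul (hY : IsUnitSpace Y) (hWu : IsUnitSpace W) (f g : Cc Y) :
    compress hW hχ (hY.mul (hY.inv f) g) =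
      hWu.mul (hWu.inv (cutRight hW hχ f)) (cutRight hW hχ g) :=
  ext_injective (by simp [adj_rmul, lmul_conv, conv_rmul, lmul_rmul])

theorem norm_rep_inv_mul (hWu : IsUnitSpace W) (π : Rep W) (ξ : π.H) (f : Cc W) :
    ⟪ξ, π.toFun (hWu.mul (hWu.inv f) f) ξ⟫_ℂ = ((‖π.toFun f ξ‖ ^ 2 : ℝ) : ℂ) := by
  rw [hWu.rep_mul, hWu.rep_inv, ContinuousLinearMap.star_eq_adjoint, mul_apply_eq_comp,
    ContinuousLinearMap.adjoint_inner_right, inner_self_eq_norm_sq_to_K]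
  norm_cast

theorem iNorm_cut_le (hWu : IsUnitSpace W)
    (h01 : ∀ S, 0 ≤ χ S ∧ χ S ≤ 1) (f : Cc Y) :
    iNorm (cutRight hW hχ f) ≤ iNorm f ∧ iNorm (compress hW hχ f) ≤ iNorm f := by
  have habs : ∀ S, ‖(χ S : ℂ)‖ ≤ 1 := fun S => by
    rw [Complex.norm_real, Real.norm_eq_abs, abs_le]
    exact ⟨by linarith [(h01 S).1], (h01 S).2⟩
  have hWY : W ⊆ Y := hW ▸ sdiff_subset
  refine ⟨iNorm_mono hWu hWY fun γ _ => ?_, iNorm_mono hWu hWY fun γ _ => ?_⟩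
  · rw [ext_cutRight, rmul, norm_mul]
    exact mul_le_of_le_one_right (norm_nonneg _) (habs _)
  · rw [ext_compress, lmul, rmul, norm_mul, norm_mul]
    refine (mul_le_of_le_one_left (by positivity) (habs _)).trans ?_
    exact mul_le_of_le_one_right (norm_nonneg _) (habs _)

/-- A second cutoff, equal to one on the ranges of the truncated `f`, can be inserted between the
factors and moved to `k`. Left multiplication by `k` is thereby realized inside `C_c(𝒢_W)` without
increasing the I-norm, which gives the bound required of a positive functional. -/
theorem exists_cutRight_mul (hY : IsUnitSpace Y) (hWu : IsUnitSpace W) (hZ : IsClosed Z)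
    (k f : Cc Y) : ∃ k' : Cc W, iNorm k' ≤ iNorm k ∧
      cutRight hW hχ (hY.mul k f) = hWu.mul k' (cutRight hW hχ f) := by
  subst hW
  set F := cutRight (Y := Y) (Z := Z) rfl hχ f
  obtain ⟨K, hK, hKW, hχ'⟩ := ((isCc_ext F).adj hWu).exists_compact_source
  obtain ⟨χ', h1, h01, hd⟩ := exists_cutoff hK hZ (Set.disjoint_left.2 fun S hS => (hKW hS).2)
  refine ⟨cutRight rfl hd k, (iNorm_cut_le hWu h01 k).1, ext_injective ?_⟩
  have h2 : lmul χ' (ext F) = ext F := by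
    rw [← adj_adj (lmul χ' (ext F)), adj_lmul, hχ' χ' h1, adj_adj]
  rw [hWu.ext_mul, ext_cutRight, ext_cutRight, hY.ext_mul, ← conv_lmul, h2, ← conv_rmul]
  simp [F]

/-- The vector functional of a representation of `C_c(𝒢_W)`, compressed by a cutoff function. -/
def compressedFunctional (hW : W = Y \ Z) {χ : C(Pattern d, ℝ)} (hχ : Disjoint (tsupport χ) Z)
    (hY : IsUnitSpace Y) (hWu : IsUnitSpace W) (hZ : IsClosed Z)
    (π : Rep W) (ξ : π.H) : PositiveFunctional hY where
  toLin := (innerSL ℂ ξ).toLinearMap ∘ₗ (ContinuousLinearMap.apply ℂ π.H ξ).toLinearMap ∘ₗ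
    π.toFun ∘ₗ compress hW hχ
  map_inv f := by
    change ⟪ξ, π.toFun (compress hW hχ (hY.inv f)) ξ⟫_ℂ = star ⟪ξ, π.toFun (compress hW hχ f) ξ⟫_ℂ
    rw [compress_inv hY hWu, hWu.rep_inv, ContinuousLinearMap.star_eq_adjoint,
      ContinuousLinearMap.adjoint_inner_right]
    exact (inner_conj_symm _ _).symm
  nonneg f := by
    change 0 ≤ (⟪ξ, π.toFun (compress hW hχ (hY.mul (hY.inv f) f)) ξ⟫_ℂ).re
    rw [compress_inv_mul hY hWu, norm_rep_inv_mul, Complex.ofReal_re]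
    positivity
  bound k f := by
    change (⟪ξ, π.toFun (compress hW hχ (hY.mul _ _)) ξ⟫_ℂ).re ≤
      _ * (⟪ξ, π.toFun (compress hW hχ (hY.mul _ f)) ξ⟫_ℂ).re
    rw [compress_inv_mul hY hWu, compress_inv_mul hY hWu, norm_rep_inv_mul, norm_rep_inv_mul,
      Complex.ofReal_re, Complex.ofReal_re, ← mul_pow]
    obtain ⟨k', hk', h⟩ := exists_cutRight_mul (hW := hW) (hχ := hχ) hY hWu hZ k f
    rw [h, hWu.rep_mul, mul_apply_eq_comp]
    gcongr
    refine ContinuousLinearMap.le_of_opNorm_le _ ((π.norm_le hWu k').trans ?_) _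
    exact ENNReal.toReal_mono (iNorm_lt_top hY.separated k).ne hk'

theorem compressedFunctional_apply (hY : IsUnitSpace Y) (hWu : IsUnitSpace W) (hZ : IsClosed Z)
    (π : Rep W) (ξ : π.H) (f : Cc Y) :
    (compressedFunctional hW hχ hY hWu hZ π ξ).toLin f = ⟪ξ, π.toFun (compress hW hχ f) ξ⟫_ℂ := rfl

theorem compressedFunctional_inv_mul (hY : IsUnitSpace Y) (hWu : IsUnitSpace W) (hZ : IsClosed Z)
    (π : Rep W) (ξ : π.H) (f : Cc Y) :
    ((compressedFunctional hW hχ hY hWu hZ π ξ).toLin (hY.mul (hY.inv f) f)).re =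
      ‖π.toFun (cutRight hW hχ f) ξ‖ ^ 2 := by
  rw [compressedFunctional_apply, compress_inv_mul hY hWu, norm_rep_inv_mul, Complex.ofReal_re]

theorem norm_compressedFunctional_le (hY : IsUnitSpace Y) (hWu : IsUnitSpace W) (hZ : IsClosed Z)
    (h01 : ∀ S, 0 ≤ χ S ∧ χ S ≤ 1) (π : Rep W) (ξ : π.H) (f : Cc Y) :
    ‖(compressedFunctional hW hχ hY hWu hZ π ξ).toLin f‖ ≤ (iNorm f).toReal * ‖ξ‖ ^ 2 := by
  rw [compressedFunctional_apply]
  refine (norm_inner_le_norm _ _).trans ?_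
  have h1 := ContinuousLinearMap.le_of_opNorm_le _ ((π.norm_le hWu (compress hW hχ f)).trans
    (ENNReal.toReal_mono (iNorm_lt_top hY.separated f).ne
      (iNorm_cut_le hWu h01 f).2)) ξ
  calc _ ≤ ‖ξ‖ * ((iNorm f).toReal * ‖ξ‖) := by gcongr
    _ = _ := by ring

end Compress

theorem iNorm_one_le {Y : Set (Pattern d)} (hY : IsUnitSpace Y) (hcl : IsClosed Y) :
    (iNorm (hY.one hcl)).toReal ≤ 1 := by
  have h : ∀ S, sumAbs (unitFun Y) S ≤ 1 := by
    intro S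
    rw [sumAbs, finsum_eq_single _ 0 fun y hy => by simp [unitFun, hy]]
    rw [unitFun]
    split_ifs <;> simp
  refine ENNReal.toReal_le_of_le_ofReal zero_le_one (iNorm_le hY (fun S _ => ?_) fun S _ => ?_)
  · rw [hY.ext_one]
    exact h S
  · rw [hY.ext_one, adj_unitFun]
    exact h S

/-- Extension by zero does not decrease the norm of the full C*-algebra. -/
theorem norm_ι_le_of_ext_eq {Y Z : Set (Pattern d)} (hY : IsUnitSpace Y) (hcl : IsClosed Y)
    (hZ : IsUnitSpace Z) (hZcl : IsClosed Z) (f : Cc (Y \ Z)) (g : Cc Y) (h : ext g = ext f) :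
    ‖ι f‖ ≤ ‖ι g‖ := by
  have hWu := hY.diff hZ
  refine norm_ι_le hWu f (norm_nonneg _) fun π =>
    ContinuousLinearMap.opNorm_le_bound _ (norm_nonneg _) fun ξ => ?_
  obtain ⟨K, hK, hKW, hχ'⟩ := (isCc_ext f).exists_compact_source
  obtain ⟨χ, h1, h01, hd⟩ := exists_cutoff hK hZcl (Set.disjoint_left.2 fun S hS => (hKW hS).2)
  -- Since `χ` is one on the sources of `f`, this functional takes the value `‖π(f)ξ‖²` at `g* g`,
  -- while its value at the unit is at most `‖ξ‖²`. Its GNS representation is one over all of `Y`.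
  set φ := compressedFunctional rfl hd hY hWu hZcl π ξ
  have h2 : cutRight rfl hd g = f := ext_injective (by rw [ext_cutRight, h, hχ' χ h1])
  have h3 := φ.le_norm_gns_mul hcl g
  rw [compressedFunctional_inv_mul, h2] at h3
  have h4 : (φ.toLin (hY.one hcl)).re ≤ ‖ξ‖ ^ 2 := by
    refine (Complex.re_le_norm _).trans ((norm_compressedFunctional_le hY hWu hZcl h01 π ξ _).trans ?_)
    exact mul_le_of_le_one_left (by positivity) (iNorm_one_le hY hcl)
  have h5 : 0 ≤ (φ.toLin (hY.one hcl)).re := by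
    simpa only [hY.mul_one, hY.inv_one] using φ.nonneg (hY.one hcl)
  refine le_of_sq_le_sq ?_ (by positivity)
  rw [mul_pow]
  refine h3.trans ?_
  gcongr
  exact norm_toFun_le_norm_ι hY g _

end Crystal

end

/-! ### Restriction to closed invariant sets and the quotient norm -/

noncomputable section

namespace Crystal

open Filter

variable {d : ℕ}

/-! ### Restriction and extension by zero -/

section Exact

variable {Y Z : Set (Pattern d)}

theorem restrictTo_conv (hZ : IsUnitSpace Z) {F G : Space d × Pattern d → ℂ} (hG : IsCc Y G) :
    restrictTo Z (conv F G) = conv (restrictTo Z F) (restrictTo Z G) := by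
  funext ⟨x, S⟩
  by_cases hS : S ∈ Z
  · rw [restrictTo, if_pos hS]
    refine finsum_congr fun y => ?_
    by_cases hy : y ∈ S
    · simp [restrictTo, hS, hZ.invariant S hS y hy]
    · have : G (y, S) = 0 := hG.eq_zero fun h => hy h.2
      simp [restrictTo, this]
  · simp [restrictTo, hS, conv]

theorem restrictTo_adj (hY : IsUnitSpace Y) (hZ : IsUnitSpace Z) {F : Space d × Pattern d → ℂ}
    (hF : IsCc Y F) : restrictTo Z (adj F) = adj (restrictTo Z F) := by
  funext γ
  by_cases hγ : γ ∈ arrows Y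
  · have h := hZ.shift_mem_iff (hY.zero_mem _ hγ.1) hγ.2
    by_cases h' : γ.2 ∈ Z
    · rw [restrictTo, if_pos h', adj, adj, restrictTo, if_pos (show (inverse γ).2 ∈ Z from h.2 h')]
    · rw [restrictTo, if_neg h', adj, restrictTo,
        if_neg (show (inverse γ).2 ∉ Z from mt h.1 h'), star_zero]
  · have h := (hF.adj hY).eq_zero hγ
    have h' : F (inverse γ) = 0 := star_eq_zero.1 h
    simp only [restrictTo, adj, h']
    simp

/-- Restriction of functions to a closed invariant set of units. -/
def restrictCc (hY : IsUnitSpace Y) (hZ : IsUnitSpace Z) (hZcl : IsClosed Z) (hZY : Z ⊆ Y) :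
    CcHom Y Z where
  toLin :=
    { toFun := fun f => mkCc (restrictTo Z (ext f)) ((isCc_ext f).restrictTo hZcl hZY)
      map_add' := fun f g => ext_injective (by
        simp only [ext_mkCc, ext_add]
        funext γ
        simp only [restrictTo, Pi.add_apply]
        split_ifs <;> simp)
      map_smul' := fun c f => ext_injective (by
        simp only [ext_mkCc, ext_smul]
        funext γ
        simp only [restrictTo, Pi.smul_apply]
        split_ifs <;> simp [*]) }
  map_convolution f g h H := by
    rw [isConvolution_iff hY] at H
    rw [isConvolution_iff hZ]
    simp only [LinearMap.coe_mk, AddHom.coe_mk, ext_mkCc, H]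
    exact restrictTo_conv hZ (isCc_ext g)
  map_adjoint f g H := by
    rw [isAdjoint_iff hY] at H
    rw [isAdjoint_iff hZ]
    simp only [LinearMap.coe_mk, AddHom.coe_mk, ext_mkCc, H]
    exact restrictTo_adj hY hZ (isCc_ext f)
  iNorm_le f := iNorm_mono hZ hZY fun γ hγ => by
    simp only [LinearMap.coe_mk, AddHom.coe_mk, ext_mkCc, restrictTo, if_pos hγ, le_refl]

@[simp] theorem ext_restrictCc (hY : IsUnitSpace Y) (hZ : IsUnitSpace Z) (hZcl : IsClosed Z)
    (hZY : Z ⊆ Y) (f : Cc Y) :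
    ext ((restrictCc hY hZ hZcl hZY).toLin f) = restrictTo Z (ext f) :=
  ext_mkCc ((isCc_ext f).restrictTo hZcl hZY)

/-- Extension of functions by zero from a relatively open invariant set of units. -/
def extendCc (hY : IsUnitSpace Y) (hZ : IsUnitSpace Z) (hZcl : IsClosed Z) :
    CcHom (Y \ Z) Y where
  toLin :=
    { toFun := fun f => mkCc (ext f) ((isCc_ext f).extend hZcl)
      map_add' := fun f g => ext_injective (by simp)
      map_smul' := fun c f => ext_injective (by simp) }
  map_convolution f g h H := by
    rw [isConvolution_iff (hY.diff hZ)] at H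
    rw [isConvolution_iff hY]
    simpa using H
  map_adjoint f g H := by
    rw [isAdjoint_iff (hY.diff hZ)] at H
    rw [isAdjoint_iff hY]
    simpa using H
  iNorm_le f := by
    have hW := hY.diff hZ
    rw [← ENNReal.ofReal_toReal (iNorm_lt_top hW.separated f).ne]
    have key : ∀ F : Space d × Pattern d → ℂ, IsCc (Y \ Z) F → ∀ S ∉ Y \ Z, sumAbs F S = 0 := by
      intro F hF S hS
      refine finsum_eq_zero_of_forall_eq_zero fun y => ?_
      rw [hF.eq_zero fun h => hS h.1, norm_zero]
    refine iNorm_le hY (fun S _ => ?_) fun S _ => ?_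
    all_goals
      simp only [LinearMap.coe_mk, AddHom.coe_mk, ext_mkCc]
      by_cases hS : S ∈ Y \ Z
    · exact sumAbs_le hW f hS
    · rw [key _ (isCc_ext f) S hS]
      positivity
    · exact sumAbs_adj_le hW f hS
    · rw [key _ ((isCc_ext f).adj hW) S hS]
      positivity

@[simp] theorem ext_extendCc (hY : IsUnitSpace Y) (hZ : IsUnitSpace Z) (hZcl : IsClosed Z)
    (f : Cc (Y \ Z)) : ext ((extendCc hY hZ hZcl).toLin f) = ext f :=
  ext_mkCc ((isCc_ext f).extend hZcl)

/-- Tietze extends `g` from the closed set of arrows over `Z`. The bump `b`, which is one on the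
first coordinates of the support of `g`, restores compact support. -/
theorem exists_extension (hY : IsClosed Y) (hZcl : IsClosed Z) (hZY : Z ⊆ Y) (g : Cc Z) :
    ∃ f : Cc Y, restrictTo Z (ext f) = ext g := by
  classical
  obtain ⟨φ, hφ⟩ := ContinuousMap.exists_extension' (IsClosed.arrows hZcl).isClosedEmbedding_subtypeVal
    (g : C(arrows Z, ℂ))
  have hφ' : ∀ γ : arrows Z, φ γ = g γ := fun γ => congrFun hφ γ
  obtain ⟨K, hK, h0⟩ := (isCc_ext g).exists_compact
  obtain ⟨R, hR⟩ := hK.isBounded.exists_norm_le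
  set b : Space d → ℝ := fun x => max 0 (min 1 (R + 1 - ‖x‖)) with hb
  have hb1 : ∀ x ∈ K, b x = 1 := fun x hx => by
    have : 1 ≤ R + 1 - ‖x‖ := by linarith [hR x hx]
    simp [hb, this]
  have hb0 : ∀ x ∉ Metric.closedBall (0 : Space d) (R + 1), b x = 0 := fun x hx => by
    have : R + 1 < ‖x‖ := by simpa using hx
    simp only [hb]
    rw [max_eq_left]
    exact (min_le_right _ _).trans (by linarith)
  have hbc : Continuous b := by fun_prop
  have hcont : Continuous fun γ : Space d × Pattern d => (b γ.1 : ℂ) * φ γ :=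
    (Complex.continuous_ofReal.comp (hbc.comp continuous_fst)).mul φ.continuous
  have hcc : IsCc Y ((arrows Y).indicator fun γ => (b γ.1 : ℂ) * φ γ) := by
    refine isCc_of_isClosed hY (hcont.continuousOn.congr fun γ hγ => indicator_of_mem hγ _)
      (isCompact_closedBall (0 : Space d) (R + 1)) (fun γ hγ => indicator_of_notMem hγ _)
      fun γ hγ => ?_
    rw [indicator_apply_eq_zero]
    intro _
    rw [hb0 _ hγ, Complex.ofReal_zero, zero_mul]
  refine ⟨mkCc _ hcc, ?_⟩
  rw [ext_mkCc]
  funext γ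
  by_cases hγ : γ ∈ arrows Z
  · rw [restrictTo, if_pos hγ.1, indicator_of_mem (show γ ∈ arrows Y from ⟨hZY hγ.1, hγ.2⟩),
      hφ' ⟨γ, hγ⟩, ext_apply g ⟨γ, hγ⟩]
    by_cases hK' : γ.1 ∈ K
    · rw [hb1 _ hK', Complex.ofReal_one, one_mul]
    · rw [← ext_apply g ⟨γ, hγ⟩, h0 _ hK', mul_zero]
  · rw [ext_of_notMem _ hγ, restrictTo]
    split_ifs with h
    · exact indicator_of_notMem (fun h' => hγ ⟨h, h'.2⟩) _
    · rfl

/-- This makes the I-norm semicontinuous towards `Z`: fibre sums over patterns near `Z` are not much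
larger than those over `Z`. -/
theorem continuousOn_sumAbs (hY : IsUnitSpace Y) {F : Space d × Pattern d → ℂ} (hF : IsCc Y F) :
    ContinuousOn (sumAbs F) Y := by
  obtain ⟨K, hK, h0⟩ := hF.exists_compact
  refine continuousOn_finsum (X := Pattern d) (q := id) (F := fun y S => ‖F (y, S)‖)
    continuousOn_id (by simpa using hY.separated) hK (fun S hS y h => ?_) ?_
  · have h' : F (y, S) ≠ 0 := norm_ne_zero_iff.1 h
    refine ⟨(hF.mem h').2, ?_⟩
    by_contra hcon
    exact h' (h0 _ hcon)
  · exact hF.1.norm.mono fun p hp => ⟨hp.1, hp.2⟩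

theorem sumAbs_mono (hY : IsUnitSpace Y) {F G : Space d × Pattern d → ℂ} (hG : IsCc Y G)
    {S : Pattern d} (h : ∀ y, ‖F (y, S)‖ ≤ ‖G (y, S)‖) :
    sumAbs F S ≤ sumAbs G S := by
  have hfin := hG.finite_support hY S
  rw [sumAbs, sumAbs, finsum_eq_sum_of_support_subset (s := hfin.toFinset),
    finsum_eq_sum_of_support_subset (s := hfin.toFinset)]
  · exact Finset.sum_le_sum fun y _ => h y
  · exact fun y hy => hfin.mem_toFinset.2 (norm_ne_zero_iff.1 hy)
  · refine fun y hy => hfin.mem_toFinset.2 (norm_pos_iff.1 ((norm_pos_iff.2 ?_).trans_le (h y)))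
    exact norm_ne_zero_iff.1 hy

/-- A function on the arrows can be cut off near `Z` such that its I-norm becomes almost that of
its restriction. -/
theorem exists_cutoff_iNorm_le (hY : IsUnitSpace Y) (hcl : IsClosed Y) (hZ : IsUnitSpace Z)
    (hZcl : IsClosed Z) (hZY : Z ⊆ Y) (f : Cc Y) {ε : ℝ} (hε : 0 < ε) :
    ∃ χ : C(Pattern d, ℝ), Disjoint (tsupport χ) Z ∧
      ∀ g : Cc Y, ext g = lmul (1 - χ) (rmul (ext f) (1 - χ)) →
        iNorm g ≤ ENNReal.ofReal
          ((iNorm ((restrictCc hY hZ hZcl hZY).toLin f)).toReal + ε) := by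
  set M := (iNorm ((restrictCc hY hZ hZcl hZY).toLin f)).toReal
  have hF := isCc_ext f
  have hF' := hF.adj hY
  have h1 : ∀ S ∈ Z, sumAbs (ext f) S ≤ M := by
    intro S hS
    refine (le_of_eq ?_).trans (sumAbs_le hZ _ hS)
    simp [sumAbs, restrictTo, hS]
  have h2 : ∀ S ∈ Z, sumAbs (adj (ext f)) S ≤ M := by
    intro S hS
    refine (le_of_eq ?_).trans (sumAbs_adj_le hZ _ hS)
    rw [ext_restrictCc, ← restrictTo_adj hY hZ hF]
    simp [sumAbs, restrictTo, hS]
  -- The units where a fibre sum exceeds the norm over `Z` by `ε` form a closed set disjoint from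
  -- `Z`; the cutoff is chosen to be one there. It is applied on sources and ranges, so that source
  -- and range fibres are handled alike through the adjoint.
  have hK : ∀ F : Space d × Pattern d → ℂ, IsCc Y F →
      IsClosed (Y ∩ sumAbs F ⁻¹' Ici (M + ε)) := fun F hF =>
    (continuousOn_sumAbs hY hF).preimage_isClosed_of_isClosed hcl isClosed_Ici
  have hK1 := hK _ hF
  have hK2 := hK _ hF'
  obtain ⟨χ, hχ1, h01, hd⟩ := exists_cutoff (hK1.union hK2).isCompact hZcl (by
    rw [Set.disjoint_left]
    rintro S (⟨_, hS⟩ | ⟨_, hS⟩) hSZ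
    · exact absurd (h1 S hSZ) (not_le.2 (by rw [mem_preimage, mem_Ici] at hS; linarith))
    · exact absurd (h2 S hSZ) (not_le.2 (by rw [mem_preimage, mem_Ici] at hS; linarith)))
  refine ⟨χ, hd, fun g hg => ?_⟩
  have hM : 0 ≤ M := ENNReal.toReal_nonneg
  have habs : ∀ S, ‖((1 - χ : C(Pattern d, ℝ)) S : ℂ)‖ ≤ 1 := fun S => by
    rw [Complex.norm_real, Real.norm_eq_abs, abs_le, ContinuousMap.sub_apply,
      ContinuousMap.one_apply]
    constructor <;> linarith [(h01 S).1, (h01 S).2]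
  have key : ∀ F : Space d × Pattern d → ℂ, IsCc Y F → ∀ S ∈ Y,
      (M + ε ≤ sumAbs F S → χ S = 1) →
      sumAbs (lmul (1 - χ) (rmul F (1 - χ))) S ≤ M + ε := by
    intro F hF S hS hSK
    by_cases h : M + ε ≤ sumAbs F S
    · rw [sumAbs, finsum_eq_zero_of_forall_eq_zero fun y => by simp [lmul, rmul, hSK h]]
      linarith
    · refine (sumAbs_mono hY hF fun y => ?_).trans (not_le.1 h).le
      rw [lmul, rmul, norm_mul, norm_mul]
      refine (mul_le_of_le_one_left (by positivity) (habs _)).trans ?_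
      exact mul_le_of_le_one_right (norm_nonneg _) (habs _)
  refine iNorm_le hY (fun S hS => ?_) fun S hS => ?_
  · rw [hg]
    exact key _ hF S hS fun h => hχ1 S (Or.inl ⟨hS, h⟩)
  · rw [hg, adj_lmul, adj_rmul, ← lmul_rmul]
    exact key _ hF' S hS fun h => hχ1 S (Or.inr ⟨hS, h⟩)

/-- A representation that vanishes on `C_c` of the complement of `Z` is bounded by the I-norm of the
restriction to `Z`. -/
theorem norm_rep_le_iNorm_restrict (hY : IsUnitSpace Y) (hcl : IsClosed Y) (hZ : IsUnitSpace Z)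
    (hZcl : IsClosed Z) (hZY : Z ⊆ Y) (ρ : Rep Y)
    (hρ : ∀ f : Cc Y, IsCc (Y \ Z) (ext f) → ρ.toFun f = 0) (f : Cc Y) :
    ‖ρ.toFun f‖ ≤ (iNorm ((restrictCc hY hZ hZcl hZY).toLin f)).toReal := by
  refine le_of_forall_pos_le_add fun ε hε => ?_
  obtain ⟨χ, hd, h⟩ := exists_cutoff_iNorm_le hY hcl hZ hZcl hZY f hε
  set F := ext f
  have hF : IsCc Y F := isCc_ext f
  set g : Cc Y := mkCc (lmul (1 - χ) (rmul F (1 - χ))) ((hF.rmul _).lmul _)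
  have hg : ext g = lmul (1 - χ) (rmul F (1 - χ)) := ext_mkCc _
  -- Expansion of `f - (1 - χ) f (1 - χ)`: each term carries a factor `χ` and is supported off `Z`,
  -- so `ρ` does not distinguish `f` from `g`.
  have hdiff : ext (f - g) = (rmul F χ + lmul χ F) - lmul χ (rmul F χ) := by
    rw [ext_sub, hg]
    funext γ
    simp [lmul, rmul, F]
    ring
  have h0 : ρ.toFun (f - g) = 0 := by
    refine hρ _ ?_
    rw [hdiff]
    exact ((hF.rmul_diff hd).add (hF.lmul_diff hY hZ hd)).sub ((hF.rmul_diff hd).lmul χ)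
  rw [map_sub, sub_eq_zero] at h0
  rw [h0]
  refine (ρ.norm_le hY g).trans (ENNReal.toReal_le_of_le_ofReal ?_ (h g hg))
  have : 0 ≤ (iNorm ((restrictCc hY hZ hZcl hZY).toLin f)).toReal := ENNReal.toReal_nonneg
  linarith

/-- A representation that vanishes on `C_c` of the complement of `Z` factors through the
restriction to `Z`. -/
theorem exists_rep_restrict (hY : IsUnitSpace Y) (hcl : IsClosed Y) (hZ : IsUnitSpace Z)
    (hZcl : IsClosed Z) (hZY : Z ⊆ Y) (ρ : Rep Y)
    (hρ : ∀ f : Cc Y, IsCc (Y \ Z) (ext f) → ρ.toFun f = 0) :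
    ∃ σ : Rep Z, ∀ f : Cc Y,
      ‖σ.toFun ((restrictCc hY hZ hZcl hZY).toLin f)‖ = ‖ρ.toFun f‖ := by
  have hex : ∀ g : Cc Z, ∃ f : Cc Y, (restrictCc hY hZ hZcl hZY).toLin f = g := fun g => by
    obtain ⟨f, hf⟩ := exists_extension hcl hZcl hZY g
    exact ⟨f, ext_injective (by rw [ext_restrictCc, hf])⟩
  choose s hs using hex
  -- By the I-norm bound `ρ` depends on the restriction only, so composing it with arbitrary
  -- extensions `s` gives a representation over `Z`.
  have hwd : ∀ f f' : Cc Y, (restrictCc hY hZ hZcl hZY).toLin f =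
      (restrictCc hY hZ hZcl hZY).toLin f' → ρ.toFun f = ρ.toFun f' := by
    intro f f' h
    rw [← sub_eq_zero, ← map_sub]
    rw [← sub_eq_zero, ← map_sub] at h
    have h1 := norm_rep_le_iNorm_restrict hY hcl hZ hZcl hZY ρ hρ (f - f')
    rw [h] at h1
    have h2 : (iNorm (0 : Cc Z)).toReal = 0 := by simp [iNorm]
    rw [h2] at h1
    exact norm_le_zero_iff.1 h1
  refine ⟨{ H := ρ.H
            toFun :=
              { toFun := fun g => ρ.toFun (s g)
                map_add' := fun g h => ?_
                map_smul' := fun c g => ?_ }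
            map_convolution := fun f g h H => ?_
            map_adjoint := fun f g H => ?_
            bounded := fun g => ?_ }, fun f => congrArg _ (hwd _ _ (hs _))⟩
  · rw [← map_add]
    exact hwd _ _ (by simp only [map_add, hs])
  · rw [← map_smul]
    exact hwd _ _ (by simp only [map_smul, hs, RingHom.id_apply])
  · have : h = hZ.mul f g := ext_injective (by rw [(isConvolution_iff hZ).1 H, hZ.ext_mul])
    subst this
    change ρ.toFun _ = ρ.toFun _ * ρ.toFun _
    rw [← hY.rep_mul]
    refine hwd _ _ (ext_injective ?_)
    rw [hs, hZ.ext_mul, ext_restrictCc, hY.ext_mul, restrictTo_conv hZ (isCc_ext _),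
      ← ext_restrictCc hY hZ hZcl hZY, ← ext_restrictCc hY hZ hZcl hZY, hs, hs]
  · have : g = hZ.inv f := ext_injective (by rw [(isAdjoint_iff hZ).1 H, hZ.ext_inv])
    subst this
    change ρ.toFun _ = star (ρ.toFun _)
    rw [← hY.rep_inv]
    refine hwd _ _ (ext_injective ?_)
    rw [hs, hZ.ext_inv, ext_restrictCc, hY.ext_inv, restrictTo_adj hY hZ (isCc_ext _),
      ← ext_restrictCc hY hZ hZcl hZY, hs]
  · rw [← ofReal_norm, ENNReal.ofReal_le_iff_le_toReal (iNorm_lt_top hZ.separated g).ne]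
    have := norm_rep_le_iNorm_restrict hY hcl hZ hZcl hZY ρ hρ (s g)
    rwa [hs] at this

/-- The norm of the restriction to `Z` is the quotient norm: a function can be changed on the
complement of `Z` such that its norm becomes almost that of the restriction. -/
theorem exists_norm_cut_le (hY : IsUnitSpace Y) (hcl : IsClosed Y) (hZ : IsUnitSpace Z)
    (hZcl : IsClosed Z) (hZY : Z ⊆ Y) (f : Cc Y) {ε : ℝ} (hε : 0 < ε) :
    ∃ u : Cc Y, IsCc (Y \ Z) (ext u) ∧
      ‖ι (f - u)‖ ≤ ‖ι ((restrictCc hY hZ hZcl hZY).toLin f)‖ + ε := by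
  set c := ‖ι ((restrictCc hY hZ hZcl hZY).toLin f)‖ + ε with hc
  have hcpos : 0 < c := by positivity
  -- The argument goes through GNS and a limit of functionals instead of representing the quotient
  -- algebra; the Hilbert space is then a completion of `C_c(𝒢_Y)` and lives in `Type`, as `Rep`
  -- demands.
  by_contra! hcon
  let I := {K : TopologicalSpace.Compacts (Pattern d) // Disjoint (K : Set (Pattern d)) Z}
  have : Nonempty I := ⟨⟨⊥, by simp⟩⟩
  have : IsDirectedOrder I := ⟨fun K L => ⟨⟨K.1 ⊔ L.1, by
    rw [TopologicalSpace.Compacts.coe_sup]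
    exact Set.disjoint_union_left.2 ⟨K.2, L.2⟩⟩, le_sup_left (a := K.1), le_sup_right (a := K.1)⟩⟩
  have hχ : ∀ K : I, ∃ χ : C(Pattern d, ℝ), (∀ S ∈ (K.1 : Set (Pattern d)), χ S = 1) ∧
      (∀ S, 0 ≤ χ S ∧ χ S ≤ 1) ∧ Disjoint (tsupport χ) Z := fun K =>
    exists_cutoff K.1.isCompact hZcl K.2
  choose χ hχ1 hχ01 hχd using hχ
  -- With the empty set removed, compression to `Y` itself by `1 - χ K` is an instance of the
  -- construction above.
  have hYe : Y = Y \ ∅ := sdiff_empty.symm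
  have hde : ∀ ψ : C(Pattern d, ℝ), Disjoint (tsupport ψ) (∅ : Set (Pattern d)) := fun _ =>
    disjoint_empty _
  -- Removing the part `f χ_K` is one of the changes excluded by `hcon`, so what remains still has
  -- norm greater than `c` in some representation.
  have hvec : ∀ K : I, ∃ (π : Rep Y) (ξ : π.H), ‖ξ‖ ≤ 1 ∧
      c < ‖π.toFun (cutRight hYe (hde (1 - χ K)) f) ξ‖ := by
    intro K
    set u : Cc Y := mkCc (rmul (ext f) (χ K)) ((isCc_ext f).rmul _)
    have h1 := hcon u (by rw [ext_mkCc]; exact (isCc_ext f).rmul_diff (hχd K))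
    have h2 : f - u = cutRight hYe (hde (1 - χ K)) f := ext_injective (by
      rw [ext_cutRight, ext_sub, ext_mkCc]
      funext γ
      simp [rmul]
      ring)
    rw [h2] at h1
    by_contra! h3
    refine absurd (norm_ι_le hY (cutRight hYe (hde (1 - χ K)) f) hcpos.le fun π => ?_) (not_le.2 h1)
    refine ContinuousLinearMap.opNorm_le_of_unit_norm hcpos.le fun ξ hξ => ?_
    exact h3 π ξ hξ.le
  choose π ξ hξ hπ using hvec
  have h01' : ∀ K S, 0 ≤ (1 - χ K) S ∧ (1 - χ K) S ≤ 1 := fun K S => by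
    have := hχ01 K S
    simp only [ContinuousMap.sub_apply, ContinuousMap.one_apply]
    constructor <;> linarith
  let ψ : I → PositiveFunctional hY := fun K =>
    compressedFunctional hYe (hde (1 - χ K)) hY hY isClosed_empty (π K) (ξ K)
  have hψle : ∀ K g, ‖(ψ K).toLin g‖ ≤ (iNorm g).toReal := fun K g => by
    refine (norm_compressedFunctional_le hY hY isClosed_empty (h01' K) (π K) (ξ K) g).trans ?_
    exact mul_le_of_le_one_right ENNReal.toReal_nonneg (pow_le_one₀ (norm_nonneg _) (hξ K))
  -- Finer than `atTop`, so each compact set disjoint from `Z` is eventually contained in `K`.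
  set 𝒰 : Ultrafilter I := Ultrafilter.of atTop
  obtain ⟨φ, hφ⟩ := PositiveFunctional.exists_limit 𝒰 ψ (fun g => (iNorm g).toReal) hψle
  have hre : ∀ g, Tendsto (fun K => ((ψ K).toLin g).re) 𝒰 (𝓝 (φ.toLin g).re) := fun g =>
    (Complex.continuous_re.tendsto _).comp (hφ g)
  -- As soon as `K` contains the sources of `u`, the factor `1 - χ K` annihilates `u`.
  have hkill : ∀ u : Cc Y, IsCc (Y \ Z) (ext u) →
      (φ.toLin (hY.mul (hY.inv u) u)).re = 0 := by
    intro u hu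
    obtain ⟨K₀, hK₀, hK₀Z, hcut⟩ := hu.exists_compact_source
    refine tendsto_nhds_unique (hre _) (tendsto_const_nhds.congr' ?_)
    have hev : ∀ᶠ K in (atTop : Filter I), K₀ ⊆ (K.1 : Set (Pattern d)) :=
      Filter.eventually_ge_atTop (⟨⟨K₀, hK₀⟩, Set.disjoint_left.2 fun S hS => (hK₀Z hS).2⟩ : I)
    filter_upwards [Ultrafilter.of_le atTop hev] with K hK
    have h1 : cutRight hYe (hde (1 - χ K)) u = 0 := ext_injective (by
      have h2 := hcut (χ K) fun S hS => hχ1 K S (hK hS)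
      rw [ext_cutRight, ext_zero]
      funext γ
      have h3 := congrFun h2 γ
      simp only [rmul] at h3
      simp [rmul, mul_sub, h3])
    rw [compressedFunctional_inv_mul, h1]
    simp
  have hρ : ∀ u : Cc Y, IsCc (Y \ Z) (ext u) → φ.gns.toFun u = 0 := by
    intro u hu
    refine φ.gns_eq_zero fun g => hkill _ ?_
    rw [hY.ext_mul]
    exact IsCc.conv_left hY (hY.diff hZ) sdiff_subset hu (isCc_ext g)
  obtain ⟨σ, hσ⟩ := exists_rep_restrict hY hcl hZ hZcl hZY φ.gns hρ
  have h1 : ‖φ.gns.toFun f‖ ≤ c - ε := by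
    rw [← hσ, hc, add_sub_cancel_right]
    exact norm_toFun_le_norm_ι hZ _ σ
  -- The vectors were chosen so that every functional in the net has value at least `c ^ 2` at `f*
  -- f`. With value at most one at the unit, this forces GNS norm at least `c`, against the bound `c
  -- - ε` through `Z`.
  have h2 : c ^ 2 ≤ (φ.toLin (hY.mul (hY.inv f) f)).re := by
    refine ge_of_tendsto' (hre _) fun K => ?_
    rw [compressedFunctional_inv_mul]
    exact pow_le_pow_left₀ hcpos.le (hπ K).le 2
  have h3 : (φ.toLin (hY.one hcl)).re ≤ 1 := by
    refine le_of_tendsto' (hre _) fun K => (Complex.re_le_norm _).trans ((hψle K _).trans ?_)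
    exact iNorm_one_le hY hcl
  have h4 := φ.le_norm_gns_mul hcl f
  have h5 : c ^ 2 ≤ ‖φ.gns.toFun f‖ ^ 2 :=
    h2.trans (h4.trans (mul_le_of_le_one_right (by positivity) h3))
  have h6 : c ≤ ‖φ.gns.toFun f‖ := le_of_sq_le_sq h5 (norm_nonneg _)
  linarith

end Exact

end Crystal

end

/-! ### Exact sequences, symmetry and detection of values on units -/

noncomputable section

namespace Crystal

open Filter

variable {d : ℕ}

/-! ### Exactness -/

section Exact

variable {Y Z : Set (Pattern d)}

theorem isRestriction_restrictCc (hY : IsUnitSpace Y) (hZ : IsUnitSpace Z) (hZcl : IsClosed Z)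
    (hZY : Z ⊆ Y) : IsRestriction ((restrictCc hY hZ hZcl hZY).map hY hZ) := by
  intro f g h
  rw [CcHom.map_ι]
  congr 1
  refine ext_injective (funext fun γ => ?_)
  rw [ext_restrictCc]
  by_cases hγ : γ ∈ arrows Z
  · rw [restrictTo, if_pos hγ.1, h γ hγ]
  · rw [ext_of_notMem g hγ, ((isCc_ext f).restrictTo hZcl hZY).eq_zero hγ]

theorem isExtensionByZero_extendCc (hY : IsUnitSpace Y) (hZ : IsUnitSpace Z) (hZcl : IsClosed Z) :
    IsExtensionByZero ((extendCc hY hZ hZcl).map (hY.diff hZ) hY) := by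
  intro f g h
  rw [CcHom.map_ι]
  congr 1
  exact ext_injective (by rw [ext_extendCc, h])

/-- Two restriction homomorphisms agree. -/
theorem IsRestriction.unique (hY : IsUnitSpace Y) (hZ : IsUnitSpace Z) (hZcl : IsClosed Z)
    (hZY : Z ⊆ Y) {p : CStar Y →⋆ₙₐ[ℂ] CStar Z} (hp : IsRestriction p) :
    p = (restrictCc hY hZ hZcl hZY).map hY hZ :=
  CStar.hom_ext hY fun f => by
    rw [CcHom.map_ι]
    refine hp _ _ fun γ hγ => ?_
    rw [ext_restrictCc, restrictTo, if_pos hγ.1]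

/-- Elements coming from `C_c(𝒢_Z)` are dense and lift with norm at most twice their own;
completeness then lifts their limits by successive approximation. -/
theorem surjective_restrict (hY : IsUnitSpace Y) (hcl : IsClosed Y) (hZ : IsUnitSpace Z)
    (hZcl : IsClosed Z) (hZY : Z ⊆ Y) :
    Function.Surjective ((restrictCc hY hZ hZcl hZY).map hY hZ) := by
  set p := (restrictCc hY hZ hZcl hZY).map hY hZ
  let P : NormedAddGroupHom (CStar Y) (CStar Z) :=
    { toFun := p
      map_add' := map_add p
      bound' := ⟨1, fun a => by
        rw [one_mul]
        exact NonUnitalStarAlgHom.norm_apply_le p a⟩ }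
  let K : AddSubgroup (CStar Z) :=
    { carrier := range ι
      add_mem' := by
        rintro _ _ ⟨f, rfl⟩ ⟨g, rfl⟩
        exact ⟨f + g, ι_add hZ f g⟩
      zero_mem' := ⟨0, ι_zero hZ⟩
      neg_mem' := by
        rintro _ ⟨f, rfl⟩
        exact ⟨0 - f, by rw [ι_sub hZ, ι_zero hZ, zero_sub]⟩ }
  have hK : P.SurjectiveOnWith K 2 := by
    rintro _ ⟨g, rfl⟩
    by_cases h0 : ι g = 0
    · exact ⟨0, by rw [h0]; exact map_zero p, by simp [h0]⟩
    obtain ⟨f, hf⟩ := exists_extension hcl hZcl hZY g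
    have hfg : (restrictCc hY hZ hZcl hZY).toLin f = g := ext_injective (by rw [ext_restrictCc, hf])
    -- The error allowed is `‖ι g‖` itself, whence the constant `2`; nonvanishing is needed because
    -- errors must be positive.
    obtain ⟨u, hu, hle⟩ := exists_norm_cut_le hY hcl hZ hZcl hZY f (norm_pos_iff.2 h0)
    refine ⟨ι (f - u), ?_, ?_⟩
    · change p (ι (f - u)) = ι g
      rw [CcHom.map_ι, map_sub, hfg]
      congr 1
      rw [sub_eq_self]
      refine ext_injective (funext fun γ => ?_)
      rw [ext_restrictCc, ext_zero, restrictTo]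
      split_ifs with h
      · exact hu.eq_zero fun h' => h'.1.2 h
      · rfl
    · rw [hfg] at hle
      linarith
  intro b
  have hb : b ∈ K.topologicalClosure := by
    have := denseRange_ι hZ b
    exact this
  obtain ⟨a, ha, _⟩ := controlled_closure_of_complete two_pos one_pos hK b hb
  exact ⟨a, ha⟩

theorem restrict_ι_eq_zero (hY : IsUnitSpace Y) (hZ : IsUnitSpace Z) (hZcl : IsClosed Z)
    (hZY : Z ⊆ Y) {f : Cc Y} (hf : ∀ γ ∈ arrows Z, ext f γ = 0) :
    (restrictCc hY hZ hZcl hZY).map hY hZ (ι f) = 0 := by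
  rw [isRestriction_restrictCc hY hZ hZcl hZY f 0 fun γ hγ => by rw [hf γ hγ, ext_zero]; rfl,
    ι_zero hZ]

theorem isClosed_ker (p : CStar Y →⋆ₙₐ[ℂ] CStar Z) : IsClosed {a | p a = 0} := by
  have h : Continuous p := AddMonoidHomClass.continuous_of_bound p 1 fun a => by
    rw [one_mul]
    exact NonUnitalStarAlgHom.norm_apply_le p a
  exact isClosed_eq h continuous_const

/-- If `a` is in the kernel and `ι f` is close to it, the restriction of `f` has small norm;
subtracting a suitable `u` supported off `Z` makes `f - u` small as well, so `u` approximates `a`.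
-/
theorem ker_restrict (hY : IsUnitSpace Y) (hcl : IsClosed Y) (hZ : IsUnitSpace Z)
    (hZcl : IsClosed Z) (hZY : Z ⊆ Y) :
    {a | (restrictCc hY hZ hZcl hZY).map hY hZ a = 0} =
      closure (ι '' {f : Cc Y | IsCc (Y \ Z) (ext f)}) := by
  set p := (restrictCc hY hZ hZcl hZY).map hY hZ with hp
  refine subset_antisymm (fun a ha => ?_) (closure_minimal ?_ (isClosed_ker p))
  · refine Metric.mem_closure_iff.2 fun ε hε => ?_
    obtain ⟨_, ⟨f, rfl⟩, hf⟩ := Metric.mem_closure_iff.1 (denseRange_ι hY a) (ε / 4) (by positivity)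
    obtain ⟨u, hu, hle⟩ := exists_norm_cut_le hY hcl hZ hZcl hZY f (ε := ε / 4) (by positivity)
    refine ⟨ι u, ⟨u, hu, rfl⟩, ?_⟩
    have h1 : ‖ι ((restrictCc hY hZ hZcl hZY).toLin f)‖ ≤ ‖a - ι f‖ := by
      rw [← CcHom.map_ι _ hY hZ, ← hp, ← norm_neg, ← zero_sub, ← (show p a = 0 from ha), ← map_sub]
      exact NonUnitalStarAlgHom.norm_apply_le p _
    rw [dist_eq_norm] at hf ⊢
    rw [ι_sub hY] at hle
    have h2 : a - ι u = (a - ι f) + (ι f - ι u) := by abel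
    rw [h2]
    linarith [norm_add_le (a - ι f) (ι f - ι u)]
  · rintro _ ⟨f, hf, rfl⟩
    exact restrict_ι_eq_zero hY hZ hZcl hZY fun γ hγ =>
      IsCc.eq_zero hf fun h => h.1.2 hγ.1

theorem norm_extend (hY : IsUnitSpace Y) (hcl : IsClosed Y) (hZ : IsUnitSpace Z)
    (hZcl : IsClosed Z) (a : CStar (Y \ Z)) :
    ‖(extendCc hY hZ hZcl).map (hY.diff hZ) hY a‖ = ‖a‖ := by
  set j := (extendCc hY hZ hZcl).map (hY.diff hZ) hY
  have hj : Continuous j := AddMonoidHomClass.continuous_of_bound j 1 fun a => by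
    rw [one_mul]
    exact NonUnitalStarAlgHom.norm_apply_le j a
  refine (denseRange_ι (hY.diff hZ)).induction_on (p := fun a => ‖j a‖ = ‖a‖) a
    (isClosed_eq hj.norm continuous_norm) fun f => ?_
  refine le_antisymm (NonUnitalStarAlgHom.norm_apply_le j _) ?_
  rw [CcHom.map_ι]
  exact norm_ι_le_of_ext_eq hY hcl hZ hZcl f _ (ext_extendCc hY hZ hZcl f)

theorem isometry_extend (hY : IsUnitSpace Y) (hcl : IsClosed Y) (hZ : IsUnitSpace Z)
    (hZcl : IsClosed Z) : Isometry ((extendCc hY hZ hZcl).map (hY.diff hZ) hY) :=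
  AddMonoidHomClass.isometry_of_norm _ (norm_extend hY hcl hZ hZcl)

/-- An isometry has closed range, and this range contains the functions supported off `Z`, which are
dense in the kernel of restriction. -/
theorem range_extend (hY : IsUnitSpace Y) (hcl : IsClosed Y) (hZ : IsUnitSpace Z)
    (hZcl : IsClosed Z) (hZY : Z ⊆ Y) :
    range ((extendCc hY hZ hZcl).map (hY.diff hZ) hY) =
      {a | (restrictCc hY hZ hZcl hZY).map hY hZ a = 0} := by
  have hiso := isometry_extend hY hcl hZ hZcl
  refine subset_antisymm ?_ ?_
  · rintro _ ⟨a, rfl⟩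
    refine (denseRange_ι (hY.diff hZ)).induction_on a
      ((isClosed_ker _).preimage hiso.continuous) fun f => ?_
    rw [CcHom.map_ι]
    refine restrict_ι_eq_zero hY hZ hZcl hZY fun γ hγ => ?_
    rw [ext_extendCc]
    exact ext_of_notMem f fun h => h.1.2 hγ.1
  · rw [ker_restrict hY hcl hZ hZcl hZY]
    refine closure_minimal ?_ hiso.isClosedEmbedding.isClosed_range
    rintro _ ⟨f, hf, rfl⟩
    refine ⟨ι (mkCc (ext f) hf), ?_⟩
    rw [CcHom.map_ι]
    congr 1
    exact ext_injective (by rw [ext_extendCc, ext_mkCc])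

end Exact

/-! ### The action of the point group -/

section PointAction

variable {Y : Set (Pattern d)}

/-- The action of a linear isometry on arrows. -/
def act (σ : Space d ≃ₗᵢ[ℝ] Space d) (γ : Space d × Pattern d) : Space d × Pattern d :=
  (σ γ.1, γ.2.map σ)

theorem continuous_act (σ : Space d ≃ₗᵢ[ℝ] Space d) : Continuous (act σ) :=
  (σ.continuous.comp continuous_fst).prodMk ((Pattern.continuous_map σ).comp continuous_snd)

theorem act_mul (σ τ : Space d ≃ₗᵢ[ℝ] Space d) (γ : Space d × Pattern d) :
    act (σ * τ) γ = act σ (act τ γ) := rfl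

theorem act_act_inv (σ : Space d ≃ₗᵢ[ℝ] Space d) (γ : Space d × Pattern d) :
    act σ (act σ⁻¹ γ) = γ := by
  rw [← act_mul, mul_inv_cancel]
  rfl

theorem act_mem {σ : Space d ≃ₗᵢ[ℝ] Space d} (hσ : ∀ S ∈ Y, S.map σ ∈ Y)
    {γ : Space d × Pattern d} (h : γ ∈ arrows Y) : act σ γ ∈ arrows Y :=
  ⟨hσ _ h.1, by simpa [act] using h.2⟩

theorem IsCc.comp_act {F : Space d × Pattern d → ℂ} (hF : IsCc Y F)
    {σ : Space d ≃ₗᵢ[ℝ] Space d} (hσ : ∀ S ∈ Y, S.map σ ∈ Y)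
    (hσ' : ∀ S ∈ Y, S.map σ⁻¹ ∈ Y) : IsCc Y (F ∘ act σ⁻¹) := by
  obtain ⟨hc, C, hCY, hC, h0⟩ := hF
  refine ⟨hc.comp (continuous_act _).continuousOn fun γ h => act_mem hσ' h, act σ '' C, ?_,
    hC.image (continuous_act σ), fun γ hγ => h0 _ fun h => hγ ⟨_, h, act_act_inv σ γ⟩⟩
  rintro _ ⟨γ, h, rfl⟩
  exact act_mem hσ (hCY h)

theorem conv_comp_act (σ : Space d ≃ₗᵢ[ℝ] Space d) (F G : Space d × Pattern d → ℂ) :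
    conv F G ∘ act σ = conv (F ∘ act σ) (G ∘ act σ) := by
  funext ⟨x, S⟩
  change ∑ᶠ y : Space d, F (σ x - y, (S.map σ).shift y) * G (y, S.map σ) = _
  rw [← finsum_comp_equiv σ.toEquiv]
  refine finsum_congr fun z => ?_
  simp [act, Pattern.map_shift]

theorem adj_comp_act (σ : Space d ≃ₗᵢ[ℝ] Space d) (F : Space d × Pattern d → ℂ) :
    adj F ∘ act σ = adj (F ∘ act σ) := by
  funext ⟨x, S⟩
  simp [adj, act, inverse, Pattern.map_shift]

theorem sumAbs_comp_act (σ : Space d ≃ₗᵢ[ℝ] Space d) (F : Space d × Pattern d → ℂ)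
    (S : Pattern d) : sumAbs (F ∘ act σ) S = sumAbs F (S.map σ) := by
  exact finsum_comp_equiv σ.toEquiv (f := fun y => ‖F (y, S.map σ)‖)

/-- The action of a linear isometry on the convolution algebra. -/
def actCc (hY : IsUnitSpace Y) (σ : Space d ≃ₗᵢ[ℝ] Space d) (hσ : ∀ S ∈ Y, S.map σ ∈ Y)
    (hσ' : ∀ S ∈ Y, S.map σ⁻¹ ∈ Y) : CcHom Y Y where
  toLin :=
    { toFun := fun f => mkCc (ext f ∘ act σ⁻¹) ((isCc_ext f).comp_act hσ hσ')
      map_add' := fun f g => ext_injective (by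
        simp only [ext_mkCc, ext_add]
        rfl)
      map_smul' := fun c f => ext_injective (by
        simp only [ext_mkCc, ext_smul]
        rfl) }
  map_convolution f g h H := by
    rw [isConvolution_iff hY] at *
    simp only [LinearMap.coe_mk, AddHom.coe_mk, ext_mkCc, H, conv_comp_act]
  map_adjoint f g H := by
    rw [isAdjoint_iff hY] at *
    simp only [LinearMap.coe_mk, AddHom.coe_mk, ext_mkCc, H, adj_comp_act]
  iNorm_le f := by
    rw [← ENNReal.ofReal_toReal (iNorm_lt_top hY.separated f).ne]
    refine iNorm_le hY (fun S hS => ?_) fun S hS => ?_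
    all_goals simp only [LinearMap.coe_mk, AddHom.coe_mk, ext_mkCc, ← adj_comp_act, sumAbs_comp_act]
    · exact sumAbs_le hY f (hσ' S hS)
    · exact sumAbs_adj_le hY f (hσ' S hS)

@[simp] theorem ext_actCc (hY : IsUnitSpace Y) (σ : Space d ≃ₗᵢ[ℝ] Space d)
    (hσ : ∀ S ∈ Y, S.map σ ∈ Y) (hσ' : ∀ S ∈ Y, S.map σ⁻¹ ∈ Y) (f : Cc Y) :
    ext ((actCc hY σ hσ hσ').toLin f) = ext f ∘ act σ⁻¹ :=
  ext_mkCc ((isCc_ext f).comp_act hσ hσ')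

variable {G : Subgroup (Space d ≃ₗᵢ[ℝ] Space d)}

/-- The action of an element of the point group on the C*-algebra. -/
def actHom (hY : IsUnitSpace Y) (hG : PointInvariant G Y) (σ : G) : CStar Y →⋆ₙₐ[ℂ] CStar Y :=
  (actCc hY σ (hG σ σ.2) (hG _ (σ⁻¹).2)).map hY hY

theorem actHom_mul (hY : IsUnitSpace Y) (hG : PointInvariant G Y) (σ τ : G) (a : CStar Y) :
    actHom hY hG (σ * τ) a = actHom hY hG σ (actHom hY hG τ a) := by
  have h : actHom hY hG (σ * τ) = (actHom hY hG σ).comp (actHom hY hG τ) := by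
    refine CStar.hom_ext hY fun f => ?_
    rw [NonUnitalStarAlgHom.comp_apply, actHom, actHom, actHom, CcHom.map_ι, CcHom.map_ι,
      CcHom.map_ι]
    congr 1
    refine ext_injective ?_
    simp only [ext_actCc, Function.comp_assoc]
    rw [Subgroup.coe_mul, mul_inv_rev]
    rfl
  rw [h]
  rfl

theorem actHom_one (hY : IsUnitSpace Y) (hG : PointInvariant G Y) (a : CStar Y) :
    actHom hY hG 1 a = a := by
  have h : actHom hY hG 1 = NonUnitalStarAlgHom.id ℂ (CStar Y) := by
    refine CStar.hom_ext hY fun f => ?_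
    rw [actHom, CcHom.map_ι, NonUnitalStarAlgHom.coe_id, id]
    congr 1
    refine ext_injective ?_
    rw [ext_actCc]
    rfl
  rw [h]
  rfl

/-- The action of the point group on the C*-algebra by automorphisms. -/
def actAut (hY : IsUnitSpace Y) (hG : PointInvariant G Y) : G →* (CStar Y ≃⋆ₐ[ℂ] CStar Y) where
  toFun σ :=
    { toFun := actHom hY hG σ
      invFun := actHom hY hG σ⁻¹
      left_inv := fun a => by rw [← actHom_mul, inv_mul_cancel, actHom_one]
      right_inv := fun a => by rw [← actHom_mul, mul_inv_cancel, actHom_one]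
      map_mul' := map_mul _
      map_add' := map_add _
      map_star' := map_star _
      map_smul' := map_smul _ }
  map_one' := StarAlgEquiv.ext fun a => actHom_one hY hG a
  map_mul' σ τ := StarAlgEquiv.ext fun a => actHom_mul hY hG σ τ a

theorem actAut_apply (hY : IsUnitSpace Y) (hG : PointInvariant G Y) (σ : G) (a : CStar Y) :
    actAut hY hG σ a = actHom hY hG σ a := rfl

theorem isInducedBy_actAut (hY : IsUnitSpace Y) (hG : PointInvariant G Y) (σ : G) :
    IsInducedBy (σ : Space d ≃ₗᵢ[ℝ] Space d) (actAut hY hG σ) := by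
  intro f g h
  rw [actAut_apply, actHom, CcHom.map_ι]
  congr 1
  refine ext_injective (funext fun γ => ?_)
  rw [ext_actCc, Function.comp_apply]
  by_cases hγ : γ ∈ arrows Y
  · have h1 := h _ (act_mem (hG _ (σ⁻¹).2) hγ)
    exact h1.symm.trans (congrArg (ext g) (act_act_inv _ γ))
  · rw [ext_of_notMem g hγ, ext_of_notMem f]
    intro h'
    refine hγ ?_
    rw [← act_act_inv (σ : Space d ≃ₗᵢ[ℝ] Space d) γ]
    exact act_mem (hG _ σ.2) h'

end PointAction

/-- Filtrations of the transversal of a crystal by closed invariant sets supply equivariant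
cofiltrations of the groupoid C*-algebra. -/
theorem hasEquivariantCofiltration {n : ℕ} {Ξ : Set (Pattern d)} (hΞ : IsUnitSpace Ξ)
    {G : Subgroup (Space d ≃ₗᵢ[ℝ] Space d)} {F : Fin (n + 1) → Set (Pattern d)}
    (hmono : Monotone F) (hsub : ∀ r, F r ⊆ Ξ) (hcl : ∀ r, IsClosed (F r))
    (hinv : ∀ r, GroupoidInvariant (F r)) (hG : ∀ r, PointInvariant G (F r)) :
    HasEquivariantCofiltration G F := by
  have hF : ∀ r, IsUnitSpace (F r) := fun r => hΞ.subset (hsub r) (hinv r)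
  have hle : ∀ r : Fin n, F r.castSucc ⊆ F r.succ := fun r => hmono (Fin.castSucc_le_succ r)
  refine ⟨fun r => (restrictCc (hF r.succ) (hF r.castSucc) (hcl _) (hle r)).map (hF _) (hF _),
    fun r => (extendCc (hF r.succ) (hF r.castSucc) (hcl _)).map ((hF _).diff (hF _)) (hF _),
    fun r => actAut (hF r) (hG r), fun r => isRestriction_restrictCc _ _ _ _,
    fun r => isExtensionByZero_extendCc _ _ _, fun r σ => isInducedBy_actAut _ _ _,
    fun r => surjective_restrict (hF _) (hcl _) (hF _) (hcl _) (hle r),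
    fun r => (isometry_extend (hF _) (hcl _) (hF _) (hcl _)).injective,
    fun r => range_extend (hF _) (hcl _) (hF _) (hcl _) (hle r), fun r σ a => ?_⟩
  set p := (restrictCc (hF r.succ) (hF r.castSucc) (hcl _) (hle r)).map (hF _) (hF _)
  have h : p.comp (actHom (hF r.succ) (hG r.succ) σ) =
      (actHom (hF r.castSucc) (hG r.castSucc) σ).comp p := by
    refine CStar.hom_ext (hF _) fun f => ?_
    rw [NonUnitalStarAlgHom.comp_apply, NonUnitalStarAlgHom.comp_apply, actHom, actHom,
      CcHom.map_ι, CcHom.map_ι, CcHom.map_ι, CcHom.map_ι]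
    congr 1
    refine ext_injective (funext fun γ => ?_)
    simp only [ext_restrictCc, ext_actCc, Function.comp_apply, restrictTo]
    have hiff : (act (σ : Space d ≃ₗᵢ[ℝ] Space d)⁻¹ γ).2 ∈ F r.castSucc ↔ γ.2 ∈ F r.castSucc := by
      refine ⟨fun h => ?_, fun h => hG _ _ (σ⁻¹).2 _ h⟩
      have h' := hG _ _ σ.2 _ h
      exact (congrArg Prod.snd (act_act_inv (σ : Space d ≃ₗᵢ[ℝ] Space d) γ)) ▸ h'
    by_cases hγ : γ.2 ∈ F r.castSucc
    · rw [if_pos hγ, if_pos (hiff.2 hγ)]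
    · rw [if_neg hγ, if_neg (mt hiff.1 hγ)]
  exact DFunLike.congr_fun h a

/-! ### The regular representation -/

theorem sum_le_finsum_of_nonneg {α : Type*} {f : α → ℝ} (h0 : ∀ a, 0 ≤ f a)
    (hf : (Function.support f).Finite) (B : Finset α) : ∑ a ∈ B, f a ≤ ∑ᶠ a, f a := by
  classical
  rw [finsum_eq_sum_of_support_subset (s := B ∪ hf.toFinset) f (by simp)]
  exact Finset.sum_le_sum_of_subset_of_nonneg Finset.subset_union_left fun a _ _ => h0 a

theorem re_inv_mul_self_zero {Y : Set (Pattern d)} (hY : IsUnitSpace Y) (f : Cc Y)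
    (S : Pattern d) : (ext (hY.mul (hY.inv f) f) (0, S)).re = ∑ᶠ y : Space d, ‖ext f (y, S)‖ ^ 2 := by
  have hfin := (isCc_ext f).finite_support hY S
  rw [hY.ext_mul, conv_apply_eq_sum (G := ext f) (γ := (0, S)) (A := hfin.toFinset)
    fun y hy => hfin.mem_toFinset.2 hy, Complex.re_sum,
    finsum_eq_sum_of_support_subset (s := hfin.toFinset)]
  · refine Finset.sum_congr rfl fun y _ => ?_
    have : ext (hY.inv f) (0 - y, S.shift y) = star (ext f (y, S)) := by
      simp [adj, inverse]
    rw [this, RCLike.star_def, ← Complex.normSq_eq_conj_mul_self, Complex.ofReal_re,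
      Complex.normSq_eq_norm_sq]
  · exact fun y hy => hfin.mem_toFinset.2 fun h => hy (by simp [h])

/-- The vector functional of the regular representation at a pattern. -/
def regularFunctional {Y : Set (Pattern d)} (hY : IsUnitSpace Y) {S : Pattern d} (hS : S ∈ Y) :
    PositiveFunctional hY where
  toLin :=
    { toFun := fun f => ext f (0, S)
      map_add' := fun f g => by rw [ext_add]; rfl
      map_smul' := fun c f => by rw [ext_smul]; rfl }
  map_inv := fun f => by simp [adj, inverse]
  nonneg := fun f => by
    change 0 ≤ (ext (hY.mul (hY.inv f) f) (0, S)).re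
    rw [re_inv_mul_self_zero]
    exact finsum_nonneg fun y => by positivity
  bound := fun k f => by
    change (ext (hY.mul (hY.inv (hY.mul k f)) (hY.mul k f)) (0, S)).re ≤
      _ * (ext (hY.mul (hY.inv f) f) (0, S)).re
    rw [re_inv_mul_self_zero, re_inv_mul_self_zero]
    have hA := (isCc_ext f).finite_support hY S
    have hB := (isCc_ext (hY.mul k f)).finite_support hY S
    set N := (iNorm k).toReal
    have hN : 0 ≤ N := ENNReal.toReal_nonneg
    rw [finsum_eq_sum_of_support_subset (s := hB.toFinset) _
        fun y hy => hB.mem_toFinset.2 fun h => hy (by simp [h]),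
      finsum_eq_sum_of_support_subset (s := hA.toFinset) _
        fun y hy => hA.mem_toFinset.2 fun h => hy (by simp [h])]
    set A := hA.toFinset
    set B := hB.toFinset
    -- Schur test for the matrix of `k` on the fibre at `S`: rows are bounded by range fibres and
    -- columns by source fibres, hence both by the I-norm, and Cauchy-Schwarz gives the operator
    -- bound.
    set K : Space d → Space d → ℝ := fun x y => ‖ext k (x - y, S.shift y)‖
    have hrow : ∀ x, ∑ y ∈ A, K x y ≤ N := by
      intro x
      by_cases hx : x ∈ S
      · have h1 := sumAbs_adj_le hY k (hY.invariant S hS x hx)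
        have h2 : sumAbs (adj (ext k)) (S.shift x) = ∑ᶠ y, K x y := by
          rw [sumAbs, ← finsum_comp_equiv (Equiv.subRight x)]
          exact finsum_congr fun y => by simp [adj, inverse, K]
        rw [h2] at h1
        refine (sum_le_finsum_of_nonneg (fun y => norm_nonneg _) ?_ A).trans h1
        have h3 := ((isCc_ext k).adj hY).finite_support hY (S.shift x)
        refine (h3.image fun z => z + x).subset fun y hy => ⟨y - x, ?_, by simp⟩
        have h4 : ext k (x - y, S.shift y) ≠ 0 := norm_ne_zero_iff.1 hy
        simpa [adj, inverse] using h4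
      · rw [Finset.sum_eq_zero]
        · exact hN
        · intro y _
          refine norm_eq_zero.2 (ext_of_notMem k fun h => hx ?_)
          simpa using h.2
    have hcol : ∀ y ∈ A, ∑ x ∈ B, K x y ≤ N := by
      intro y hy
      have hyS : y ∈ S := ((isCc_ext f).mem (hA.mem_toFinset.1 hy)).2
      have h1 := sumAbs_le hY k (hY.invariant S hS y hyS)
      have h2 : sumAbs (ext k) (S.shift y) = ∑ᶠ x, K x y := by
        rw [sumAbs, ← finsum_comp_equiv (Equiv.subRight y)]
        rfl
      rw [h2] at h1
      refine (sum_le_finsum_of_nonneg (fun x => norm_nonneg _) ?_ B).trans h1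
      have h3 := (isCc_ext k).finite_support hY (S.shift y)
      refine (h3.image fun z => z + y).subset fun x hx => ⟨x - y, ?_, by simp⟩
      exact norm_ne_zero_iff.1 hx
    have hpt : ∀ x, ‖ext (hY.mul k f) (x, S)‖ ^ 2 ≤ N * ∑ y ∈ A, K x y * ‖ext f (y, S)‖ ^ 2 := by
      intro x
      have h1 : ‖ext (hY.mul k f) (x, S)‖ ≤ ∑ y ∈ A, K x y * ‖ext f (y, S)‖ := by
        rw [hY.ext_mul, conv_apply_eq_sum (G := ext f) (γ := (x, S)) (A := A)
            fun y hy => hA.mem_toFinset.2 hy]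
        refine (norm_sum_le _ _).trans (le_of_eq (Finset.sum_congr rfl fun y _ => ?_))
        rw [norm_mul]
      have h2 := Finset.sum_sq_le_sum_mul_sum_of_sq_le_mul A
        (r := fun y => K x y * ‖ext f (y, S)‖) (f := K x)
        (g := fun y => K x y * ‖ext f (y, S)‖ ^ 2) (fun y _ => norm_nonneg _)
        (fun y _ => by positivity) fun y _ => le_of_eq (by ring)
      calc _ ≤ (∑ y ∈ A, K x y * ‖ext f (y, S)‖) ^ 2 := by gcongr
        _ ≤ _ := h2
        _ ≤ _ := by
          gcongr
          exact hrow x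
    calc _ ≤ ∑ x ∈ B, N * ∑ y ∈ A, K x y * ‖ext f (y, S)‖ ^ 2 :=
          Finset.sum_le_sum fun x _ => hpt x
      _ = N * ∑ y ∈ A, (∑ x ∈ B, K x y) * ‖ext f (y, S)‖ ^ 2 := by
          rw [← Finset.mul_sum, Finset.sum_comm]
          simp_rw [Finset.sum_mul]
      _ ≤ N * ∑ y ∈ A, N * ‖ext f (y, S)‖ ^ 2 := by
          gcongr with y hy
          exact hcol y hy
      _ = _ := by rw [← Finset.mul_sum]; ring

/-- In the regular representation at `S` the unit is a vector of norm one, and the value of `f` at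
the unit `(0, S)` is one coordinate of its image. -/
theorem norm_ext_zero_le {Y : Set (Pattern d)} (hY : IsUnitSpace Y) (hcl : IsClosed Y)
    {S : Pattern d} (hS : S ∈ Y) (f : Cc Y) : ‖ext f (0, S)‖ ≤ ‖ι f‖ := by
  set φ := regularFunctional hY hS
  have h1 := φ.le_norm_gns_mul hcl f
  have h2 : (φ.toLin (hY.one hcl)).re = 1 := by
    change (ext (hY.one hcl) (0, S)).re = 1
    simp [unitFun, hS]
  have h3 : ‖ext f (0, S)‖ ^ 2 ≤ (φ.toLin (hY.mul (hY.inv f) f)).re := by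
    change _ ≤ (ext (hY.mul (hY.inv f) f) (0, S)).re
    rw [re_inv_mul_self_zero]
    have hfin := (isCc_ext f).finite_support hY S
    refine le_trans (by simp) (sum_le_finsum_of_nonneg (f := fun y => ‖ext f (y, S)‖ ^ 2)
      (fun y => by positivity) (hfin.subset fun y hy h => hy (by simp [h])) {0})
  rw [h2, mul_one] at h1
  refine le_of_sq_le_sq (h3.trans (h1.trans ?_)) (norm_nonneg _)
  have := norm_toFun_le_norm_ι hY f φ.gns
  gcongr

end Crystal

end

/-! ### Cut lattices and the transversal of an orthant -/

noncomputable section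

namespace Crystal

open Filter

variable {d : ℕ}

/-! ### Lattice points and cut lattices -/

/-- The points of the lattice `ℤ^d`. -/
def emb (m : Fin d → ℤ) : Space d := WithLp.toLp 2 fun i => (m i : ℝ)

@[simp] theorem emb_apply (m : Fin d → ℤ) (i : Fin d) : emb m i = m i := rfl

@[simp] theorem emb_inj {m m' : Fin d → ℤ} : emb m = emb m' ↔ m = m' := by
  refine ⟨fun h => funext fun i => ?_, fun h => h ▸ rfl⟩
  have := congrArg (fun x : Space d => x i) h
  simpa using this

theorem emb_add (m m' : Fin d → ℤ) : emb (m + m') = emb m + emb m' := by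
  ext i
  simp

theorem emb_sub (m m' : Fin d → ℤ) : emb (m - m') = emb m - emb m' := by
  ext i
  simp

@[simp] theorem emb_zero : emb (0 : Fin d → ℤ) = 0 := by
  ext i
  simp

theorem emb_single (i : Fin d) : emb (Pi.single i 1) = unitVec i := by
  ext j
  by_cases h : j = i
  · subst h; simp [unitVec]
  · simp [unitVec, h]

theorem eq_of_dist_lt_one {m m' : Fin d → ℤ} (h : dist (emb m) (emb m') < 1) : m = m' := by
  funext i
  have h1 : ‖(emb m - emb m') i‖ ≤ ‖emb m - emb m'‖ := PiLp.norm_apply_le _ _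
  rw [dist_eq_norm] at h
  have h2 : |((m i - m' i : ℤ) : ℝ)| < 1 := by
    have := h1.trans_lt h
    simpa using this
  rw [← Int.cast_abs] at h2
  have h3 : |m i - m' i| < 1 := by exact_mod_cast h2
  have := Int.abs_lt_one_iff.1 h3
  omega

theorem isClosed_range_emb : IsClosed (range (emb : (Fin d → ℤ) → Space d)) := by
  have : range (emb : (Fin d → ℤ) → Space d) = {x | ∀ i, x i ∈ range ((↑) : ℤ → ℝ)} := by
    ext x
    constructor
    · rintro ⟨m, rfl⟩ i
      exact ⟨m i, rfl⟩
    · intro h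
      choose m hm using h
      exact ⟨m, by ext i; exact hm i⟩
  rw [this]
  simp only [ofPred_forall]
  exact isClosed_iInter fun i => Int.isClosedEmbedding_coe_real.isClosed_range.preimage
    (by fun_prop : Continuous fun x : Space d => x i)

theorem signCast (s : SignType) : ((s : ℤ) : ℝ) = (s : ℝ) := by cases s <;> simp

/-- The lattice points `m` with `-n i ≤ τ i * m i` for all `i`. -/
def cut (τ : Fin d → SignType) (n : Fin d → ℕ) : Pattern d where
  carrier := {x | ∀ i, x i ∈ range ((↑) : ℤ → ℝ) ∧ -(n i : ℝ) ≤ (τ i : ℝ) * x i}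
  isClosed' := by
    simp only [ofPred_forall, ofPred_and]
    refine isClosed_iInter fun i => IsClosed.inter ?_ ?_
    · exact Int.isClosedEmbedding_coe_real.isClosed_range.preimage
        (by fun_prop : Continuous fun x : Space d => x i)
    · exact isClosed_le continuous_const (by fun_prop)

theorem mem_cut {τ : Fin d → SignType} {n : Fin d → ℕ} {x : Space d} :
    x ∈ cut τ n ↔ ∃ m, emb m = x ∧ ∀ i, -(n i : ℤ) ≤ (τ i : ℤ) * m i := by
  constructor
  · intro h
    have h' : ∀ i, ∃ m : ℤ, (m : ℝ) = x i ∧ -(n i : ℝ) ≤ (τ i : ℝ) * x i := fun i =>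
      (h i).1.imp fun m hm => ⟨hm, (h i).2⟩
    choose m hm hn using h'
    refine ⟨m, by ext i; exact hm i, fun i => ?_⟩
    have := hn i
    rw [← hm i, ← signCast] at this
    exact_mod_cast this
  · rintro ⟨m, rfl, h⟩ i
    refine ⟨⟨m i, rfl⟩, ?_⟩
    rw [emb_apply, ← signCast]
    exact_mod_cast h i

@[simp] theorem emb_mem_cut {τ : Fin d → SignType} {n : Fin d → ℕ} {m : Fin d → ℤ} :
    emb m ∈ cut τ n ↔ ∀ i, -(n i : ℤ) ≤ (τ i : ℤ) * m i := by
  rw [mem_cut]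
  exact ⟨fun ⟨m', h, h'⟩ => emb_inj.1 h ▸ h', fun h => ⟨m, rfl, h⟩⟩

theorem emb_single_mem_cut {τ : Fin d → SignType} {n : Fin d → ℕ} {i : Fin d} {m : ℤ} :
    emb (Pi.single i m) ∈ cut τ n ↔ -(n i : ℤ) ≤ τ i * m := by
  rw [emb_mem_cut]
  refine ⟨fun h => by simpa using h i, fun h j => ?_⟩
  by_cases hj : j = i
  · subst hj; simpa using h
  · simp [hj]

theorem orthant_eq_cut (ε : Fin d → SignType) : orthant ε = cut ε 0 := by
  refine SetLike.ext fun x => forall_congr' fun i => ?_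
  simp

theorem bulk_eq_cut : bulk d = cut 0 0 := orthant_eq_cut 0

/-- Patterns that consist of lattice points. -/
def IsLattice (S : Pattern d) : Prop := ∀ x ∈ S, ∃ m, emb m = x

theorem isLattice_cut (τ : Fin d → SignType) (n : Fin d → ℕ) : IsLattice (cut τ n) := fun _ hx => by
  obtain ⟨m, hm, _⟩ := mem_cut.1 hx
  exact ⟨m, hm⟩

theorem zero_mem_cut (τ : Fin d → SignType) (n : Fin d → ℕ) : (0 : Space d) ∈ cut τ n := by
  rw [← emb_zero, emb_mem_cut]
  intro i
  simp

theorem uniformlySeparated_of_isLattice {Y : Set (Pattern d)} (h : ∀ S ∈ Y, IsLattice S) :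
    UniformlySeparated Y := by
  refine uniformlySeparated_iff.2 ⟨1, one_pos, fun S hS x hx y hy hxy => ?_⟩
  obtain ⟨m, rfl⟩ := h S hS x hx
  obtain ⟨m', rfl⟩ := h S hS y hy
  rw [eq_of_dist_lt_one hxy]

theorem IsLattice.ext {S T : Pattern d} (hS : IsLattice S) (hT : IsLattice T)
    (h : ∀ m, emb m ∈ S ↔ emb m ∈ T) : S = T := by
  refine SetLike.ext fun x => ⟨fun hx => ?_, fun hx => ?_⟩
  · obtain ⟨m, rfl⟩ := hS x hx
    exact (h m).1 hx
  · obtain ⟨m, rfl⟩ := hT x hx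
    exact (h m).2 hx

theorem cut_shift (τ : Fin d → SignType) {n n' : Fin d → ℕ} {m : Fin d → ℤ}
    (h : ∀ i, τ i ≠ 0 → (n' i : ℤ) = n i + τ i * m i) : (cut τ n).shift (emb m) = cut τ n' := by
  refine IsLattice.ext (fun x hx => ?_) (isLattice_cut _ _) fun l => ?_
  · obtain ⟨l, hl⟩ := isLattice_cut _ _ _ hx
    exact ⟨l - m, by rw [emb_sub, hl, add_sub_cancel_right]⟩
  · rw [Pattern.mem_shift, ← emb_add, emb_mem_cut, emb_mem_cut]
    refine forall_congr' fun i => ?_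
    have := h i
    cases hi : τ i <;> simp_all <;> omega

/-- The walls absent from `τ'` recede to distance `N`. The approximating patterns are contained in
the limit, so miss conditions hold throughout; a hit condition needs a single lattice point, which
is eventually on the right side of all walls. -/
theorem tendsto_cut {τ τ' : Fin d → SignType} (h : ∀ i, τ' i = 0 ∨ τ' i = τ i) (n' : Fin d → ℕ) :
    Tendsto (fun N : ℕ => cut τ fun i => if τ' i = 0 then N else n' i) atTop
      (𝓝 (cut τ' n')) := by
  have hsub : ∀ N : ℕ, ∀ x ∈ cut τ fun i => if τ' i = 0 then N else n' i, x ∈ cut τ' n' := by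
    intro N x hx
    obtain ⟨m, rfl, hm⟩ := mem_cut.1 hx
    rw [emb_mem_cut]
    intro i
    have h1 := hm i
    rcases h i with h0 | h0
    · simp [h0]
    · by_cases h2 : τ' i = 0
      · simp [h2]
      · rw [if_neg h2] at h1
        rwa [h0]
  rw [TopologicalSpace.tendsto_nhds_generateFrom_iff]
  rintro A (⟨K, hK, rfl⟩ | ⟨U, hU, rfl⟩) hA
  · refine Filter.Eventually.of_forall fun N => ?_
    exact Set.disjoint_left.2 fun x hx hxK => Set.disjoint_left.1 hA (hsub N x hx) hxK
  · obtain ⟨x, hx, hxU⟩ := hA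
    obtain ⟨m, rfl, hm⟩ := mem_cut.1 (show x ∈ cut τ' n' from hx)
    obtain ⟨N₀, hN₀⟩ : ∃ N₀ : ℕ, ∀ i, |m i| ≤ N₀ := by
      refine ⟨∑ i, (m i).natAbs, fun i => ?_⟩
      rw [Int.abs_eq_natAbs]
      exact_mod_cast Finset.single_le_sum (f := fun i => (m i).natAbs) (fun _ _ => Nat.zero_le _)
        (Finset.mem_univ i)
    filter_upwards [eventually_ge_atTop N₀] with N hN
    refine ⟨emb m, emb_mem_cut.2 fun i => ?_, hxU⟩
    have h1 := hm i
    have h2 := hN₀ i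
    rcases h i with h0 | h0
    · rw [if_pos h0]
      have h3 := abs_le.1 h2
      have h4 : (N₀ : ℤ) ≤ N := by exact_mod_cast hN
      cases hi : τ i <;> simp <;> omega
    · by_cases h2 : τ' i = 0
      · rw [if_pos h2, ← h0, h2]
        simp
      · rw [if_neg h2, ← h0]
        exact h1

/-- A closed invariant set of patterns contains with a cut lattice all its translates with the
origin in the pattern and their limits. -/
theorem cut_mem_of_cut_mem {F : Set (Pattern d)} (hF : IsClosed F) (hinv : GroupoidInvariant F)
    {τ τ' : Fin d → SignType} {n : Fin d → ℕ} (hτ : cut τ n ∈ F)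
    (h : ∀ i, τ' i = 0 ∨ τ' i = τ i) (n' : Fin d → ℕ) : cut τ' n' ∈ F := by
  refine hF.mem_of_tendsto (tendsto_cut h n') (Filter.Eventually.of_forall fun N => ?_)
  set n'' : Fin d → ℕ := fun i => if τ' i = 0 then N else n' i
  -- Moving by `n'' i - n i` along `τ i` corrects the distance to each wall, because `τ i * τ i = 1`
  -- there.
  rw [← cut_shift τ (n := n) (m := fun i => τ i * ((n'' i : ℤ) - n i)) fun i hi => ?_]
  · refine hinv _ hτ _ (emb_mem_cut.2 fun i => ?_)
    cases hi : τ i <;> simp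
  · cases hi' : τ i <;> simp_all

/-- One inclusion consists of translates and limits of the orthant. For the other, a limit
containing the origin is a lattice pattern agreeing on every finite set of lattice points with some
cut of sign `ε`; following the coordinate axes from the origin tells which walls survive and where
they are. -/
theorem mem_transversal_orthant {ε : Fin d → SignType} {S : Pattern d} :
    S ∈ transversal (orthant ε) ↔
      ∃ τ n, (∀ i, τ i = 0 ∨ τ i = ε i) ∧ S = cut τ n := by
  constructor
  swap
  · rintro ⟨τ, n, hτ, rfl⟩
    refine cut_mem_of_cut_mem (isClosed_transversal _) (groupoidInvariant_transversal _)
      (τ := ε) (n := 0) ?_ hτ n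
    rw [← orthant_eq_cut, mem_transversal]
    refine ⟨subset_closure ⟨0, Pattern.shift_zero _⟩, ?_⟩
    rw [orthant_eq_cut]
    exact zero_mem_cut _ _
  rw [mem_transversal]
  rintro ⟨hS, h0⟩
  -- Translates close to `S` need not contain the origin, only a site `a` near it; below they are
  -- recentred at `a`.
  have approx : ∀ A : Set (Pattern d), IsOpen A → S ∈ A → ∀ δ > 0, ∃ t, (orthant ε).shift t ∈ A ∧
      ∃ a ∈ (orthant ε).shift t, ‖a‖ < δ := by
    intro A hA hSA δ hδ
    obtain ⟨_, ⟨hT, ⟨a, ha, haδ⟩⟩, t, rfl⟩ := mem_closure_iff.1 hS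
      (A ∩ {T : Pattern d | ((T : Set (Space d)) ∩ Metric.ball 0 δ).Nonempty})
      (hA.inter (Pattern.isOpen_inter_nonempty Metric.isOpen_ball))
      ⟨hSA, 0, h0, Metric.mem_ball_self hδ⟩
    exact ⟨t, hT, a, ha, by simpa using haδ⟩
  have hdiff : ∀ t : Space d, ∀ a ∈ (orthant ε).shift t, ∀ b ∈ (orthant ε).shift t,
      ∃ m, emb m = b - a := by
    intro t a ha b hb
    rw [Pattern.mem_shift, orthant_eq_cut] at ha hb
    obtain ⟨m, hm⟩ := isLattice_cut _ _ _ ha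
    obtain ⟨m', hm'⟩ := isLattice_cut _ _ _ hb
    exact ⟨m' - m, by rw [emb_sub, hm, hm']; abel⟩
  have hlat : IsLattice S := by
    intro y hy
    by_contra hcon
    obtain ⟨δ, hδ, hball⟩ := Metric.isOpen_iff.1 isClosed_range_emb.isOpen_compl y
      (show y ∈ (range emb)ᶜ from fun ⟨m, hm⟩ => hcon ⟨m, hm⟩)
    obtain ⟨t, ⟨b, hb, hby⟩, a, ha, haδ⟩ := approx
      {T : Pattern d | ((T : Set (Space d)) ∩ Metric.ball y (δ / 2)).Nonempty}
      (Pattern.isOpen_inter_nonempty Metric.isOpen_ball)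
      ⟨y, hy, Metric.mem_ball_self (by positivity)⟩
      (δ / 2) (by positivity)
    refine hball (show b - a ∈ Metric.ball y δ from ?_) (hdiff t a ha b hb)
    rw [Metric.mem_ball, dist_eq_norm] at hby ⊢
    rw [show b - a - y = (b - y) - a by abel]
    linarith [norm_sub_le (b - y) a]
  have hfin : ∀ Φ : Finset (Fin d → ℤ), ∃ n : Fin d → ℕ, ∀ m ∈ Φ,
      (emb m ∈ S ↔ emb m ∈ cut ε n) := by
    intro Φ
    have hδ : ∀ m : Fin d → ℤ, emb m ∉ S → ∃ δ > 0,
        Metric.closedBall (emb m) δ ⊆ (S : Set (Space d))ᶜ :=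
      fun m hm => Metric.nhds_basis_closedBall.mem_iff.1 (S.isClosed.isOpen_compl.mem_nhds hm)
    choose! δ hδ0 hδ using hδ
    classical
    -- `η` is small enough for closed balls about the finitely many absent test points to miss `S`.
    -- The bound `1 / 2` leaves an error below `1` after recentring, and lattice points at distance
    -- below `1` coincide.
    obtain ⟨η, hη0, hη2, hηδ⟩ : ∃ η : ℝ, 0 < η ∧ η ≤ 1 / 2 ∧ ∀ m ∈ Φ, emb m ∉ S → η ≤ δ m := by
      clear * - hδ0
      induction Φ using Finset.induction_on with
      | empty => exact ⟨1 / 2, by norm_num, le_rfl, by simp⟩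
      | insert m Φ _ ih =>
        obtain ⟨η, h1, h2, h3⟩ := ih
        by_cases hm : emb m ∈ S
        · refine ⟨η, h1, h2, fun m' h' hm' => ?_⟩
          rcases Finset.mem_insert.1 h' with rfl | h'
          · exact absurd hm hm'
          · exact h3 m' h' hm'
        · refine ⟨min η (δ m), lt_min h1 (hδ0 m hm), (min_le_left _ _).trans h2, fun m' h' hm' => ?_⟩
          rcases Finset.mem_insert.1 h' with rfl | h'
          · exact min_le_right _ _
          · exact (min_le_left _ _).trans (h3 m' h' hm')
    obtain ⟨t, hT, a, ha, haη⟩ := approx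
      (⋂ m ∈ Φ, if emb m ∈ S then
          {T : Pattern d | ((T : Set (Space d)) ∩ Metric.ball (emb m) (1 / 2)).Nonempty}
        else {T : Pattern d | Disjoint (T : Set (Space d)) (Metric.closedBall (emb m) η)})
      (isOpen_biInter_finset fun m _ => by
        split_ifs
        · exact Pattern.isOpen_inter_nonempty Metric.isOpen_ball
        · exact Pattern.isOpen_disjoint (isCompact_closedBall _ _))
      (mem_iInter₂.2 fun m hm => by
        split_ifs with h
        · exact ⟨emb m, h, Metric.mem_ball_self (by norm_num)⟩
        · exact Set.disjoint_left.2 fun x hx hxb => hδ m h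
            (Metric.closedBall_subset_closedBall (hηδ m hm h) hxb) hx)
      η hη0
    have ha' := ha
    rw [Pattern.mem_shift, orthant_eq_cut] at ha'
    obtain ⟨l, hl, hlpos⟩ := mem_cut.1 ha'
    have hshift : (cut ε 0).shift (emb l) = cut ε fun i => (ε i * l i : ℤ).toNat := by
      refine cut_shift ε fun i _ => ?_
      have := hlpos i
      rw [Int.toNat_of_nonneg (by simpa using this)]
      simp
    have hmem : ∀ m, emb m ∈ (cut ε fun i => (ε i * l i : ℤ).toNat) ↔
        emb m + a ∈ (orthant ε).shift t := by
      intro m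
      rw [← hshift, Pattern.mem_shift, Pattern.mem_shift, hl, orthant_eq_cut, add_assoc]
    refine ⟨fun i => (ε i * l i : ℤ).toNat, fun m hm => ?_⟩
    rw [hmem]
    have hm' := mem_iInter₂.1 hT m hm
    by_cases h : emb m ∈ S
    · rw [if_pos h] at hm'
      obtain ⟨b, hb, hbm⟩ := hm'
      refine ⟨fun _ => ?_, fun _ => h⟩
      obtain ⟨m', hm'⟩ := hdiff t a ha b hb
      have : m' = m := by
        refine eq_of_dist_lt_one ?_
        rw [hm']
        rw [Metric.mem_ball, dist_eq_norm] at hbm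
        rw [dist_eq_norm, show b - a - emb m = (b - emb m) - a by abel]
        linarith [norm_sub_le (b - emb m) a]
      rw [← this, hm', sub_add_cancel]
      exact hb
    · rw [if_neg h] at hm'
      refine ⟨fun h' => absurd h' h, fun h' => ?_⟩
      refine (Set.disjoint_left.1 hm' h' ?_).elim
      rw [Metric.mem_closedBall, dist_eq_norm, add_sub_cancel_left]
      exact haη.le
  classical
  -- The site at depth `N + 1` from the origin towards the wall in direction `i` is absent. If this
  -- never happens the wall has disappeared; otherwise the first such `N` is its distance. For `ε i
  -- = 0` the point tested is the origin, so no wall arises.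
  let P : Fin d → ℕ → Prop := fun i N => emb (Pi.single i (-(ε i : ℤ) * (N + 1))) ∉ S
  let τ : Fin d → SignType := fun i => if ∃ N, P i N then ε i else 0
  let n : Fin d → ℕ := fun i => if h : ∃ N, P i N then Nat.find h else 0
  refine ⟨τ, n, fun i => ?_, hlat.ext (isLattice_cut _ _) fun m => ?_⟩
  · simp only [τ]
    split_ifs <;> simp
  -- The test points on each axis: the first absent site and the last present one determine an
  -- existing wall, and depth `|m i| + 1` shows that a vanished wall imposes no condition on `m`.
  let Φ : Finset (Fin d → ℤ) := insert m (Finset.univ.biUnion fun i =>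
    {Pi.single i (-(ε i : ℤ) * (n i + 1)), Pi.single i (-(ε i : ℤ) * n i),
      Pi.single i (-(ε i : ℤ) * ((m i).natAbs + 1))})
  obtain ⟨ν, hν⟩ := hfin Φ
  rw [hν m (Finset.mem_insert_self _ _), emb_mem_cut, emb_mem_cut]
  refine forall_congr' fun i => ?_
  have hm1 := hν (Pi.single i (-(ε i : ℤ) * (n i + 1))) (Finset.mem_insert_of_mem
    (Finset.mem_biUnion.2 ⟨i, Finset.mem_univ i, by simp⟩))
  have hm2 := hν (Pi.single i (-(ε i : ℤ) * n i)) (Finset.mem_insert_of_mem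
    (Finset.mem_biUnion.2 ⟨i, Finset.mem_univ i, by simp⟩))
  have hm3 := hν (Pi.single i (-(ε i : ℤ) * ((m i).natAbs + 1))) (Finset.mem_insert_of_mem
    (Finset.mem_biUnion.2 ⟨i, Finset.mem_univ i, by simp⟩))
  rw [emb_single_mem_cut] at hm1 hm2 hm3
  by_cases hP : ∃ N, P i N
  · have hτ : τ i = ε i := if_pos hP
    have hn : n i = Nat.find hP := dif_pos hP
    have h1 : emb (Pi.single i (-(ε i : ℤ) * (n i + 1))) ∉ S := by
      rw [hn]
      exact Nat.find_spec hP
    have h2 : emb (Pi.single i (-(ε i : ℤ) * n i)) ∈ S := by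
      rcases Nat.eq_zero_or_pos (n i) with h | h
      · rw [h]
        simpa using h0
      · have := Nat.find_min hP (m := n i - 1) (by omega)
        simp only [P, not_not] at this
        have hcast : ((n i - 1 : ℕ) : ℤ) + 1 = n i := by omega
        rwa [hcast] at this
    rw [hτ]
    have h1' := mt hm1.2 h1
    have h2' := hm2.1 h2
    generalize n i = a at *
    cases hi : ε i <;> simp [hi] at h1' h2' ⊢ <;> omega
  · have hτ : τ i = 0 := if_neg hP
    rw [hτ]
    have h3 : emb (Pi.single i (-(ε i : ℤ) * ((m i).natAbs + 1))) ∈ S := by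
      by_contra h
      exact hP ⟨_, h⟩
    have h3' := hm3.1 h3
    have h4 := neg_abs_le (m i)
    have h5 := le_abs_self (m i)
    clear hm1 hm2 hm3
    cases hi : ε i <;> simp [hi] at h3' ⊢ <;> omega

end Crystal

end

/-! ### Codimension, closedness of the strata and localization -/

noncomputable section

namespace Crystal

open Filter

variable {d : ℕ}

/-! ### Codimension and boundary sites of cut lattices -/

/-- The directions in which a pattern is cut. -/
def signSupp (τ : Fin d → SignType) : Finset (Fin d) := Finset.univ.filter fun i => τ i ≠ 0

@[simp] theorem mem_signSupp {τ : Fin d → SignType} {i : Fin d} : i ∈ signSupp τ ↔ τ i ≠ 0 := by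
  simp [signSupp]

theorem linearIndependent_unitVec : LinearIndependent ℝ (unitVec : Fin d → Space d) := by
  have h := (EuclideanSpace.basisFun (Fin d) ℝ).orthonormal.linearIndependent
  have h' : ⇑(EuclideanSpace.basisFun (Fin d) ℝ) = (unitVec : Fin d → Space d) := by
    funext i
    simp [unitVec]
  rwa [h'] at h

theorem sum_smul_unitVec (x : Space d) : ∑ i, x i • unitVec i = x := by
  ext j
  simp [unitVec, Finset.sum_apply, Pi.single_apply]

theorem shift_nsmul {S : Pattern d} {v : Space d} (h : S.shift v = S) (N : ℕ) :
    S.shift (N • v) = S := by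
  induction N with
  | zero => rw [zero_smul, Pattern.shift_zero]
  | succ N ih => rw [succ_nsmul, ← Pattern.shift_shift, h, ih]

/-- A period has all its integer multiples inside the pattern, so it cannot have a component across
a wall; the uncut unit vectors are periods. -/
theorem span_periods_cut (τ : Fin d → SignType) (n : Fin d → ℕ) :
    Submodule.span ℝ {v : Space d | (cut τ n).shift v = cut τ n} =
      Submodule.span ℝ (range fun i : {i // τ i = 0} => unitVec (i : Fin d)) := by
  refine le_antisymm (Submodule.span_le.2 fun v hv => ?_) (Submodule.span_mono ?_)
  · have hmem : ∀ w : Space d, (cut τ n).shift w = cut τ n → w ∈ cut τ n := fun w hw => by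
      have h0 := zero_mem_cut τ n
      rw [← hw, Pattern.mem_shift, zero_add] at h0
      exact h0
    have hv' : (cut τ n).shift (-v) = cut τ n := by
      conv_lhs => rw [← show (cut τ n).shift v = cut τ n from hv]
      rw [Pattern.shift_shift, neg_add_cancel, Pattern.shift_zero]
    obtain ⟨m, rfl⟩ := isLattice_cut _ _ _ (hmem v hv)
    have hneg : ∀ l : Fin d → ℤ, -emb l = emb (-l) := fun l => by ext i; simp
    have hsmul : ∀ (N : ℕ) (l : Fin d → ℤ), N • emb l = emb (N • l) := fun N l => by
      ext i; simp
    have hm : ∀ i, τ i ≠ 0 → m i = 0 := by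
      intro i hi
      -- The multiple `n i + 1` exceeds the distance to the wall, so `|m i| * (n i + 1) ≤ n i`
      -- forces `m i = 0`.
      have h1 := hmem _ (shift_nsmul hv (n i + 1))
      have h2 := hmem _ (shift_nsmul hv' (n i + 1))
      rw [hneg, hsmul, emb_mem_cut] at h2
      rw [hsmul, emb_mem_cut] at h1
      have h3 : |m i| * (n i + 1) ≤ n i := by
        rw [← abs_of_nonneg (show (0 : ℤ) ≤ n i + 1 by positivity), ← abs_mul, abs_le]
        have h1 := h1 i
        have h2 := h2 i
        cases h : τ i
        · exact absurd h hi
        · simp [h] at h1 h2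
          constructor <;> linarith
        · simp [h] at h1 h2
          constructor <;> linarith
      by_contra h0
      have := Int.one_le_abs h0
      nlinarith
    rw [← sum_smul_unitVec (emb m)]
    refine Submodule.sum_mem _ fun i _ => ?_
    by_cases hi : τ i = 0
    · exact Submodule.smul_mem _ _ (Submodule.subset_span ⟨⟨i, hi⟩, rfl⟩)
    · simp [hm i hi]
  · rintro _ ⟨⟨i, hi⟩, rfl⟩
    change (cut τ n).shift (unitVec i) = cut τ n
    rw [← emb_single]
    refine cut_shift τ fun j hj => ?_
    have : j ≠ i := fun h => hj (h ▸ hi)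
    simp [this]

theorem codim_cut (τ : Fin d → SignType) (n : Fin d → ℕ) :
    codim (cut τ n) = (signSupp τ).card := by
  have hli : LinearIndependent ℝ fun i : {i // τ i = 0} => (unitVec (i : Fin d) : Space d) :=
    linearIndependent_unitVec.comp _ Subtype.val_injective
  rw [codim, span_periods_cut, finrank_span_eq_card hli, Fintype.card_subtype]
  have h := Finset.card_filter_add_card_filter_not (s := Finset.univ) (fun i => τ i = 0)
  rw [Finset.card_univ, Fintype.card_fin] at h
  have h' : (signSupp τ).card = (Finset.univ.filter fun i => ¬ τ i = 0).card := rfl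
  omega

theorem codim_shift (S : Pattern d) (x : Space d) : codim (S.shift x) = codim S := by
  have : {v : Space d | (S.shift x).shift v = S.shift x} = {v | S.shift v = S} := by
    ext v
    constructor
    · intro h
      have h' := congrArg (fun T : Pattern d => T.shift (-x))
        (show (S.shift x).shift v = S.shift x from h)
      simpa [Pattern.shift_shift, Pattern.shift_zero] using h'
    · intro h
      have h' := congrArg (fun T : Pattern d => T.shift x) (show S.shift v = S from h)
      rw [mem_ofPred_eq, Pattern.shift_shift, add_comm, ← Pattern.shift_shift]
      exact h'
  rw [codim, this, codim]

theorem codim_map (σ : Space d ≃ₗᵢ[ℝ] Space d) (S : Pattern d) : codim (S.map σ) = codim S := by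
  have hinj : Function.Injective (Pattern.map σ) := fun S T h => by
    have := congrArg (Pattern.map σ⁻¹) h
    rwa [← Pattern.map_mul, ← Pattern.map_mul, inv_mul_cancel, Pattern.map_one,
      Pattern.map_one] at this
  have : {v : Space d | (S.map σ).shift v = S.map σ} =
      σ.toLinearEquiv '' {v | S.shift v = S} := by
    ext v
    constructor
    · intro h
      refine ⟨σ.symm v, hinj ?_, σ.apply_symm_apply v⟩
      rw [Pattern.map_shift, σ.apply_symm_apply]
      exact h
    · rintro ⟨w, hw, rfl⟩
      change (S.map σ).shift (σ w) = S.map σ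
      rw [← Pattern.map_shift, show S.shift w = S from hw]
  rw [codim, this, codim]
  congr 1
  rw [show (σ.toLinearEquiv : Space d → Space d) = (σ.toLinearEquiv : Space d →ₗ[ℝ] Space d) from rfl,
    Submodule.span_image]
  exact LinearEquiv.finrank_map_eq σ.toLinearEquiv _

theorem emb_add_unitVec (m : Fin d → ℤ) (i : Fin d) :
    emb m + unitVec i = emb (m + Pi.single i 1) := by rw [emb_add, emb_single]

theorem emb_sub_unitVec (m : Fin d → ℤ) (i : Fin d) :
    emb m - unitVec i = emb (m - Pi.single i 1) := by rw [emb_sub, emb_single]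

theorem nonempty_boundarySites_cut {τ : Fin d → SignType} {n : Fin d → ℕ} {r : ℕ} :
    (boundarySites r (cut τ n)).Nonempty ↔ r ≤ (signSupp τ).card := by
  rw [← Set.ncard_coe_finset]
  constructor
  · rintro ⟨y, hy, hr⟩
    refine hr.trans (Set.ncard_le_ncard (fun i hi => ?_) (Finset.finite_toSet _))
    obtain ⟨m, rfl, hm⟩ := mem_cut.1 hy
    simp only [Finset.mem_coe, mem_signSupp]
    intro h0
    rw [mem_ofPred_eq, emb_add_unitVec, emb_sub_unitVec, emb_mem_cut, emb_mem_cut] at hi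
    have key : ∀ c : ℤ, ∀ j, -(n j : ℤ) ≤ τ j * (m j + c * (Pi.single i 1 : Fin d → ℤ) j) := by
      intro c j
      by_cases hj : j = i
      · subst hj
        simp [h0]
      · simpa [hj] using hm j
    rcases hi with hi | hi
    · exact hi fun j => by simpa using key 1 j
    · exact hi fun j => by simpa [sub_eq_add_neg] using key (-1) j
  · intro hr
    -- The corner of the pattern, lying on all of its walls at once.
    refine ⟨emb fun i => -(τ i * n i), emb_mem_cut.2 fun i => ?_, hr.trans
      (Set.ncard_le_ncard (fun i hi => ?_) (Set.toFinite _))⟩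
    · cases τ i <;> simp
    · simp only [Finset.mem_coe, mem_signSupp] at hi
      rw [mem_ofPred_eq, emb_add_unitVec, emb_sub_unitVec, emb_mem_cut, emb_mem_cut]
      cases h : τ i
      · exact absurd h hi
      · left
        intro h'
        have := h' i
        simp [h] at this
      · right
        intro h'
        have := h' i
        simp [h] at this

/-- Boundary sites of lattice patterns persist in nearby lattice patterns. -/
theorem eventually_boundarySites {S : Pattern d} (hS : IsLattice S) {r : ℕ} {y : Space d}
    (hy : y ∈ boundarySites r S) : ∀ᶠ T in 𝓝 S, IsLattice T → y ∈ boundarySites r T := by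
  obtain ⟨hyS, hr⟩ := hy
  obtain ⟨m, rfl⟩ := hS y hyS
  -- A site within distance `1` of `emb m` in a lattice pattern is `emb m` itself; absence of a
  -- neighbour is an open condition anyway.
  have h1 : ∀ᶠ T : Pattern d in 𝓝 S, ((T : Set (Space d)) ∩ Metric.ball (emb m) 1).Nonempty :=
    (Pattern.isOpen_inter_nonempty Metric.isOpen_ball).mem_nhds
      ⟨_, hyS, Metric.mem_ball_self one_pos⟩
  have h2 : ∀ᶠ T : Pattern d in 𝓝 S, ∀ i : Fin d,
      (emb m + unitVec i ∉ S ∨ emb m - unitVec i ∉ S) →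
        (emb m + unitVec i ∉ T ∨ emb m - unitVec i ∉ T) := by
    rw [eventually_all]
    intro i
    by_cases h : emb m + unitVec i ∉ S
    · filter_upwards [(Pattern.isOpen_notMem _).mem_nhds h] with T hT _ using Or.inl hT
    · by_cases h' : emb m - unitVec i ∉ S
      · filter_upwards [(Pattern.isOpen_notMem _).mem_nhds h'] with T hT _ using Or.inr hT
      · exact Eventually.of_forall fun T hT => absurd hT (by tauto)
  filter_upwards [h1, h2] with T hT1 hT2 hT
  refine ⟨?_, hr.trans (Set.ncard_le_ncard hT2 (Set.toFinite _))⟩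
  obtain ⟨x, hx, hxm⟩ := hT1
  obtain ⟨l, rfl⟩ := hT x hx
  rwa [← eq_of_dist_lt_one hxm]

/-! ### Transversals of families of cut lattices -/

theorem mem_globalTransversal_orthant {E : Set (Fin d → SignType)} {S : Pattern d} :
    S ∈ globalTransversal (orthant '' E) ↔
      ∃ ε ∈ E, ∃ τ n, (∀ i, τ i = 0 ∨ τ i = ε i) ∧ S = cut τ n := by
  simp only [globalTransversal, mem_iUnion, exists_prop, exists_mem_image, mem_transversal_orthant]

/-- The signs of a nonempty family of patterns which are cut in the first `k` directions. -/
structure IsSignFamily (E : Set (Fin d → SignType)) (k : ℕ) : Prop where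
  nonempty : E.Nonempty
  ne_zero_iff : ∀ ε ∈ E, ∀ i : Fin d, ε i ≠ 0 ↔ (i : ℕ) < k
  le : k ≤ d

theorem cornerFamily_eq (d k : ℕ) :
    cornerFamily d k = orthant '' {fun i : Fin d => if (i : ℕ) < k then 1 else 0} := by
  rw [image_singleton, cornerFamily]

theorem boxFamily_eq (d k : ℕ) :
    boxFamily d k = orthant '' {ε : Fin d → SignType | ∀ i : Fin d, ε i ≠ 0 ↔ (i : ℕ) < k} := by
  ext L
  simp only [boxFamily, mem_ofPred_eq, mem_image, eq_comm]

theorem isSignFamily_corner {k : ℕ} (h : k ≤ d) :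
    IsSignFamily {fun i : Fin d => if (i : ℕ) < k then (1 : SignType) else 0} k where
  nonempty := singleton_nonempty _
  ne_zero_iff := by
    rintro _ rfl i
    simp
  le := h

theorem isSignFamily_box {k : ℕ} (h : k ≤ d) :
    IsSignFamily {ε : Fin d → SignType | ∀ i : Fin d, ε i ≠ 0 ↔ (i : ℕ) < k} k where
  nonempty := ⟨fun i => if (i : ℕ) < k then 1 else 0, fun i => by simp⟩
  ne_zero_iff _ hε := hε
  le := h

namespace IsSignFamily

variable {E : Set (Fin d → SignType)} {k : ℕ}

theorem card_signSupp (hE : IsSignFamily E k) {ε : Fin d → SignType} (hε : ε ∈ E) :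
    (signSupp ε).card = k := by
  have : signSupp ε = Finset.univ.filter fun i : Fin d => (i : ℕ) < k := by
    ext i
    rw [mem_signSupp, hE.ne_zero_iff ε hε]
    simp
  rw [this, Fin.card_filter_val_lt, min_eq_right hE.le]

theorem isLattice (S : Pattern d) (hS : S ∈ globalTransversal (orthant '' E)) : IsLattice S := by
  obtain ⟨ε, _, τ, n, _, rfl⟩ := mem_globalTransversal_orthant.1 hS
  exact isLattice_cut _ _

theorem finite_family (E : Set (Fin d → SignType)) : (orthant '' E).Finite := E.toFinite.image _

theorem uniformlySeparated (E : Set (Fin d → SignType)) (L : Pattern d) (hL : L ∈ orthant '' E) :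
    UniformlySeparated {L} := by
  obtain ⟨ε, _, rfl⟩ := hL
  refine uniformlySeparated_of_isLattice fun S hS => ?_
  rw [mem_singleton_iff.1 hS, orthant_eq_cut]
  exact isLattice_cut _ _

theorem isUnitSpace (E : Set (Fin d → SignType)) :
    IsUnitSpace (globalTransversal (orthant '' E)) :=
  isUnitSpace_globalTransversal (finite_family E) (uniformlySeparated E)

theorem isClosed (E : Set (Fin d → SignType)) : IsClosed (globalTransversal (orthant '' E)) :=
  isClosed_globalTransversal (finite_family E)

theorem codim_le (hE : IsSignFamily E k) {S : Pattern d}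
    (hS : S ∈ globalTransversal (orthant '' E)) : codim S ≤ k := by
  obtain ⟨ε, hε, τ, n, hτ, rfl⟩ := mem_globalTransversal_orthant.1 hS
  rw [codim_cut, ← hE.card_signSupp hε]
  refine Finset.card_le_card fun i hi => ?_
  rw [mem_signSupp] at hi ⊢
  exact (hτ i).resolve_left hi ▸ hi

theorem exists_codim_eq (hE : IsSignFamily E k) {r : ℕ} (hr : r ≤ k) :
    ∃ S ∈ globalTransversal (orthant '' E), codim S = r := by
  obtain ⟨ε, hε⟩ := hE.nonempty
  obtain ⟨t, ht, rfl⟩ := Finset.exists_subset_card_eq (hr.trans_eq (hE.card_signSupp hε).symm)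
  refine ⟨cut (fun i => if i ∈ t then ε i else 0) 0, mem_globalTransversal_orthant.2
    ⟨ε, hε, _, _, fun i => ?_, rfl⟩, ?_⟩
  · split_ifs <;> simp
  · rw [codim_cut]
    congr 1
    ext i
    rw [mem_signSupp]
    split_ifs with h
    · simpa [h] using mem_signSupp.1 (ht h)
    · simp [h]

/-- Within the transversal a direction is cut exactly if some lattice point on its axis is absent.
This is an open condition, so being cut in more than `r` directions is open too. -/
theorem isClosed_codim_le (E : Set (Fin d → SignType)) (r : ℕ) :
    IsClosed {S | S ∈ globalTransversal (orthant '' E) ∧ codim S ≤ r} := by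
  have : {S | S ∈ globalTransversal (orthant '' E) ∧ codim S ≤ r} =
      globalTransversal (orthant '' E) ∩ (⋃ t : {t : Finset (Fin d) // r < t.card},
        ⋂ i ∈ t.1, ⋃ m : ℤ, {S : Pattern d | emb (Pi.single i m) ∉ S})ᶜ := by
    ext S
    refine and_congr_right fun hS => ?_
    obtain ⟨ε, hε, τ, n, hτ, rfl⟩ := mem_globalTransversal_orthant.1 hS
    have hsupp : ∀ i, (∃ m : ℤ, emb (Pi.single i m) ∉ cut τ n) ↔ i ∈ signSupp τ := by
      intro i
      rw [mem_signSupp]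
      constructor
      · rintro ⟨m, hm⟩ h0
        refine hm (emb_mem_cut.2 fun j => ?_)
        by_cases hj : j = i
        · subst hj
          simp [h0]
        · simp [hj]
      · intro h
        refine ⟨-(τ i) * (n i + 1), fun h' => ?_⟩
        have := emb_mem_cut.1 h' i
        cases hi : τ i <;> simp [hi] at this h
    rw [codim_cut]
    simp only [mem_compl_iff, mem_iUnion, mem_iInter, mem_ofPred_eq, hsupp, not_exists]
    constructor
    · intro h t ht
      exact absurd (Finset.card_le_card (show t.1 ⊆ signSupp τ from ht)) (by have := t.2; omega)
    · intro h
      by_contra hcon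
      exact h ⟨signSupp τ, by omega⟩ fun i hi => hi
  rw [this]
  refine (isClosed E).inter (isOpen_iUnion fun t => ?_).isClosed_compl
  exact isOpen_biInter_finset fun i _ => isOpen_iUnion fun m => Pattern.isOpen_notMem _

theorem cut_zero (n : Fin d → ℕ) : cut 0 n = bulk d := by
  rw [bulk_eq_cut, ← cut_shift (0 : Fin d → SignType) (n := 0) (n' := n) (m := 0) (by simp), emb_zero,
    Pattern.shift_zero]

theorem isFiltration (hE : IsSignFamily E k) :
    IsFiltration (globalTransversal (orthant '' E)) (codimFiltration (orthant '' E) k) where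
  monotone r s hrs S hS := ⟨hS.1, hS.2.trans (by exact_mod_cast hrs)⟩
  zero := by
    ext S
    rw [mem_singleton_iff]
    constructor
    · rintro ⟨hS, h0⟩
      obtain ⟨ε, hε, τ, n, hτ, rfl⟩ := mem_globalTransversal_orthant.1 hS
      rw [codim_cut, Fin.val_zero, Nat.le_zero, Finset.card_eq_zero] at h0
      have : τ = 0 := by
        funext i
        by_contra h
        have := mem_signSupp.2 h
        rw [h0] at this
        simp at this
      rw [this, cut_zero]
    · rintro rfl
      obtain ⟨ε, hε⟩ := hE.nonempty
      refine ⟨mem_globalTransversal_orthant.2 ⟨ε, hε, 0, 0, fun i => Or.inl rfl, bulk_eq_cut⟩, ?_⟩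
      rw [bulk_eq_cut, codim_cut]
      simp [signSupp]
  last := by
    ext S
    exact ⟨fun h => h.1, fun h => ⟨h, hE.codim_le h⟩⟩
  isClosed r := isClosed_codim_le E r
  invariant r S hS x hx := ⟨(isUnitSpace E).invariant S hS.1 x hx, (codim_shift S x).trans_le hS.2⟩

theorem strictMono (hE : IsSignFamily E k) : StrictMono (codimFiltration (orthant '' E) k) := by
  intro r s hrs
  refine ssubset_iff_subset_not_subset.2 ⟨hE.isFiltration.monotone hrs.le, fun h => ?_⟩
  obtain ⟨S, hS, hcodim⟩ := hE.exists_codim_eq (Nat.lt_succ_iff.1 s.2)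
  have := (h ⟨hS, hcodim.le⟩).2
  rw [hcodim] at this
  exact absurd hrs (not_lt.2 (by exact_mod_cast this))

theorem map_mem {σ : Space d ≃ₗᵢ[ℝ] Space d} {𝓛 : Set (Pattern d)} (hσ : σ ∈ pointGroup 𝓛 k)
    {S : Pattern d} (hS : S ∈ globalTransversal 𝓛) : S.map σ ∈ globalTransversal 𝓛 := by
  obtain ⟨L, hL, hSL⟩ := mem_iUnion₂.1 hS
  exact mem_iUnion₂.2 ⟨L.map σ, hσ.2 ▸ mem_image_of_mem _ hL, map_mem_transversal σ hSL⟩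

theorem pointInvariant_codimFiltration {𝓛 : Set (Pattern d)}
    {G : Subgroup (Space d ≃ₗᵢ[ℝ] Space d)} (hG : G ≤ pointGroup 𝓛 k) (r : Fin (k + 1)) :
    PointInvariant G (codimFiltration 𝓛 k r) :=
  fun σ hσ S hS => ⟨map_mem (hG hσ) hS.1, (codim_map σ S).trans_le hS.2⟩

theorem finite_lattice_unitBall : {x : Space d | (∃ m, emb m = x) ∧ ‖x‖ ≤ 1}.Finite := by
  refine ((Set.finite_Icc (-1 : Fin d → ℤ) 1).image emb).subset ?_
  rintro _ ⟨⟨m, rfl⟩, h⟩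
  have h' : ∀ i, |m i| ≤ 1 := fun i => by
    have := (PiLp.norm_apply_le (emb m) i).trans h
    rw [emb_apply, Real.norm_eq_abs] at this
    exact_mod_cast this
  exact ⟨m, ⟨fun i => (abs_le.1 (h' i)).1, fun i => (abs_le.1 (h' i)).2⟩, rfl⟩

/-- Each unit vector or its negative lies in an orthant of the family, so it is mapped to a lattice
point of norm one. There are finitely many of these, and the images of the unit vectors determine
the isometry. -/
theorem finite_pointGroup (hE : IsSignFamily E k) : Finite (pointGroup (orthant '' E) k) := by
  have hmem : ∀ σ ∈ pointGroup (orthant '' E) k, ∀ i : Fin d,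
      σ (unitVec i) ∈ {x : Space d | (∃ m, emb m = x) ∧ ‖x‖ ≤ 1} := by
    intro σ hσ i
    refine ⟨?_, by rw [σ.norm_map]; simp [unitVec]⟩
    obtain ⟨ε, hε⟩ := hE.nonempty
    have hL : IsLattice ((orthant ε).map σ) := by
      have : (orthant ε).map σ ∈ orthant '' E := hσ.2 ▸ mem_image_of_mem _ (mem_image_of_mem _ hε)
      obtain ⟨ε', _, h⟩ := this
      rw [← h, orthant_eq_cut]
      exact isLattice_cut _ _
    have key : ∀ s : ℤ, (0 : ℤ) ≤ ε i * s → ∃ m, emb m = σ (emb (Pi.single i s)) := by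
      intro s hs
      refine hL _ ?_
      rw [Pattern.mem_map, σ.symm_apply_apply, orthant_eq_cut, emb_mem_cut]
      intro j
      by_cases hj : j = i
      · subst hj
        simpa using hs
      · simp [hj]
    by_cases h : (0 : ℤ) ≤ ε i
    · rw [← emb_single]
      exact key 1 (by simpa using h)
    · obtain ⟨m, hm⟩ := key (-1) (by simp; omega)
      refine ⟨-m, ?_⟩
      have h1 : emb (-m) = -emb m := by ext; simp
      have h2 : emb (Pi.single i (-1)) = -unitVec i := by
        rw [← emb_single]; ext j
        by_cases hj : j = i
        · subst hj; simp
        · simp [hj]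
      rw [h1, hm, h2, map_neg, neg_neg]
  have := (finite_lattice_unitBall (d := d)).to_subtype
  refine Finite.of_injective (fun (σ : pointGroup (orthant '' E) k) (i : Fin d) =>
    (⟨σ.1 (unitVec i), hmem σ.1 σ.2 i⟩ : {x : Space d | (∃ m, emb m = x) ∧ ‖x‖ ≤ 1})) ?_
  intro σ τ h
  refine Subtype.ext (LinearIsometryEquiv.ext fun x => ?_)
  rw [← sum_smul_unitVec x, map_sum, map_sum]
  refine Finset.sum_congr rfl fun i _ => ?_
  have hi : σ.1 (unitVec i) = τ.1 (unitVec i) := congrArg Subtype.val (congrFun h i)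
  rw [map_smul, map_smul, hi]

/-! ### Localization to the boundaries -/

theorem nonempty_boundarySites_iff {S : Pattern d} (hS : S ∈ globalTransversal (orthant '' E))
    {r : ℕ} : (boundarySites r S).Nonempty ↔ r ≤ codim S := by
  obtain ⟨ε, hε, τ, n, hτ, rfl⟩ := mem_globalTransversal_orthant.1 hS
  rw [nonempty_boundarySites_cut, codim_cut]

theorem ext_eq_zero_of_localizedAt {Y : Set (Pattern d)}
    (hY : Y ⊆ globalTransversal (orthant '' E)) {r : ℕ} {f : Cc Y} (hf : LocalizedAt r f)
    {γ : Space d × Pattern d} (hγ : codim γ.2 < r) : ext f γ = 0 := by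
  obtain ⟨R, hR⟩ := hf
  by_contra h0
  by_cases hmem : γ ∈ arrows Y
  · obtain ⟨y, hy, _⟩ := hR ⟨γ, hmem⟩ (by rwa [ext_apply f ⟨γ, hmem⟩] at h0)
    exact absurd ((nonempty_boundarySites_iff (hY hmem.1)).1 ⟨y, hy⟩) (by simpa using hγ)
  · exact h0 (ext_of_notMem f hmem)

/-- Each pattern over which `f` is supported has a boundary site that nearby patterns share;
compactness of the support makes the distance to such sites uniform. -/
theorem localizedAt_of_isCc {Y W : Set (Pattern d)}
    (hY : Y ⊆ globalTransversal (orthant '' E)) {r : ℕ} (hWY : W ⊆ Y) (hW : ∀ S ∈ W, r ≤ codim S)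
    {f : Cc Y} (hf : IsCc W (ext f)) : LocalizedAt r f := by
  obtain ⟨C, hCW, hC, hfC⟩ := hf.2
  have hK : IsCompact (Prod.snd '' C) := hC.image continuous_snd
  obtain ⟨R, hR⟩ : ∃ R : ℝ, ∀ S ∈ Prod.snd '' C, S ∈ Y → ∃ y ∈ boundarySites r S, ‖y‖ ≤ R := by
    refine hK.induction_on (p := fun s => ∃ R : ℝ, ∀ S ∈ s, S ∈ Y →
      ∃ y ∈ boundarySites r S, ‖y‖ ≤ R) ⟨0, by simp⟩ ?_ ?_ ?_
    · rintro s t hst ⟨R, hR⟩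
      exact ⟨R, fun S hS => hR S (hst hS)⟩
    · rintro s t ⟨R, hR⟩ ⟨R', hR'⟩
      refine ⟨max R R', fun S hS hSY => ?_⟩
      rcases hS with hS | hS
      · obtain ⟨y, hy, h⟩ := hR S hS hSY
        exact ⟨y, hy, h.trans (le_max_left _ _)⟩
      · obtain ⟨y, hy, h⟩ := hR' S hS hSY
        exact ⟨y, hy, h.trans (le_max_right _ _)⟩
    · intro S hS
      obtain ⟨γ, hγ, rfl⟩ := hS
      have hSY := hY (hWY (hCW hγ).1)
      obtain ⟨y, hy⟩ := (nonempty_boundarySites_iff hSY).2 (hW _ (hCW hγ).1)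
      refine ⟨_, mem_nhdsWithin_of_mem_nhds (eventually_boundarySites (isLattice _ hSY) hy), ‖y‖,
        fun T hT hTY => ⟨y, hT (isLattice _ (hY hTY)), le_rfl⟩⟩
  refine ⟨R, fun γ hγ => hR _ ⟨γ.1, ?_, rfl⟩ γ.2.1⟩
  by_contra h
  have h0 := hfC γ.1 h
  rw [ext_apply] at h0
  exact hγ h0

end IsSignFamily

end Crystal

end

/-! ### Signed permutations and their action on sign vectors -/

noncomputable section

namespace Crystal

open Filter

variable {d : ℕ}

/-! ### Signed permutations of the coordinates -/

/-- The reflection that changes the sign of the `i`-th coordinate. -/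
def signFlip (i : Fin d) : Space d ≃ₗᵢ[ℝ] Space d := (Submodule.span ℝ {unitVec i})ᗮ.reflection

/-- The reflection that exchanges two coordinates, for `i ≠ j`. -/
def coordSwap (i j : Fin d) : Space d ≃ₗᵢ[ℝ] Space d :=
  (Submodule.span ℝ {unitVec i - unitVec j})ᗮ.reflection

theorem det_reflection_span_singleton {v : Space d} (hv : v ≠ 0) :
    LinearMap.det ((Submodule.span ℝ {v})ᗮ.reflection.toLinearEquiv : Space d →ₗ[ℝ] Space d) =
      -1 := by
  have h := (Submodule.span ℝ {v})ᗮ.det_reflection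
  rw [Submodule.orthogonal_orthogonal, finrank_span_singleton hv, pow_one] at h
  exact h

theorem unitVec_ne_zero (i : Fin d) : (unitVec i : Space d) ≠ 0 := by
  intro h
  have := congrArg (fun x : Space d => x i) h
  simp [unitVec] at this

theorem unitVec_sub_ne_zero {i j : Fin d} (hij : i ≠ j) :
    (unitVec i - unitVec j : Space d) ≠ 0 := by
  intro h
  have := congrArg (fun x : Space d => x i) h
  simp [unitVec, hij] at this

/-- A product of two reflections; it is the rotation by a right angle in the plane of the
coordinates `i` and `j`, the element available in the rotation group of the box. -/
theorem det_signFlip_mul_coordSwap {i j : Fin d} (hij : i ≠ j) :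
    LinearMap.det ((signFlip i * coordSwap i j).toLinearEquiv : Space d →ₗ[ℝ] Space d) = 1 := by
  have h : ((signFlip i * coordSwap i j).toLinearEquiv : Space d →ₗ[ℝ] Space d) =
      ((signFlip i).toLinearEquiv : Space d →ₗ[ℝ] Space d) ∘ₗ
        ((coordSwap i j).toLinearEquiv : Space d →ₗ[ℝ] Space d) := rfl
  rw [h, LinearMap.det_comp, signFlip, coordSwap, det_reflection_span_singleton (unitVec_ne_zero i),
    det_reflection_span_singleton (unitVec_sub_ne_zero hij)]
  norm_num

theorem signFlip_apply (i : Fin d) (x : Space d) (l : Fin d) :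
    signFlip i x l = if l = i then -x l else x l := by
  rw [signFlip, Submodule.reflection_orthogonal_apply, Submodule.reflection_singleton_apply]
  by_cases h : l = i
  · subst h
    simp [unitVec, EuclideanSpace.inner_single_left]
    ring
  · simp [unitVec, EuclideanSpace.inner_single_left, h]

theorem coordSwap_apply {i j : Fin d} (hij : i ≠ j) (x : Space d) (l : Fin d) :
    coordSwap i j x l = x (Equiv.swap i j l) := by
  have hn : ‖(unitVec i - unitVec j : Space d)‖ ^ 2 = 2 := by
    rw [← real_inner_self_eq_norm_sq, inner_sub_left]
    simp [unitVec, EuclideanSpace.inner_single_left, hij, hij.symm]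
    norm_num
  rw [coordSwap, Submodule.reflection_orthogonal_apply, Submodule.reflection_singleton_apply]
  simp only [RCLike.ofReal_real_eq_id, id, hn]
  by_cases h : l = i
  · subst h
    simp [unitVec, inner_sub_left, EuclideanSpace.inner_single_left, hij]
    ring
  · by_cases h' : l = j
    · subst h'
      simp [unitVec, inner_sub_left, EuclideanSpace.inner_single_left, h]
      ring
    · simp [unitVec, h, h', Equiv.swap_apply_of_ne_of_ne h h']

theorem signFlip_symm (i : Fin d) : (signFlip i).symm = signFlip i := Submodule.reflection_symm

theorem coordSwap_symm (i j : Fin d) : (coordSwap i j).symm = coordSwap i j :=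
  Submodule.reflection_symm

/-- Change of a sign at one place. -/
def negAt (i : Fin d) (τ : Fin d → SignType) : Fin d → SignType :=
  fun l => if l = i then -τ l else τ l

theorem map_signFlip_cut (i : Fin d) (τ : Fin d → SignType) (n : Fin d → ℕ) :
    (cut τ n).map (signFlip i) = cut (negAt i τ) n := by
  refine SetLike.ext fun x => ?_
  rw [Pattern.mem_map, signFlip_symm]
  refine forall_congr' fun l => ?_
  rw [signFlip_apply, negAt]
  split_ifs with h
  · refine and_congr ⟨?_, ?_⟩ ?_
    · rintro ⟨m, hm⟩
      exact ⟨-m, by simp [hm]⟩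
    · rintro ⟨m, hm⟩
      exact ⟨-m, by simp [hm]⟩
    · cases τ l <;> simp
  · rfl

theorem map_coordSwap_cut {i j : Fin d} (hij : i ≠ j) (τ : Fin d → SignType) (n : Fin d → ℕ) :
    (cut τ n).map (coordSwap i j) = cut (τ ∘ Equiv.swap i j) (n ∘ Equiv.swap i j) := by
  refine SetLike.ext fun x => ?_
  rw [Pattern.mem_map, coordSwap_symm]
  refine (Equiv.swap i j).forall_congr fun {l} => ?_
  rw [coordSwap_apply hij]
  simp

theorem signFlip_mem_pointGroup {E : Set (Fin d → SignType)} {k : ℕ} {i : Fin d} (hi : (i : ℕ) < k)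
    (hE : ∀ ε ∈ E, negAt i ε ∈ E) : signFlip i ∈ pointGroup (orthant '' E) k := by
  refine ⟨fun l hl => ?_, Subset.antisymm ?_ fun L hL => ?_⟩
  · have hli : i ≠ l := fun h => absurd hi (by rw [h]; omega)
    ext m
    rw [signFlip_apply]
    split_ifs with h
    · subst h; simp [unitVec, hli]
    · rfl
  all_goals
    have hmaps : ∀ L ∈ orthant '' E, L.map (signFlip i) ∈ orthant '' E := by
      rintro _ ⟨ε, hε, rfl⟩
      exact ⟨_, hE ε hε, by rw [orthant_eq_cut, orthant_eq_cut, map_signFlip_cut]⟩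
  · rintro _ ⟨L, hL, rfl⟩
    exact hmaps L hL
  · refine ⟨_, hmaps L hL, ?_⟩
    rw [← Pattern.map_mul, signFlip, Submodule.reflection_mul_reflection, Pattern.map_one]

theorem coordSwap_mem_pointGroup {E : Set (Fin d → SignType)} {k : ℕ} {i j : Fin d} (hij : i ≠ j)
    (hi : (i : ℕ) < k) (hj : (j : ℕ) < k) (hE : ∀ ε ∈ E, ε ∘ Equiv.swap i j ∈ E) :
    coordSwap i j ∈ pointGroup (orthant '' E) k := by
  refine ⟨fun l hl => ?_, Subset.antisymm ?_ fun L hL => ?_⟩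
  · have hli : i ≠ l := fun h => absurd hi (by rw [h]; omega)
    have hlj : j ≠ l := fun h => absurd hj (by rw [h]; omega)
    ext m
    rw [coordSwap_apply hij]
    by_cases hm : m = l
    · subst hm
      rw [Equiv.swap_apply_of_ne_of_ne hli.symm hlj.symm]
    · have : Equiv.swap i j m ≠ l := by
        intro h
        rw [Equiv.swap_apply_eq_iff, Equiv.swap_apply_of_ne_of_ne hli.symm hlj.symm] at h
        exact hm h
      simp [unitVec, hm, this]
  all_goals
    have hmaps : ∀ L ∈ orthant '' E, L.map (coordSwap i j) ∈ orthant '' E := by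
      rintro _ ⟨ε, hε, rfl⟩
      exact ⟨_, hE ε hε, by rw [orthant_eq_cut, orthant_eq_cut, map_coordSwap_cut hij]; rfl⟩
  · rintro _ ⟨L, hL, rfl⟩
    exact hmaps L hL
  · refine ⟨_, hmaps L hL, ?_⟩
    rw [← Pattern.map_mul, coordSwap, Submodule.reflection_mul_reflection, Pattern.map_one]

/-! ### Sets of sign vectors closed under moves -/

/-- Exchange argument: while `t` is not contained in the support, the cardinalities provide an
element of the support outside `t` to trade for a missing one, and the number of missing elements
drops. -/
theorem exists_subset_signSupp {A : Set (Fin d → SignType)} {k : ℕ}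
    (hA : ∀ τ ∈ A, ∀ i, τ i ≠ 0 → (i : ℕ) < k)
    (hmove : ∀ τ ∈ A, ∀ i j : Fin d, (i : ℕ) < k → (j : ℕ) < k → τ i ≠ 0 → τ j = 0 →
      ∃ τ₁ ∈ A, signSupp τ₁ = insert j ((signSupp τ).erase i))
    {t : Finset (Fin d)} (ht : ∀ j ∈ t, (j : ℕ) < k) {τ : Fin d → SignType} (hτ : τ ∈ A)
    (hcard : t.card ≤ (signSupp τ).card) : ∃ τ₁ ∈ A, t ⊆ signSupp τ₁ := by
  induction h : (t \ signSupp τ).card generalizing τ with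
  | zero => exact ⟨τ, hτ, by rwa [Finset.card_eq_zero, Finset.sdiff_eq_empty_iff_subset] at h⟩
  | succ N ih =>
    have h1 := Finset.card_sdiff_add_card_inter t (signSupp τ)
    have h2 := Finset.card_sdiff_add_card_inter (signSupp τ) t
    rw [Finset.inter_comm] at h2
    obtain ⟨j, hj⟩ : (t \ signSupp τ).Nonempty := Finset.card_pos.1 (by omega)
    obtain ⟨i, hi⟩ : (signSupp τ \ t).Nonempty := Finset.card_pos.1 (by omega)
    rw [Finset.mem_sdiff] at hi hj
    have hi' := mem_signSupp.1 hi.1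
    have hj' : τ j = 0 := by simpa using hj.2
    obtain ⟨τ₁, hτ₁, hs⟩ := hmove τ hτ i j (hA τ hτ i hi') (ht j hj.1) hi' hj'
    refine ih hτ₁ ?_ ?_
    · rw [hs, Finset.card_insert_of_notMem (by simp [hj']), Finset.card_erase_of_mem hi.1]
      omega
    · have : t \ signSupp τ₁ = (t \ signSupp τ).erase j := by
        rw [hs]
        ext l
        simp only [Finset.mem_sdiff, Finset.mem_insert, Finset.mem_erase, not_or, not_and_or,
          not_not]
        constructor
        · rintro ⟨h1, h2, rfl | h3⟩
          · exact absurd h1 hi.2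
          · exact ⟨h2, h1, h3⟩
        · rintro ⟨h1, h2, h3⟩
          exact ⟨h2, h1, Or.inr h3⟩
      rw [this, Finset.card_erase_of_mem (Finset.mem_sdiff.2 hj)]
      omega

theorem mem_of_negAt_mem {A : Set (Fin d → SignType)}
    (hA : ∀ τ ∈ A, ∀ i, τ i ≠ 0 → negAt i τ ∈ A) {τ τ' : Fin d → SignType} (hτ : τ ∈ A)
    (h : signSupp τ = signSupp τ') : τ' ∈ A := by
  have hflip : ∀ t : Finset (Fin d), (fun i => if i ∈ t then -τ i else τ i) ∈ A := by
    intro t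
    induction t using Finset.induction_on with
    | empty => simpa using hτ
    | insert a t ha ih =>
      by_cases h0 : τ a = 0
      · convert ih using 2 with i
        by_cases hi : i = a
        · subst hi; simp [h0]
        · simp [hi]
      · convert hA _ ih a (by simpa [ha] using h0) using 2 with i
        by_cases hi : i = a
        · subst hi; simp [negAt, ha]
        · simp [negAt, hi]
  -- Equal supports leave only signs to adjust, namely at the places where `τ` and `τ'` differ.
  convert hflip (Finset.univ.filter fun i => τ i ≠ τ' i) using 2 with i
  have hi : τ i ≠ 0 ↔ τ' i ≠ 0 := by rw [← mem_signSupp, h, mem_signSupp]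
  simp only [Finset.mem_filter_univ]
  revert hi
  cases τ i <;> cases τ' i <;> decide

/-- Rotations by a right angle in the coordinate planes generate all changes of signs. -/
theorem negAt_mem_of_rotation {A : Set (Fin d → SignType)} {k : ℕ}
    (hrot : ∀ τ ∈ A, ∀ i j : Fin d, (i : ℕ) < k → (j : ℕ) < k → i ≠ j →
      negAt i (τ ∘ Equiv.swap i j) ∈ A) {τ : Fin d → SignType} (hτ : τ ∈ A) {i j : Fin d}
    (hi : (i : ℕ) < k) (hj : (j : ℕ) < k) (hij : i ≠ j) : negAt i τ ∈ A := by
  have h1 := hrot τ hτ i j hi hj hij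
  have h2 := hrot _ h1 i j hi hj hij
  have h3 := hrot τ hτ j i hj hi hij.symm
  have key : ∀ τ' : Fin d → SignType, τ' ∈ A → τ' i = -τ i → τ' j = τ j →
      (∀ l, l ≠ i → l ≠ j → τ' l = τ l) → negAt i τ ∈ A := by
    intro τ' hτ' hi hj hl
    convert hτ' using 1
    funext l
    rw [negAt]
    split_ifs with h
    · rw [h, hi]
    · by_cases h' : l = j
      · rw [h', hj]
      · rw [hl l h h']
  have hl : ∀ l, l ≠ i → l ≠ j → Equiv.swap i j l = l := fun l => Equiv.swap_apply_of_ne_of_ne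
  have hl' : ∀ l, l ≠ i → l ≠ j → Equiv.swap j i l = l := fun l h h' =>
    Equiv.swap_apply_of_ne_of_ne h' h
  by_cases hz : τ j = 0
  · refine key _ h2 ?_ ?_ fun l h h' => ?_
    · simp [negAt, hij.symm]
    · simp [negAt, hij.symm, hz]
    · simp [negAt, h, hl l h h']
  by_cases heq : τ i = τ j
  · refine key _ h1 ?_ ?_ fun l h h' => ?_
    · simp [negAt, heq]
    · simp [negAt, hij.symm, heq]
    · simp [negAt, h, hl l h h']
  by_cases hz' : τ i = 0
  · refine key _ hτ (by simp [hz']) rfl fun _ _ _ => rfl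
  have hopp : τ i = -τ j := by
    revert hz hz' heq
    cases τ i <;> cases τ j <;> decide
  -- For opposite signs the rotation in the other direction, giving `(τ j, -τ i)`, does the same.
  refine key _ h3 ?_ ?_ fun l h h' => ?_
  · simp [negAt, hij, hopp]
  · simp [negAt, hopp]
  · simp [negAt, h', hl' l h h']

end Crystal

end

/-! ### Uniqueness of the filtration, by symmetry and by localization -/

noncomputable section

namespace Crystal

open Filter

variable {d : ℕ}

/-! ### Uniqueness of the filtration -/

theorem signs_eq_of_cut_eq {τ τ' : Fin d → SignType} {n n' : Fin d → ℕ}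
    (h : cut τ n = cut τ' n') : τ = τ' := by
  funext i
  have key : ∀ m : ℤ, -(n i : ℤ) ≤ τ i * m ↔ -(n' i : ℤ) ≤ τ' i * m := fun m => by
    rw [← emb_single_mem_cut, h, emb_single_mem_cut]
  have h1 := key (n i + n' i + 1)
  have h2 := key (-(n i + n' i + 1))
  revert h1 h2
  cases τ i <;> cases τ' i <;> simp <;> omega

/-- The set contains with a pattern all patterns in `Ξ` of no larger codimension. -/
def CodimClosed (Ξ F : Set (Pattern d)) : Prop :=
  ∀ S ∈ F, ∀ S' ∈ Ξ, codim S' ≤ codim S → S' ∈ F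

namespace IsSignFamily

variable {E : Set (Fin d → SignType)} {k : ℕ}

theorem cut_mem_iff {τ : Fin d → SignType} {n : Fin d → ℕ} :
    cut τ n ∈ globalTransversal (orthant '' E) ↔ ∃ ε ∈ E, ∀ i, τ i = 0 ∨ τ i = ε i := by
  rw [mem_globalTransversal_orthant]
  constructor
  · rintro ⟨ε, hε, τ', n', h, heq⟩
    exact ⟨ε, hε, signs_eq_of_cut_eq heq ▸ h⟩
  · rintro ⟨ε, hε, h⟩
    exact ⟨ε, hε, τ, n, h, rfl⟩

theorem lt_of_cut_mem (hE : IsSignFamily E k) {τ : Fin d → SignType} {n : Fin d → ℕ}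
    (h : cut τ n ∈ globalTransversal (orthant '' E)) {i : Fin d} (hi : τ i ≠ 0) : (i : ℕ) < k := by
  obtain ⟨ε, hε, hτ⟩ := cut_mem_iff.1 h
  exact (hE.ne_zero_iff ε hε i).1 ((hτ i).resolve_left hi ▸ hi)

/-- Since wall distances are irrelevant, `F` is encoded by its sign vectors. Moves enlarge or shift
the support to cover that of the target, receding walls erase the surplus directions, `hsame`
corrects the signs and a translation restores the distances. -/
theorem codimClosed (hE : IsSignFamily E k) {F : Set (Pattern d)}
    (hFΞ : F ⊆ globalTransversal (orthant '' E)) (hcl : IsClosed F) (hinv : GroupoidInvariant F)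
    (hmove : ∀ τ, cut τ 0 ∈ F → ∀ i j : Fin d, (i : ℕ) < k → (j : ℕ) < k → τ i ≠ 0 → τ j = 0 →
      ∃ τ₁, cut τ₁ 0 ∈ F ∧ signSupp τ₁ = insert j ((signSupp τ).erase i))
    (hsame : ∀ τ τ', cut τ 0 ∈ F → cut τ' 0 ∈ globalTransversal (orthant '' E) →
      signSupp τ = signSupp τ' → cut τ' 0 ∈ F) :
    CodimClosed (globalTransversal (orthant '' E)) F := by
  intro S hS S' hS' hle
  obtain ⟨ε, hε, τ, n, hτ, rfl⟩ := mem_globalTransversal_orthant.1 (hFΞ hS)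
  obtain ⟨ε', hε', τ', n', hτ', rfl⟩ := mem_globalTransversal_orthant.1 hS'
  rw [codim_cut, codim_cut] at hle
  obtain ⟨τ₁, hτ₁, hsub⟩ := exists_subset_signSupp (A := {τ | cut τ 0 ∈ F})
    (fun τ hτ i hi => hE.lt_of_cut_mem (hFΞ hτ) hi) hmove
    (fun j hj => hE.lt_of_cut_mem hS' (mem_signSupp.1 hj))
    (cut_mem_of_cut_mem hcl hinv hS (fun _ => Or.inr rfl) 0) hle
  have h2 : cut (fun i => if τ' i = 0 then 0 else τ₁ i) 0 ∈ F :=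
    cut_mem_of_cut_mem hcl hinv hτ₁ (fun i => by split_ifs <;> simp) 0
  refine cut_mem_of_cut_mem hcl hinv (hsame _ τ' h2 (cut_mem_iff.2 ⟨ε', hε', hτ'⟩) ?_)
    (fun _ => Or.inr rfl) n'
  ext i
  rw [mem_signSupp, mem_signSupp]
  by_cases h : τ' i = 0
  · simp [h]
  · simpa [h] using mem_signSupp.1 (hsub (mem_signSupp.2 h))

/-- A pattern gained in a strict step must have larger codimension than everything before it.
Counting steps upwards from the bulk gives codimension at least `r` in `F r`, counting downwards
from `Ξ` gives at most `r`, and `CodimClosed` fills in the rest. -/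
theorem eq_codimFiltration (hE : IsSignFamily E k) {F : Fin (k + 1) → Set (Pattern d)}
    (hF : IsFiltration (globalTransversal (orthant '' E)) F) (hmono : StrictMono F)
    (hC : ∀ r, CodimClosed (globalTransversal (orthant '' E)) (F r)) :
    F = codimFiltration (orthant '' E) k := by
  have step : ∀ (r : Fin k) (c : ℕ), (∃ S ∈ F r.castSucc, c ≤ codim S) →
      ∃ S ∈ F r.succ, c + 1 ≤ codim S := by
    rintro r c ⟨S, hS, hc⟩
    obtain ⟨S', hS', hn⟩ := exists_of_ssubset (hmono (Fin.castSucc_lt_succ (i := r)))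
    refine ⟨S', hS', ?_⟩
    by_contra hlt
    refine hn (hC _ S hS S' ?_ (by omega))
    rw [← hF.last]
    exact hF.monotone (Fin.le_last _) hS'
  have up : ∀ (r : Fin (k + 1)), ∃ S ∈ F r, (r : ℕ) ≤ codim S := by
    intro r
    induction r using Fin.induction with
    | zero => exact ⟨bulk d, by rw [hF.zero]; rfl, Nat.zero_le _⟩
    | succ r ih => exact step r r ih
  have bound : ∀ (r : Fin (k + 1)), ∀ S ∈ F r, codim S ≤ r := by
    intro r
    induction r using Fin.reverseInduction with
    | last =>
      intro S hS
      rw [hF.last] at hS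
      exact hE.codim_le hS
    | cast r ih =>
      intro S hS
      obtain ⟨S', hS', h⟩ := step r _ ⟨S, hS, le_rfl⟩
      have := ih S' hS'
      rw [Fin.val_succ] at this
      rw [Fin.val_castSucc]
      omega
  funext r
  refine Subset.antisymm (fun S hS => ⟨?_, bound r S hS⟩) fun S hS => ?_
  · rw [← hF.last]
    exact hF.monotone (Fin.le_last _) hS
  · obtain ⟨S', hS', h⟩ := up r
    exact hC r S' hS' S hS.1 (hS.2.trans h)

theorem eq_codimFiltration_of_le_one (hE : IsSignFamily E k) (hk : k ≤ 1)
    {F : Fin (k + 1) → Set (Pattern d)}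
    (hF : IsFiltration (globalTransversal (orthant '' E)) F) :
    F = codimFiltration (orthant '' E) k := by
  funext r
  have h : r = 0 ∨ r = Fin.last k := by
    rw [Fin.ext_iff, Fin.ext_iff, Fin.val_zero, Fin.val_last]
    omega
  rcases h with rfl | rfl
  · rw [hF.zero, hE.isFiltration.zero]
  · rw [hF.last, hE.isFiltration.last]

end IsSignFamily

theorem signSupp_swap {τ : Fin d → SignType} {i j : Fin d} (hi : τ i ≠ 0) (hj : τ j = 0) :
    signSupp (τ ∘ Equiv.swap i j) = insert j ((signSupp τ).erase i) := by
  have hij : i ≠ j := fun h => hi (h ▸ hj)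
  ext l
  simp only [mem_signSupp, Finset.mem_insert, Finset.mem_erase, Function.comp_apply]
  by_cases h : l = i
  · subst h
    simp [hj, hij]
  · by_cases h' : l = j
    · subst h'
      simp [hi]
    · simp [Equiv.swap_apply_of_ne_of_ne h h', h, h']

theorem signSupp_negAt (i : Fin d) (τ : Fin d → SignType) : signSupp (negAt i τ) = signSupp τ := by
  ext l
  rw [mem_signSupp, mem_signSupp, negAt]
  split_ifs
  · cases τ l <;> decide
  · rfl

/-- Coordinate exchanges supply the moves of the support; the signs need no correction because the
family contains a single orthant. -/
theorem codimClosed_corner {k : ℕ} (hk : k ≤ d) {F : Set (Pattern d)}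
    (hFΞ : F ⊆ globalTransversal (cornerFamily d k)) (hcl : IsClosed F) (hinv : GroupoidInvariant F)
    (hG : PointInvariant (pointGroup (cornerFamily d k) k) F) :
    CodimClosed (globalTransversal (cornerFamily d k)) F := by
  rw [cornerFamily_eq] at *
  have hE := isSignFamily_corner hk
  refine hE.codimClosed hFΞ hcl hinv (fun τ hτ i j hi hj hτi hτj => ?_)
    fun τ τ' hτ hτ' h => ?_
  · have hij : i ≠ j := fun h => hτi (h ▸ hτj)
    refine ⟨τ ∘ Equiv.swap i j, ?_, signSupp_swap hτi hτj⟩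
    have := hG _ (coordSwap_mem_pointGroup hij hi hj ?_) _ hτ
    · rwa [map_coordSwap_cut hij] at this
    · rintro _ rfl
      rw [mem_singleton_iff]
      funext l
      by_cases h : l = i
      · subst h; simp [hi, hj]
      · by_cases h' : l = j
        · subst h'; simp [hi, hj]
        · simp [Equiv.swap_apply_of_ne_of_ne h h']
  · obtain ⟨_, rfl, h1⟩ := IsSignFamily.cut_mem_iff.1 (hFΞ hτ)
    obtain ⟨_, rfl, h2⟩ := IsSignFamily.cut_mem_iff.1 hτ'
    convert hτ using 2
    funext i
    have hi : τ i ≠ 0 ↔ τ' i ≠ 0 := by rw [← mem_signSupp, h, mem_signSupp]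
    rcases h1 i with h1 | h1 <;> rcases h2 i with h2 | h2 <;> grind

/-- Only right-angle rotations are assumed available. They move the support, and with a second
coordinate at hand they also generate sign changes; this is where `2 ≤ k` enters. -/
theorem codimClosed_box {k : ℕ} (hk : k ≤ d) (hk2 : 2 ≤ k) {G : Subgroup (Space d ≃ₗᵢ[ℝ] Space d)}
    (hdet : ∀ σ ∈ pointGroup (boxFamily d k) k,
      LinearMap.det (σ.toLinearEquiv : Space d →ₗ[ℝ] Space d) = 1 → σ ∈ G)
    {F : Set (Pattern d)}
    (hFΞ : F ⊆ globalTransversal (boxFamily d k)) (hcl : IsClosed F) (hinv : GroupoidInvariant F)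
    (hG : PointInvariant G F) :
    CodimClosed (globalTransversal (boxFamily d k)) F := by
  rw [boxFamily_eq] at *
  have hE := isSignFamily_box hk
  have hrot : ∀ τ ∈ {τ | cut τ 0 ∈ F}, ∀ i j : Fin d, (i : ℕ) < k → (j : ℕ) < k → i ≠ j →
      negAt i (τ ∘ Equiv.swap i j) ∈ {τ | cut τ 0 ∈ F} := by
    intro τ hτ i j hi hj hij
    have := hG _ (hdet _ (mul_mem (signFlip_mem_pointGroup hi fun ε hε l => ?_)
      (coordSwap_mem_pointGroup hij hi hj fun ε hε l => ?_)) (det_signFlip_mul_coordSwap hij)) _ hτ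
    · rwa [Pattern.map_mul, map_coordSwap_cut hij, map_signFlip_cut] at this
    · rw [← hε l, ← mem_signSupp, signSupp_negAt, mem_signSupp]
    · rw [Function.comp_apply, hε]
      by_cases h : l = i
      · subst h; simp [hi, hj]
      · by_cases h' : l = j
        · subst h'; simp [hi, hj]
        · simp [Equiv.swap_apply_of_ne_of_ne h h']
  refine hE.codimClosed hFΞ hcl hinv (fun τ hτ i j hi hj hτi hτj => ?_)
    fun τ τ' hτ hτ' h => ?_
  · exact ⟨_, hrot τ hτ i j hi hj fun h => hτi (h ▸ hτj), by
      rw [signSupp_negAt, signSupp_swap hτi hτj]⟩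
  · refine mem_of_negAt_mem (A := {τ | cut τ 0 ∈ F}) (fun τ hτ i hi => ?_) hτ h
    have hik := hE.lt_of_cut_mem (hFΞ hτ) hi
    obtain ⟨j, hj, hij⟩ : ∃ j : Fin d, (j : ℕ) < k ∧ i ≠ j := by
      by_cases h0 : (i : ℕ) = 0
      · exact ⟨⟨1, by omega⟩, hk2, fun h => by simp [h] at h0⟩
      · exact ⟨⟨0, by omega⟩, by simpa using (by omega : 0 < k), fun h => by simp [h] at h0⟩
    exact negAt_mem_of_rotation hrot hτ hik hj hij

/-! ### Kernels and localization -/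

/-- A function on the units that is one at a unit and zero on a closed set of units. -/
theorem exists_peak {Y Z : Set (Pattern d)} (hY : IsUnitSpace Y) (hcl : IsClosed Y)
    (hZcl : IsClosed Z) {S : Pattern d} (hS : S ∈ Y) (hSZ : S ∉ Z) :
    ∃ f : Cc Y, IsCc (Y \ Z) (ext f) ∧ ext f (0, S) = 1 := by
  obtain ⟨χ, h1, _, hχ⟩ := exists_cutoff (isCompact_singleton (x := S)) hZcl
    (disjoint_singleton_left.2 hSZ)
  have h := (isCc_unitFun hY hcl).rmul_diff hχ
  refine ⟨mkCc _ (h.extend hZcl), by rwa [ext_mkCc], ?_⟩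
  rw [ext_mkCc]
  simp [rmul, unitFun, hS, h1 S rfl]

namespace IsSignFamily

variable {E : Set (Fin d → SignType)} {k : ℕ}

/-- The kernel is the closure of functions supported over codimension exactly `r + 1`, which are
localized by compactness. Conversely, patterns of codimension at most `r` have no boundary sites of
codimension `r + 1`, so localized functions restrict to zero. -/
theorem kernelLocalizedAt_codimFiltration (hE : IsSignFamily E k) (r : Fin k) :
    KernelLocalizedAt (codimFiltration (orthant '' E) k r.succ)
      (codimFiltration (orthant '' E) k r.castSucc) (r + 1) := by
  have hfil := hE.isFiltration
  have hsub : ∀ s, codimFiltration (orthant '' E) k s ⊆ globalTransversal (orthant '' E) :=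
    fun s S hS => hS.1
  have hU := fun s => (isUnitSpace E).subset (hsub s) (hfil.invariant s)
  have hle := hfil.monotone (Fin.castSucc_le_succ r)
  refine ⟨_, isRestriction_restrictCc (hU _) (hU _) (hfil.isClosed _) hle, ?_⟩
  refine Subset.antisymm ?_ (closure_minimal ?_ (isClosed_ker _))
  · rw [ker_restrict (hU _) (hfil.isClosed _) (hU _) (hfil.isClosed _) hle]
    refine closure_mono (image_mono fun f hf => ?_)
    refine localizedAt_of_isCc (hsub _) sdiff_subset (fun S hS => ?_) hf
    by_contra h
    exact hS.2 ⟨hS.1.1, by rw [Fin.val_castSucc]; omega⟩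
  · rintro _ ⟨f, hf, rfl⟩
    refine restrict_ι_eq_zero (hU _) (hU _) (hfil.isClosed _) hle fun γ hγ => ?_
    exact ext_eq_zero_of_localizedAt (hsub _) hf (Nat.lt_succ_of_le hγ.1.2)

/-- Descending induction from the common last term, testing both inclusions with a function that is
one at a single unit and vanishes over the other set. -/
theorem eq_codimFiltration_of_kernelLocalizedAt (hE : IsSignFamily E k)
    {F : Fin (k + 1) → Set (Pattern d)}
    (hF : IsFiltration (globalTransversal (orthant '' E)) F)
    (hker : ∀ r : Fin k, KernelLocalizedAt (F r.succ) (F r.castSucc) (r + 1)) :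
    F = codimFiltration (orthant '' E) k := by
  have hfil := hE.isFiltration
  have hsub : ∀ s, F s ⊆ globalTransversal (orthant '' E) := fun s => by
    rw [← hF.last]
    exact hF.monotone (Fin.le_last s)
  have hU := fun s => (isUnitSpace E).subset (hsub s) (hF.invariant s)
  funext r
  induction r using Fin.reverseInduction with
  | last => rw [hF.last, hfil.last]
  | cast r ih =>
    have hle := hF.monotone (Fin.castSucc_le_succ r)
    obtain ⟨p, hp, hpker⟩ := hker r
    rw [hp.unique (hU _) (hU _) (hF.isClosed _) hle] at hpker
    ext S
    constructor
    · intro hS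
      by_contra hSn
      -- If `S ∈ F r` had codimension above `r`, this peak would be localized, hence in the kernel,
      -- although its restriction has the value one at `S`.
      obtain ⟨f, hf, h1⟩ := exists_peak (hU r.succ) (hF.isClosed _) (hfil.isClosed r.castSucc)
        (hle hS) hSn
      have hloc : LocalizedAt (r + 1) f := by
        refine localizedAt_of_isCc (hsub _) sdiff_subset (fun T hT => ?_) hf
        by_contra h
        exact hT.2 ⟨hsub _ hT.1, by rw [Fin.val_castSucc]; omega⟩
      have h0 : ι f ∈ {a | (restrictCc (hU r.succ) (hU r.castSucc) (hF.isClosed _) hle).map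
          (hU _) (hU _) a = 0} := by
        rw [hpker]
        exact subset_closure ⟨f, hloc, rfl⟩
      rw [mem_ofPred_eq, CcHom.map_ι] at h0
      have h2 := norm_ext_zero_le (hU r.castSucc) (hF.isClosed _) hS
        ((restrictCc (hU r.succ) (hU r.castSucc) (hF.isClosed _) hle).toLin f)
      rw [h0, ext_restrictCc, restrictTo, if_pos hS, h1] at h2
      norm_num at h2
    · intro hS
      by_contra hSn
      have hSY : S ∈ F r.succ := by
        rw [ih]
        exact hfil.monotone (Fin.castSucc_le_succ r) hS
      -- If `S` of codimension at most `r` were not in `F r`, this peak would be in the kernel; but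
      -- localized functions vanish at `S`, so they stay at distance at least one.
      obtain ⟨f, hf, h1⟩ := exists_peak (hU r.succ) (hF.isClosed _) (hF.isClosed r.castSucc)
        hSY hSn
      have h0 : ι f ∈ closure (ι '' {g : Cc (F r.succ) | LocalizedAt (r + 1) g}) := by
        rw [← hpker]
        exact restrict_ι_eq_zero _ _ _ _ fun γ hγ => hf.eq_zero fun h => h.1.2 hγ.1
      obtain ⟨_, ⟨g, hg, rfl⟩, hdist⟩ := Metric.mem_closure_iff.1 h0 1 one_pos
      have hg0 : ext g (0, S) = 0 :=
        ext_eq_zero_of_localizedAt (hsub _) hg (Nat.lt_succ_of_le hS.2)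
      have h2 := norm_ext_zero_le (hU r.succ) (hF.isClosed _) hSY (f - g)
      rw [ext_sub, Pi.sub_apply, h1, hg0, ι_sub (hU _), sub_zero, norm_one] at h2
      rw [dist_eq_norm] at hdist
      exact absurd hdist (not_lt.2 h2)

end IsSignFamily

end Crystal

end

/-! ### Assembly of cofiltrations and crystals -/

open Crystal in
theorem proposition1p2 :
    -- every filtration of the transversal of a crystal by closed invariant sets supplies an
    -- equivariant cofiltration of the groupoid C*-algebra
    (∀ (d n : ℕ) (𝓛 : Set (Pattern d)) (G : Subgroup (Space d ≃ₗᵢ[ℝ] Space d))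
      (F : Fin (n + 1) → Set (Pattern d)),
      𝓛.Finite → (∀ L ∈ 𝓛, UniformlySeparated {L}) → Finite G →
      PointInvariant G (globalTransversal 𝓛) →
      Monotone F → F (Fin.last n) = globalTransversal 𝓛 →
      (∀ r, IsClosed (F r)) → (∀ r, GroupoidInvariant (F r)) → (∀ r, PointInvariant G (F r)) →
      HasEquivariantCofiltration G F) ∧
    -- the corner geometry with its point group, and the box geometry with any group between its
    -- rotation group and its full point group
    (∀ (d k : ℕ) (𝓛 : Set (Pattern d)) (G : Subgroup (Space d ≃ₗᵢ[ℝ] Space d)), k ≤ d →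
      ((𝓛 = cornerFamily d k ∧ G = pointGroup 𝓛 k) ∨
        (𝓛 = boxFamily d k ∧ G ≤ pointGroup 𝓛 k ∧
          ∀ σ ∈ pointGroup 𝓛 k,
            LinearMap.det (σ.toLinearEquiv : Space d →ₗ[ℝ] Space d) = 1 → σ ∈ G)) →
      𝓛.Finite ∧ (∀ L ∈ 𝓛, UniformlySeparated {L}) ∧ Finite G ∧
      PointInvariant G (globalTransversal 𝓛) ∧
      -- the filtration by codimension
      IsFiltration (globalTransversal 𝓛) (codimFiltration 𝓛 k) ∧
      StrictMono (codimFiltration 𝓛 k) ∧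
      (∀ r, PointInvariant G (codimFiltration 𝓛 k r)) ∧
      -- its uniqueness
      (∀ F : Fin (k + 1) → Set (Pattern d), IsFiltration (globalTransversal 𝓛) F → StrictMono F →
        (∀ r, PointInvariant G (F r)) → F = codimFiltration 𝓛 k) ∧
      -- its cofiltration
      HasEquivariantCofiltration G (codimFiltration 𝓛 k) ∧
      -- the kernels are the boundary algebras, and this determines the filtration
      (∀ F : Fin (k + 1) → Set (Pattern d), IsFiltration (globalTransversal 𝓛) F →
        ((∀ r : Fin k, KernelLocalizedAt (F r.succ) (F r.castSucc) (r + 1)) ↔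
          F = codimFiltration 𝓛 k))) := by
  refine ⟨fun d n 𝓛 G F hfin hsep _ _ hmono hlast hcl hinv hG => ?_, fun d k 𝓛 G hk hcase => ?_⟩
  · exact hasEquivariantCofiltration (isUnitSpace_globalTransversal hfin hsep) hmono
      (fun r => hlast ▸ hmono (Fin.le_last r)) hcl hinv hG
  have hfamily : ∃ E, IsSignFamily E k ∧ 𝓛 = orthant '' E := by
    rcases hcase with ⟨rfl, _⟩ | ⟨rfl, _⟩
    · exact ⟨_, isSignFamily_corner hk, cornerFamily_eq d k⟩
    · exact ⟨_, isSignFamily_box hk, boxFamily_eq d k⟩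
  have hG : G ≤ pointGroup 𝓛 k := by
    rcases hcase with ⟨_, rfl⟩ | ⟨_, h, _⟩
    · exact le_rfl
    · exact h
  have hunique : ∀ F : Fin (k + 1) → Set (Pattern d), IsFiltration (globalTransversal 𝓛) F →
      StrictMono F → (∀ r, PointInvariant G (F r)) → F = codimFiltration 𝓛 k := by
    intro F hF hmono hinv
    obtain ⟨E, hE, h𝓛⟩ := hfamily
    have hsub : ∀ r, F r ⊆ globalTransversal 𝓛 := fun r => by
      rw [← hF.last]
      exact hF.monotone (Fin.le_last r)
    -- For `k ≤ 1` every term of the filtration is an end term. This case is separate because the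
    -- rotation group of the box then need not relate opposite half-spaces.
    by_cases hk2 : 2 ≤ k
    · have hC : ∀ r, CodimClosed (globalTransversal 𝓛) (F r) := by
        intro r
        rcases hcase with ⟨rfl, rfl⟩ | ⟨rfl, _, hdet⟩
        · exact codimClosed_corner hk (hsub r) (hF.isClosed r) (hF.invariant r) (hinv r)
        · exact codimClosed_box hk hk2 hdet (hsub r) (hF.isClosed r) (hF.invariant r) (hinv r)
      rw [h𝓛] at hF hC ⊢
      exact hE.eq_codimFiltration hF hmono hC
    · rw [h𝓛] at hF ⊢
      exact hE.eq_codimFiltration_of_le_one (by omega) hF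
  obtain ⟨E, hE, rfl⟩ := hfamily
  have hfinite := hE.finite_pointGroup
  refine ⟨IsSignFamily.finite_family E, IsSignFamily.uniformlySeparated E,
    Finite.of_injective _ (Subgroup.inclusion_injective hG),
    fun σ hσ S hS => IsSignFamily.map_mem (hG hσ) hS, hE.isFiltration, hE.strictMono,
    IsSignFamily.pointInvariant_codimFiltration hG, hunique, ?_, fun F hF => ⟨?_, ?_⟩⟩
  · exact hasEquivariantCofiltration (IsSignFamily.isUnitSpace E) hE.isFiltration.monotone
      (fun r S hS => hS.1) hE.isFiltration.isClosed hE.isFiltration.invariant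
      (IsSignFamily.pointInvariant_codimFiltration hG)
  · exact hE.eq_codimFiltration_of_kernelLocalizedAt hF
  · rintro rfl
    exact hE.kernelLocalizedAt_codimFiltration
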